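/- Let $k$ be a field and let $A$ and $B$ be finite-dimensional associative unital $k$-algebras with $A \neq 0$; put $\Lambda = A\otimes_k B$. All modules below are finitely generated. For a finite-dimensional algebra $\Gamma$, let $\Gamma\text{-}\mathsf{Gproj}$ be the full subcategory of Gorenstein projective left $\Gamma$-modules, i.e. of those $G$ isomorphic to $\operatorname{Ker}(d^1)$ for some exact complex $(P^i,d^i)_{i\in\mathbb Z}$ of projective left $\Gamma$-modules such that $\operatorname{Hom}_\Gamma(P^\bullet,\Gamma)$ is exact as well. The algebra $\Gamma$ is Gorenstein if it has finite injective dimension both as a left and as a right module over itself, and $\operatorname{gldim}(\Gamma)$ is the supremum of the projective dimensions of all left $\Gamma$-modules. Write $\operatorname{D}=\operatorname{Hom}_k(-,k)$. Let $\mathrm{Mon}(B,A)$ be the full subcategory of left $\Lambda$-modules $X$ with $\operatorname{Tor}^{\Lambda}_i(A\otimes_k \operatorname{D}(S),X)=0$ for all $i\ge 1$ and all simple left $B$-modules $S$. Let $\mathrm{Mon}(B,A\text{-}\mathsf{Gproj})$ be the full subcategory of those $X\in\mathrm{Mon}(B,A)$ such that the left $A$-module $(A\otimes_k V)\otimes_\Lambda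 X$ is in $A\text{-}\mathsf{Gproj}$ for every right $B$-module $V$. Theorem. Suppose that $B$ is Gorenstein. Then $\Lambda\text{-}\mathsf{Gproj}=\mathrm{Mon}(B,A\text{-}\mathsf{Gproj})$ if and only if $\operatorname{gldim}(B)<\infty$. -/

import Mathlib

open CategoryTheory
open scoped TensorProduct ModuleCat

universe u

noncomputable section

namespace MonRep

/-! ### Tensor products and `Tor` over a noncommutative ring -/

section Tensor

variable (S R : Type u) [Ring S] [Ring R] (M : Type u) [AddCommGroup M] [Module S M]
  [Module Rᵐᵒᵖ M]

/-- The relations `m r ⊗ x = m ⊗ r x` in `M ⊗[ℤ] X`, for an `S`-`R`-bimodule `M` and a left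
`R`-module `X`. When the two actions on `M` commute, the `S`-span of the differences is
their additive span. -/
def balancedRel (X : Type u) [AddCommGroup X] [Module R X] : Submodule S (M ⊗[ℤ] X) :=
  Submodule.span S
    {t | ∃ (m : M) (r : R) (x : X),
      t = (MulOpposite.op r • m) ⊗ₜ[ℤ] x - m ⊗ₜ[ℤ] (r • x)}

/-- The left `S`-module `M ⊗_R X`, for an `S`-`R`-bimodule `M` and a left `R`-module `X`. -/
abbrev BalancedTensor (X : Type u) [AddCommGroup X] [Module R X] : Type u :=
  (M ⊗[ℤ] X) ⧸ balancedRel S R M X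

variable {R} in
/-- The `S`-linear map `M ⊗_R f`. -/
def BalancedTensor.map {X Y : Type u} [AddCommGroup X] [Module R X] [AddCommGroup Y] [Module R Y]
    (f : X →ₗ[R] Y) : BalancedTensor S R M X →ₗ[S] BalancedTensor S R M Y :=
  Submodule.mapQ _ _
    (TensorProduct.AlgebraTensorModule.map (LinearMap.id : M →ₗ[S] M)
      f.toAddMonoidHom.toIntLinearMap)
    (by
      rw [balancedRel, Submodule.span_le]
      rintro _ ⟨m, r, x, rfl⟩
      refine Submodule.subset_span ⟨m, r, f x, ?_⟩
      simp)

theorem BalancedTensor.map_id (X : Type u) [AddCommGroup X] [Module R X] :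
    BalancedTensor.map S M (LinearMap.id : X →ₗ[R] X) = LinearMap.id := by
  refine Submodule.linearMap_qext _ (LinearMap.ext fun t => ?_)
  induction t with
  | zero => rw [_root_.map_zero, _root_.map_zero]
  | add a b ha hb => rw [_root_.map_add, _root_.map_add, ha, hb]
  | tmul m x => rfl

theorem BalancedTensor.map_comp {X Y Z : Type u} [AddCommGroup X] [Module R X] [AddCommGroup Y]
    [Module R Y] [AddCommGroup Z] [Module R Z] (f : X →ₗ[R] Y) (g : Y →ₗ[R] Z) :
    BalancedTensor.map S M (g ∘ₗ f) = BalancedTensor.map S M g ∘ₗ BalancedTensor.map S M f := by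
  refine Submodule.linearMap_qext _ (LinearMap.ext fun t => ?_)
  induction t with
  | zero => rw [_root_.map_zero, _root_.map_zero]
  | add a b ha hb => rw [_root_.map_add, _root_.map_add, ha, hb]
  | tmul m x => rfl

theorem BalancedTensor.map_add {X Y : Type u} [AddCommGroup X] [Module R X] [AddCommGroup Y]
    [Module R Y] (f g : X →ₗ[R] Y) :
    BalancedTensor.map S M (f + g) = BalancedTensor.map S M f + BalancedTensor.map S M g := by
  refine Submodule.linearMap_qext _ (LinearMap.ext fun t => ?_)
  induction t with
  | zero => rw [_root_.map_zero, _root_.map_zero]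
  | add a b ha hb => rw [_root_.map_add, _root_.map_add, ha, hb]
  | tmul m x => exact congrArg Submodule.Quotient.mk (TensorProduct.tmul_add m (f x) (g x))

/-- The functor `M ⊗_R -` from left `R`-modules to left `S`-modules. -/
def tensorFunctor [SMulCommClass S Rᵐᵒᵖ M] :
    ModuleCat.{u} R ⥤ ModuleCat.{u} S where
  obj X := ModuleCat.of S (BalancedTensor S R M X)
  map f := ModuleCat.ofHom (BalancedTensor.map S M f.hom)
  map_id X := ModuleCat.hom_ext (BalancedTensor.map_id S R M X)
  map_comp f g := ModuleCat.hom_ext (BalancedTensor.map_comp S R M f.hom g.hom)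

instance tensorFunctor_additive [SMulCommClass S Rᵐᵒᵖ M] :
    (tensorFunctor S R M).Additive where
  map_add {_ _ f g} := ModuleCat.hom_ext (BalancedTensor.map_add S R M f.hom g.hom)

/-- `Tor_i^R(M, -)`, as a functor from left `R`-modules to left `S`-modules. -/
def torFunctor [SMulCommClass S Rᵐᵒᵖ M] (i : ℕ) : ModuleCat.{u} R ⥤ ModuleCat.{u} S :=
  (tensorFunctor S R M).leftDerived i

end Tensor

/-! ### Homological notions for a ring -/

section Homological

/-- The global dimension: the supremum of the projective dimensions of all finitely generated
left modules. -/
def gldim (R : Type u) [Ring R] : WithBot ℕ∞ :=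
  ⨆ (M : ModuleCat.{u} R) (_ : Module.Finite R M), projectiveDimension M

/-- `R` has finite injective dimension as a left and as a right module over itself. -/
def IsGorenstein (R : Type u) [Ring R] : Prop :=
  injectiveDimension (ModuleCat.of R R) < ⊤ ∧ injectiveDimension (ModuleCat.of Rᵐᵒᵖ R) < ⊤

/-- A complete projective resolution of `G`: an exact complex of finitely generated projective
modules, remaining exact under `Hom_R(-, R)`, with `G` the kernel of `d¹`. -/
structure CompleteProjectiveResolution (R : Type u) [Ring R] (G : ModuleCat.{u} R) where
  P : CochainComplex (ModuleCat.{u} R) ℤ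
  finite : ∀ i, Module.Finite R (P.X i)
  projective : ∀ i, Module.Projective R (P.X i)
  acyclic : P.Acyclic
  hom_exact : ∀ i : ℤ, Function.Exact
    (fun φ : P.X (i + 2) →ₗ[R] R => φ ∘ₗ (P.d (i + 1) (i + 2)).hom)
    (fun φ : P.X (i + 1) →ₗ[R] R => φ ∘ₗ (P.d i (i + 1)).hom)
  iso : G ≃ₗ[R] LinearMap.ker (P.d 1 2).hom

/-- The full subcategory of (finitely generated) Gorenstein projective left `R`-modules. -/
def gproj (R : Type u) [Ring R] : ObjectProperty (ModuleCat.{u} R) := fun G =>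
  Module.Finite R G ∧ Nonempty (CompleteProjectiveResolution R G)

end Homological

/-! ### The dual `D(S)` and the bimodule `A ⊗ V` -/

section Bimodules

variable (k A B : Type u) [Field k] [Ring A] [Algebra k A] [Ring B] [Algebra k B]

/-- The underlying space of `D(S) = Hom_k(S, k)`. -/
def DualSpace (S : ModuleCat.{u} B) : Type u := S →ₗ[k] k

instance (S : ModuleCat.{u} B) : AddCommGroup (DualSpace k B S) :=
  inferInstanceAs (AddCommGroup (S →ₗ[k] k))

/-- The right `B`-action `(f b)(s) = f (b s)` on `D(S)`. -/
instance (S : ModuleCat.{u} B) : Module Bᵐᵒᵖ (DualSpace k B S) where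
  smul b f := (show S →ₗ[k] k from f) ∘ₗ Algebra.lsmul k k S b.unop
  one_smul f := LinearMap.ext fun s => congrArg (show S →ₗ[k] k from f) (one_smul B s)
  mul_smul b c f := LinearMap.ext fun s =>
    congrArg (show S →ₗ[k] k from f) (mul_smul c.unop b.unop s)
  smul_zero _ := rfl
  smul_add _ _ _ := rfl
  add_smul b c f := LinearMap.ext fun s =>
    (congrArg (show S →ₗ[k] k from f) (add_smul b.unop c.unop s)).trans
      (map_add (show S →ₗ[k] k from f) _ _)
  zero_smul f := LinearMap.ext fun s =>
    (congrArg (show S →ₗ[k] k from f) (zero_smul B s)).trans (map_zero (show S →ₗ[k] k from f))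

/-- The right `B`-module `D(S)` of a left `B`-module `S`. -/
def dual (S : ModuleCat.{u} B) : ModuleCat.{u} Bᵐᵒᵖ := ModuleCat.of Bᵐᵒᵖ (DualSpace k B S)

variable {B}

/-- The underlying space of the `A`-`(A ⊗ B)`-bimodule `A ⊗ V`, for a right `B`-module `V`. -/
def Induced (V : ModuleCat.{u} Bᵐᵒᵖ) : Type u := A ⊗[k] V

instance (V : ModuleCat.{u} Bᵐᵒᵖ) : AddCommGroup (Induced k A V) :=
  inferInstanceAs (AddCommGroup (A ⊗[k] V))

/-- The left `A`-action `a (a' ⊗ v) = a a' ⊗ v`. -/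
instance (V : ModuleCat.{u} Bᵐᵒᵖ) : Module A (Induced k A V) :=
  inferInstanceAs (Module A (A ⊗[k] V))

/-- The right action of `A ⊗ B` on `A ⊗ V`, as a homomorphism of algebras. -/
def rightAction (V : ModuleCat.{u} Bᵐᵒᵖ) : (A ⊗[k] B)ᵐᵒᵖ →ₐ[k] Module.End k (A ⊗[k] V) :=
  Module.endTensorEndAlgHom.comp <|
    (Algebra.TensorProduct.map (Algebra.lsmul k k A : Aᵐᵒᵖ →ₐ[k] Module.End k A)
      (Algebra.lsmul k k V : Bᵐᵒᵖ →ₐ[k] Module.End k V)).comp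
    (Algebra.TensorProduct.opAlgEquiv k k A B).symm.toAlgHom

/-- The right action is `(a' ⊗ v) (a ⊗ b) = a' a ⊗ v b`. -/
theorem rightAction_apply (V : ModuleCat.{u} Bᵐᵒᵖ) (a a' : A) (b : B) (v : V) :
    rightAction k A V (MulOpposite.op (a ⊗ₜ[k] b)) (a' ⊗ₜ[k] v) =
      (a' * a) ⊗ₜ[k] (MulOpposite.op b • v) := by
  simp only [rightAction, AlgHom.comp_apply]
  change Module.endTensorEndAlgHom (R := k) (S := k) (A := k) (M := A) (N := V)
    ((Algebra.lsmul k k A (MulOpposite.op a)) ⊗ₜ[k] (Algebra.lsmul k k V (MulOpposite.op b)))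
      (a' ⊗ₜ[k] v) = _
  rw [Module.endTensorEndAlgHom_apply]
  rfl

theorem rightAction_smul (V : ModuleCat.{u} Bᵐᵒᵖ) (a : A) (l : A ⊗[k] B) (t : A ⊗[k] V) :
    rightAction k A V (MulOpposite.op l) (a • t) =
      a • rightAction k A V (MulOpposite.op l) t := by
  induction l with
  | zero => simp
  | add x y hx hy => simp [hx, hy]
  | tmul x b =>
    induction t with
    | zero => simp
    | add s t hs ht => simp [hs, ht]
    | tmul c v =>
      rw [TensorProduct.smul_tmul', rightAction_apply, rightAction_apply,
        TensorProduct.smul_tmul', smul_eq_mul, smul_eq_mul, mul_assoc]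

instance (V : ModuleCat.{u} Bᵐᵒᵖ) : Module (A ⊗[k] B)ᵐᵒᵖ (Induced k A V) :=
  Module.compHom (A ⊗[k] V) (rightAction k A V).toRingHom

instance (V : ModuleCat.{u} Bᵐᵒᵖ) : SMulCommClass A (A ⊗[k] B)ᵐᵒᵖ (Induced k A V) where
  smul_comm a l t := (rightAction_smul k A V a l.unop t).symm

end Bimodules

/-! ### Monomorphism categories -/

section Mon

variable (k A B : Type u) [Field k] [Ring A] [Algebra k A] [Ring B] [Algebra k B]

/-- `Mon(B, A)`: the finitely generated left `A ⊗ B`-modules `X` such that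
`Tor_i(A ⊗ D(S), X) = 0` for all `i ≥ 1` and all simple left `B`-modules `S`. -/
def mon : ObjectProperty (ModuleCat.{u} (A ⊗[k] B)) := fun X =>
  Module.Finite (A ⊗[k] B) X ∧
    ∀ S : ModuleCat.{u} B, IsSimpleModule B S → ∀ i : ℕ, 1 ≤ i →
      Limits.IsZero ((torFunctor A (A ⊗[k] B) (Induced k A (dual k B S)) i).obj X)

variable {A} in
/-- `Mon(B, L)`: the modules `X` in `Mon(B, A)` such that the left `A`-module
`(A ⊗ V) ⊗_{A ⊗ B} X` is in `L` for all finitely generated right `B`-modules `V`. -/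
def monOver (L : ObjectProperty (ModuleCat.{u} A)) :
    ObjectProperty (ModuleCat.{u} (A ⊗[k] B)) := fun X =>
  mon k A B X ∧ ∀ V : ModuleCat.{u} Bᵐᵒᵖ, Module.Finite Bᵐᵒᵖ V →
    L ((tensorFunctor A (A ⊗[k] B) (Induced k A V)).obj X)

end Mon

end MonRep

end

/-!
The theorem compares two descriptions of modules `X` over `Λ = A ⊗ B`.

The category `Mon(B, Gproj A)` consists of the finitely generated `X` that are projective over `B`
and such that `D(N) ⊗_B X` is Gorenstein projective over `A` for all finitely generated left
`B`-modules `N` (`IsMonModule`, `monOver_gproj_iff`). Indeed `Tor_i(A ⊗ V, X)` is `Tor_i^B(V, X)`,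
and its vanishing on the modules `D(S)` means that `B`-linear maps from a syzygy of `X` to simple
modules, hence to all finite-dimensional modules, extend to the projective module that contains it
(`projective_of_isZero_tor`).

Gorenstein projectivity is always established by coinduction: a class of modules in which every
member has a syzygy and a cosyzygy, the latter with the extension property for maps to the ring,
consists of Gorenstein projective modules (`gproj_of_class`). The link between `A` and `Λ` is the
adjunction `Hom_A(D(N) ⊗_B Y, P) = Hom_Λ(Y, P ⊗_k N)` for finite-dimensional `N` (`adjoint`).

* Every `X` in `Mon(B, Gproj A)` is Gorenstein projective, for any `B`
  (`IsMonModule.isGproj`). Embed `D(B) ⊗_B X` into a projective `P` with Gorenstein projective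
  cokernel; the adjoint map `X → P ⊗_k B` is then a cosyzygy. For a finitely generated `N` with free
  presentation `0 → L → B^J → N → 0` it turns into the composite of
  `D(N) ⊗_B X → (D(B) ⊗_B X)^J → P^J`, whose cokernel is an extension of Gorenstein projectives.
* If `gldim B < ∞`, then a Gorenstein projective `Λ`-module is a syzygy of arbitrarily high order
  over `B`, hence projective over `B`. As every `A ⊗_k N` has finite projective dimension over `Λ`,
  maps to it extend along complete resolutions, and by adjunction `D(N) ⊗_B -` preserves these
  (`isMonModule_of_gproj`).
* Conversely, if `M` is Gorenstein projective over `B`, then so is `A ⊗_k M` over `Λ`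
  (`gproj_outer`). If it lies in `Mon(B, Gproj A)`, it is projective over `B`, and so is its direct
  summand `M`. Over a Gorenstein algebra `B` all modules with `Ext^i(M, B) = 0` for `i ≥ 1` are
  Gorenstein projective (`gproj_of_extZero`); if these are projective, the finite injective
  dimension of `B` bounds the projective dimension of all modules (`gldim_lt_top_of_isGorenstein`).
-/


noncomputable section

namespace MonRep

/-! ### Short exact sequences of modules and vanishing of `Ext` -/

section ExtVanishing

variable {R : Type u} [Ring R]

/-- `0 → X → Y → Z → 0` is a short exact sequence of `R`-modules. -/
structure SES {X Y Z : Type u} [AddCommGroup X] [AddCommGroup Y] [AddCommGroup Z]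
    [Module R X] [Module R Y] [Module R Z] (f : X →ₗ[R] Y) (g : Y →ₗ[R] Z) : Prop where
  inj : Function.Injective f
  exact : Function.Exact f g
  surj : Function.Surjective g

/-- The vanishing of `Ext^i_R(X, N)`. -/
def ExtZero (X N : ModuleCat.{u} R) (i : ℕ) : Prop := Subsingleton (Abelian.Ext X N i)

theorem SES.shortExact {X Y Z : ModuleCat.{u} R} {f : X →ₗ[R] Y} {g : Y →ₗ[R] Z} (h : SES f g) :
    (ShortComplex.mk (ModuleCat.ofHom f) (ModuleCat.ofHom g)
      (by ext x; exact h.exact.apply_apply_eq_zero x)).ShortExact where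
  exact := (ShortComplex.ShortExact.moduleCat_exact_iff_function_exact _).2 h.exact
  mono_f := (ModuleCat.mono_iff_injective _).2 h.inj
  epi_g := (ModuleCat.epi_iff_surjective _).2 h.surj

theorem SES.ker {Y Z : Type u} [AddCommGroup Y] [AddCommGroup Z] [Module R Y] [Module R Z]
    {g : Y →ₗ[R] Z} (hg : Function.Surjective g) : SES (LinearMap.ker g).subtype g :=
  ⟨Subtype.val_injective, fun y => by simp, hg⟩

theorem SES.coker {X Y : Type u} [AddCommGroup X] [AddCommGroup Y] [Module R X] [Module R Y]
    {f : X →ₗ[R] Y} (hf : Function.Injective f) : SES f (LinearMap.range f).mkQ :=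
  ⟨hf, fun y => by simp, Submodule.mkQ_surjective _⟩

/-- A map that vanishes on the image of `X` factors through the cokernel `Z`. -/
theorem SES.desc {X Y Z : Type u} [AddCommGroup X] [AddCommGroup Y] [AddCommGroup Z]
    [Module R X] [Module R Y] [Module R Z] {f : X →ₗ[R] Y} {g : Y →ₗ[R] Z} (h : SES f g)
    {W : Type*} [AddCommGroup W] [Module R W] (φ : Y →ₗ[R] W) (hφ : φ ∘ₗ f = 0) :
    ∃ ψ : Z →ₗ[R] W, ψ ∘ₗ g = φ := by
  have hk : LinearMap.ker g ≤ LinearMap.ker φ := by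
    intro y hy
    obtain ⟨x, rfl⟩ := (h.exact y).1 hy
    exact LinearMap.congr_fun hφ x
  refine ⟨(LinearMap.ker g).liftQ φ hk ∘ₗ (g.quotKerEquivOfSurjective h.surj).symm.toLinearMap, ?_⟩
  ext y
  have : (g.quotKerEquivOfSurjective h.surj).symm (g y) = Submodule.Quotient.mk y := by
    rw [LinearEquiv.symm_apply_eq]; rfl
  simp [this]

/-- A map that vanishes in `Z` factors through the kernel `X`. -/
theorem SES.ofLift {X Y Z : Type u} [AddCommGroup X] [AddCommGroup Y] [AddCommGroup Z]
    [Module R X] [Module R Y] [Module R Z] {f : X →ₗ[R] Y} {g : Y →ₗ[R] Z} (h : SES f g)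
    {W : Type*} [AddCommGroup W] [Module R W] (φ : W →ₗ[R] Y) (hφ : g ∘ₗ φ = 0) :
    ∃ ψ : W →ₗ[R] X, f ∘ₗ ψ = φ := by
  have hr : ∀ w, φ w ∈ LinearMap.range f := fun w => (h.exact _).1 (LinearMap.congr_fun hφ w)
  refine ⟨(LinearEquiv.ofInjective f h.inj).symm.toLinearMap ∘ₗ φ.codRestrict _ hr, ?_⟩
  ext w
  have := LinearEquiv.apply_symm_apply (LinearEquiv.ofInjective f h.inj) (φ.codRestrict _ hr w)
  exact congrArg Subtype.val this

/-- In a composite of monomorphisms, the cokernels form a short exact sequence. -/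
theorem SES.third {U E W P C Y : Type u} [AddCommGroup U] [AddCommGroup E]
    [AddCommGroup W] [AddCommGroup P] [AddCommGroup C] [AddCommGroup Y] [Module R U] [Module R E]
    [Module R W] [Module R P] [Module R C] [Module R Y] {α : U →ₗ[R] E} {β : E →ₗ[R] W}
    {φ : E →ₗ[R] P} {π : P →ₗ[R] C} {γ : P →ₗ[R] Y} (h₁ : SES α β) (h₂ : SES φ π)
    (h₃ : SES (φ ∘ₗ α) γ) : ∃ (a : W →ₗ[R] Y) (b : Y →ₗ[R] C), SES a b := by
  obtain ⟨a, ha⟩ := h₁.desc (γ ∘ₗ φ) (LinearMap.ext fun u => h₃.exact.apply_apply_eq_zero u)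
  obtain ⟨b, hb⟩ := h₃.desc π (LinearMap.ext fun u => h₂.exact.apply_apply_eq_zero (α u))
  have ha' : ∀ e, a (β e) = γ (φ e) := LinearMap.congr_fun ha
  have hb' : ∀ p, b (γ p) = π p := LinearMap.congr_fun hb
  refine ⟨a, b, ?_, fun y => ⟨fun hy => ?_, ?_⟩, fun c => ?_⟩
  · rw [injective_iff_map_eq_zero]
    intro w hw
    obtain ⟨e, rfl⟩ := h₁.surj w
    rw [ha'] at hw
    obtain ⟨u, hu⟩ := (h₃.exact _).1 hw
    rw [← h₂.inj hu]
    exact h₁.exact.apply_apply_eq_zero u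
  · obtain ⟨p, rfl⟩ := h₃.surj y
    rw [hb'] at hy
    obtain ⟨e, rfl⟩ := (h₂.exact _).1 hy
    exact ⟨β e, ha' e⟩
  · rintro ⟨w, rfl⟩
    obtain ⟨e, rfl⟩ := h₁.surj w
    rw [ha', hb', h₂.exact.apply_apply_eq_zero]
  · obtain ⟨p, rfl⟩ := h₂.surj c
    exact ⟨γ p, hb' p⟩

variable {X Y Z N : ModuleCat.{u} R} {f : X →ₗ[R] Y} {g : Y →ₗ[R] Z}

theorem ExtZero.eq_zero {i : ℕ} (h : ExtZero X N i) (e : Abelian.Ext X N i) : e = 0 :=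
  h.elim e 0

theorem ExtZero.of_forall {i : ℕ} (h : ∀ e : Abelian.Ext X N i, e = 0) : ExtZero X N i :=
  ⟨fun a b => (h a).trans (h b).symm⟩

theorem extZero_of_projective [Module.Projective R X] (i : ℕ) : ExtZero X N (i + 1) := by
  have : Projective X := (IsProjective.iff_projective X).1 inferInstance
  exact Abelian.Ext.subsingleton_of_projective X N i

theorem SES.extZero_left (h : SES f g) {i : ℕ} (hY : ExtZero Y N i) (hZ : ExtZero Z N (i + 1)) :
    ExtZero X N i := by
  refine .of_forall fun e => ?_
  obtain ⟨x, rfl⟩ := Abelian.Ext.contravariant_sequence_exact₁ h.shortExact N e (add_comm 1 i)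
    (hZ.eq_zero _)
  rw [hY.eq_zero x, Abelian.Ext.comp_zero]

theorem SES.extZero_right (h : SES f g) {i : ℕ} (hX : ExtZero X N i) (hY : ExtZero Y N (i + 1)) :
    ExtZero Z N (i + 1) := by
  refine .of_forall fun e => ?_
  obtain ⟨x, rfl⟩ := Abelian.Ext.contravariant_sequence_exact₃ h.shortExact N e (hY.eq_zero _)
    (add_comm 1 i)
  rw [hX.eq_zero x, Abelian.Ext.comp_zero]

theorem SES.extZero_middle (h : SES f g) {i : ℕ} (hX : ExtZero X N i) (hZ : ExtZero Z N i) :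
    ExtZero Y N i := by
  refine .of_forall fun e => ?_
  obtain ⟨x, rfl⟩ := Abelian.Ext.contravariant_sequence_exact₂ h.shortExact N e (hX.eq_zero _)
  rw [hZ.eq_zero x, Abelian.Ext.comp_zero]

theorem SES.extZero_target_right (h : SES f g) {i : ℕ} (hY : ExtZero N Y i)
    (hX : ExtZero N X (i + 1)) : ExtZero N Z i := by
  refine .of_forall fun e => ?_
  obtain ⟨x, rfl⟩ := Abelian.Ext.covariant_sequence_exact₃ N h.shortExact e rfl (hX.eq_zero _)
  rw [hY.eq_zero x, Abelian.Ext.zero_comp]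

theorem SES.extZero_target_middle (h : SES f g) {i : ℕ} (hX : ExtZero N X i)
    (hZ : ExtZero N Z i) : ExtZero N Y i := by
  refine .of_forall fun e => ?_
  obtain ⟨x, rfl⟩ := Abelian.Ext.covariant_sequence_exact₂ N h.shortExact e (hZ.eq_zero _)
  rw [hX.eq_zero x, Abelian.Ext.zero_comp]

theorem ExtZero.of_retract {i : ℕ} {F : ModuleCat.{u} R} (h : ExtZero X F i) (s : N →ₗ[R] F)
    (p : F →ₗ[R] N) (hps : p ∘ₗ s = LinearMap.id) : ExtZero X N i := by
  refine .of_forall fun e => ?_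
  have : (ModuleCat.ofHom s : N ⟶ F) ≫ ModuleCat.ofHom p = 𝟙 N := by
    ext x; exact LinearMap.congr_fun hps x
  rw [← e.comp_mk₀_id, ← this, ← Abelian.Ext.mk₀_comp_mk₀,
    ← Abelian.Ext.comp_assoc_of_second_deg_zero,
    h.eq_zero (e.comp (Abelian.Ext.mk₀ (ModuleCat.ofHom s)) (add_zero i)), Abelian.Ext.zero_comp]

/-- If `Ext^1(Z, N) = 0`, maps to `N` extend along a monomorphism with cokernel `Z`. -/
theorem SES.exists_extend (h : SES f g) (hZ : ExtZero Z N 1) (φ : X →ₗ[R] N) :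
    ∃ ψ : Y →ₗ[R] N, ψ ∘ₗ f = φ := by
  obtain ⟨x, hx⟩ := Abelian.Ext.contravariant_sequence_exact₁ h.shortExact N
    (Abelian.Ext.mk₀ (ModuleCat.ofHom φ)) (add_comm 1 0) (hZ.eq_zero _)
  refine ⟨(Abelian.Ext.addEquiv₀ x).hom, ?_⟩
  rw [← Abelian.Ext.mk₀_addEquiv₀_apply x, Abelian.Ext.mk₀_comp_mk₀] at hx
  have := Abelian.Ext.addEquiv₀.symm.injective hx
  exact congrArg ModuleCat.Hom.hom this

/-- If `Ext^1(N, X) = 0`, maps from `N` lift along an epimorphism with kernel `X`. -/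
theorem SES.exists_lift (h : SES f g) (hN : ExtZero N X 1) (φ : N →ₗ[R] Z) :
    ∃ ψ : N →ₗ[R] Y, g ∘ₗ ψ = φ := by
  obtain ⟨x, hx⟩ := Abelian.Ext.covariant_sequence_exact₃ N h.shortExact
    (Abelian.Ext.mk₀ (ModuleCat.ofHom φ)) rfl (hN.eq_zero _)
  refine ⟨(Abelian.Ext.addEquiv₀ x).hom, ?_⟩
  rw [← Abelian.Ext.mk₀_addEquiv₀_apply x, Abelian.Ext.mk₀_comp_mk₀] at hx
  have := Abelian.Ext.addEquiv₀.symm.injective hx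
  exact congrArg ModuleCat.Hom.hom this

/-- If `Ext^1(Y, N) = 0`, then `Ext^1(Z, N)` is the obstruction to extending maps from `X` to
`Y`. -/
theorem SES.extZero_of_extend (h : SES f g) (hY : ExtZero Y N 1)
    (H : ∀ φ : X →ₗ[R] N, ∃ ψ : Y →ₗ[R] N, ψ ∘ₗ f = φ) : ExtZero Z N 1 := by
  refine .of_forall fun e => ?_
  obtain ⟨x, rfl⟩ := Abelian.Ext.contravariant_sequence_exact₃ h.shortExact N e (hY.eq_zero _)
    (add_comm 1 0)
  obtain ⟨ψ, hψ⟩ := H (Abelian.Ext.addEquiv₀ x).hom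
  have hx : x = (Abelian.Ext.mk₀ (ModuleCat.ofHom f)).comp
      (Abelian.Ext.mk₀ (ModuleCat.ofHom ψ)) (zero_add 0) := by
    rw [Abelian.Ext.mk₀_comp_mk₀, ← Abelian.Ext.mk₀_addEquiv₀_apply x]
    congr 1
    ext y; exact (LinearMap.congr_fun hψ y).symm
  rw [hx]
  exact (h.shortExact.extClass_comp_assoc _).trans rfl

theorem extZero_pi {i : ℕ} (h : ExtZero X N i) (n : ℕ) :
    ExtZero X (ModuleCat.of R (Fin n → N)) i := by
  induction n with
  | zero =>
    refine .of_forall fun e => ?_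
    have h0 : 𝟙 (ModuleCat.of R (Fin 0 → N)) = 0 :=
      ModuleCat.hom_ext (LinearMap.ext fun x => funext fun i => i.elim0)
    rw [← e.comp_mk₀_id, h0, Abelian.Ext.mk₀_zero, Abelian.Ext.comp_zero]
  | succ n ih =>
    let f : N →ₗ[R] (Fin (n + 1) → N) := LinearMap.single R (fun _ => N) 0
    let g : (Fin (n + 1) → N) →ₗ[R] (Fin n → N) := LinearMap.funLeft R N Fin.succ
    -- `0 → N → N^(n+1) → N^n → 0`
    have s : SES f g := by
      refine ⟨fun a b h => by simpa [f] using congrFun h 0, fun y =>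
        ⟨fun hy => ⟨y 0, ?_⟩, ?_⟩, fun z =>
        ⟨Fin.cons 0 z, by ext i; rfl⟩⟩
      · funext j
        refine Fin.cases ?_ (fun j => ?_) j
        · simp [f]
        · have := congrFun hy j
          simp only [g, LinearMap.funLeft_apply] at this
          simp [f, this]
      · rintro ⟨x, rfl⟩
        funext j
        simp [f, g, LinearMap.funLeft_apply]
    exact SES.extZero_target_middle (X := N) (Y := ModuleCat.of R (Fin (n + 1) → N))
      (Z := ModuleCat.of R (Fin n → N)) s h ih

/-- If `Ext^i(X, R) = 0`, then `Ext^i(X, -)` vanishes on finitely generated projectives. -/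
theorem ExtZero.of_projective {i : ℕ} (h : ExtZero X (ModuleCat.of R R) i)
    [Module.Finite R N] [Module.Projective R N] : ExtZero X N i := by
  obtain ⟨n, p, hp⟩ := Module.Finite.exists_fin' R N
  obtain ⟨s, hs⟩ := Module.projective_lifting_property p LinearMap.id hp
  exact ExtZero.of_retract (F := ModuleCat.of R (Fin n → R)) (extZero_pi h n) s p hs

end ExtVanishing

/-! ### Gorenstein projective modules by coinduction -/

section GorensteinProjective

variable {R : Type u} [Ring R]

variable (R) in
/-- `Y` is a cosyzygy of `X`: there is an exact sequence `0 → X → Q → Y → 0` with `Q` finitely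
generated projective along which every map `X → R` extends to `Q`. -/
def IsCosyzygy (X Y : ModuleCat.{u} R) : Prop :=
  ∃ (Q : ModuleCat.{u} R) (f : X →ₗ[R] Q) (g : Q →ₗ[R] Y), Module.Finite R Q ∧
    Module.Projective R Q ∧ SES f g ∧ ∀ φ : X →ₗ[R] R, ∃ ψ : Q →ₗ[R] R, ψ ∘ₗ f = φ

theorem IsCosyzygy.congr {X X' Y Y' : ModuleCat.{u} R} (h : IsCosyzygy R X Y) (e : X ≃ₗ[R] X')
    (e' : Y ≃ₗ[R] Y') : IsCosyzygy R X' Y' := by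
  obtain ⟨Q, f, g, h1, h2, h3, h4⟩ := h
  refine ⟨Q, f ∘ₗ e.symm.toLinearMap, e'.toLinearMap ∘ₗ g, h1, h2,
    ⟨h3.inj.comp e.symm.injective, fun y => ?_, e'.surjective.comp h3.surj⟩, fun φ => ?_⟩
  · simp only [LinearMap.comp_apply, LinearEquiv.coe_coe, map_eq_zero_iff _ e'.injective,
      h3.exact y]
    exact ⟨fun ⟨x, hx⟩ => ⟨e x, by simpa using hx⟩, fun ⟨x, hx⟩ => ⟨e.symm x, hx⟩⟩
  · obtain ⟨ψ, hψ⟩ := h4 (φ ∘ₗ e.toLinearMap)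
    exact ⟨ψ, by rw [← LinearMap.comp_assoc, hψ]; ext; simp⟩

theorem IsCosyzygy.extZero {X Y : ModuleCat.{u} R} (h : IsCosyzygy R X Y) :
    ExtZero Y (ModuleCat.of R R) 1 := by
  obtain ⟨Q, f, g, h1, h2, h3, h4⟩ := h
  exact h3.extZero_of_extend (extZero_of_projective 0) h4

theorem SES.isCosyzygy {X Q Y : ModuleCat.{u} R} {f : X →ₗ[R] Q} {g : Q →ₗ[R] Y} (h : SES f g)
    [Module.Finite R Q] [Module.Projective R Q] (hY : ExtZero Y (ModuleCat.of R R) 1) :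
    IsCosyzygy R X Y :=
  ⟨Q, f, g, inferInstance, inferInstance, h, h.exists_extend hY⟩

/-- A relation that is serial in both directions has two-sided infinite chains. -/
theorem exists_int_chain {T : Type*} (r : T → T → Prop) (h₁ : ∀ x, ∃ y, r x y)
    (h₂ : ∀ y, ∃ x, r x y) (x : T) : ∃ s : ℤ → T, s 0 = x ∧ ∀ i, r (s i) (s (i + 1)) := by
  choose n hn using h₁
  choose p hp using h₂
  let s : ℤ → T := fun i => match i with
    | Int.ofNat m => n^[m] x
    | Int.negSucc m => p^[m + 1] x
  refine ⟨s, rfl, fun i => ?_⟩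
  match i with
  | Int.ofNat m =>
    have : s (Int.ofNat m + 1) = n (s (Int.ofNat m)) := Function.iterate_succ_apply' n m x
    rw [this]; exact hn _
  | Int.negSucc 0 => exact hp x
  | Int.negSucc (m + 1) =>
    have h : s (Int.negSucc (m + 1)) = p (s (Int.negSucc m)) :=
      Function.iterate_succ_apply' p (m + 1) x
    have h' : Int.negSucc (m + 1) + 1 = Int.negSucc m := by omega
    rw [h, h']; exact hp _

/-- A two-sided infinite chain of cosyzygies splices to a complete projective resolution. -/
theorem gproj_of_chain (s : ℤ → ModuleCat.{u} R) (hs : ∀ i, IsCosyzygy R (s i) (s (i + 1))) :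
    gproj R (s 1) := by
  choose Q f g hfin hproj hses hext using hs
  let d : ∀ n : ℤ, Q n ⟶ Q (n + 1) := fun n => ModuleCat.ofHom (f (n + 1) ∘ₗ g n)
  have hd : ∀ n, d n ≫ d (n + 1) = 0 := fun n => by
    ext x
    change f _ (g _ (f _ (g n x))) = 0
    rw [(hses (n + 1)).exact.apply_apply_eq_zero, map_zero]
  let P : CochainComplex (ModuleCat.{u} R) ℤ := CochainComplex.of Q d hd
  have hPd : ∀ n, P.d n (n + 1) = d n := fun n => CochainComplex.of_d Q d n
  have hex : ∀ i, Function.Exact (P.d i (i + 1)).hom (P.d (i + 1) (i + 1 + 1)).hom := by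
    intro i
    rw [hPd, hPd]
    intro (y : Q (i + 1))
    change f _ (g _ y) = 0 ↔ ∃ x, f _ (g _ x) = y
    rw [map_eq_zero_iff _ (hses _).inj, (hses _).exact y]
    constructor
    · rintro ⟨z, rfl⟩
      obtain ⟨x, rfl⟩ := (hses i).surj z
      exact ⟨x, rfl⟩
    · rintro ⟨x, rfl⟩
      exact ⟨_, rfl⟩
  have hker : ∀ i, Nonempty (s i ≃ₗ[R] LinearMap.ker (P.d i (i + 1)).hom) := by
    intro i
    rw [hPd]
    have hr : LinearMap.ker (d i).hom = LinearMap.range (f i) := by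
      ext y
      change f _ (g _ y) = 0 ↔ _
      rw [map_eq_zero_iff _ (hses _).inj, (hses _).exact y]; rfl
    rw [hr]
    exact ⟨LinearEquiv.ofInjective (f i) (hses i).inj⟩
  refine ⟨Module.Finite.of_surjective (g 0) (hses 0).surj, ⟨⟨P, hfin, hproj, ?_, ?_, ?_⟩⟩⟩
  · intro i
    rw [P.exactAt_iff' (i - 1) i (i + 1) (by simp) (by simp),
      ShortComplex.ShortExact.moduleCat_exact_iff_function_exact]
    have := hex (i - 1)
    generalize hj : i - 1 = j at this
    obtain rfl : i = j + 1 := by omega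
    exact this
  · have key : ∀ i j l : ℤ, i + 1 = j → j + 1 = l → Function.Exact
        (fun φ : P.X l →ₗ[R] R => φ ∘ₗ (P.d j l).hom)
        (fun φ : P.X j →ₗ[R] R => φ ∘ₗ (P.d i j).hom) := by
      rintro i _ _ rfl rfl (φ : Q (i + 1) →ₗ[R] R)
      rw [hPd, hPd]
      constructor
      · intro (h : φ ∘ₗ (f (i + 1) ∘ₗ g i) = 0)
        have h0 : φ ∘ₗ f (i + 1) = 0 := by
          ext z
          obtain ⟨x, rfl⟩ := (hses i).surj z
          exact LinearMap.congr_fun h x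
        obtain ⟨φ', hφ'⟩ := (hses (i + 1)).desc φ h0
        obtain ⟨ψ, hψ⟩ := hext _ φ'
        refine ⟨ψ, ?_⟩
        change ψ ∘ₗ (f _ ∘ₗ g _) = φ
        rw [← LinearMap.comp_assoc, hψ, hφ']
      · rintro ⟨ψ, rfl⟩
        have := congrArg ModuleCat.Hom.hom (hd i)
        change (ψ ∘ₗ (d (i + 1)).hom) ∘ₗ (d i).hom = 0
        rw [LinearMap.comp_assoc]
        rw [ModuleCat.hom_comp] at this
        rw [this, ModuleCat.hom_zero, LinearMap.comp_zero]
    exact fun i => key i (i + 1) (i + 2) rfl (by omega)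
  · exact (hker 1).some

/-- A class of modules closed under cosyzygies in both directions consists of Gorenstein
projective modules. -/
theorem gproj_of_class (C : ModuleCat.{u} R → Prop)
    (h₁ : ∀ X, C X → ∃ Y, C Y ∧ IsCosyzygy R X Y) (h₂ : ∀ Y, C Y → ∃ X, C X ∧ IsCosyzygy R X Y)
    {X : ModuleCat.{u} R} (hX : C X) : gproj R X := by
  obtain ⟨s, h0, hs⟩ := exists_int_chain
    (fun X Y : {X : ModuleCat.{u} R // C X} => IsCosyzygy R X.1 Y.1)
    (fun X => by obtain ⟨Y, hY, h⟩ := h₁ X.1 X.2; exact ⟨⟨Y, hY⟩, h⟩)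
    (fun Y => by obtain ⟨X, hX, h⟩ := h₂ Y.1 Y.2; exact ⟨⟨X, hX⟩, h⟩) ⟨X, hX⟩
  have := gproj_of_chain (fun i => (s (i - 1)).1) (fun i => by
    have := hs (i - 1)
    rwa [show i - 1 + 1 = i + 1 - 1 by ring] at this)
  rw [show (1 : ℤ) - 1 = 0 by norm_num, h0] at this
  exact this

/-- The cocycles of a complete projective resolution are consecutive cosyzygies. -/
theorem CompleteProjectiveResolution.isCosyzygy_ker {G : ModuleCat.{u} R}
    (T : CompleteProjectiveResolution R G) {h i j l m : ℤ} (hi : h + 1 = i) (hj : i + 1 = j)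
    (hl : j + 1 = l) (hm : l + 1 = m) :
    IsCosyzygy R (ModuleCat.of R (LinearMap.ker (T.P.d j l).hom))
      (ModuleCat.of R (LinearMap.ker (T.P.d l m).hom)) := by
  have hex : ∀ i j l : ℤ, i + 1 = j → j + 1 = l →
      Function.Exact (T.P.d i j).hom (T.P.d j l).hom := by
    rintro i _ _ rfl rfl
    have := T.acyclic (i + 1)
    rwa [T.P.exactAt_iff' i (i + 1) (i + 1 + 1) (by simp) (by simp),
      ShortComplex.ShortExact.moduleCat_exact_iff_function_exact] at this
  have hhom : ∀ φ : T.P.X i →ₗ[R] R, φ ∘ₗ (T.P.d h i).hom = 0 →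
      ∃ ψ : T.P.X j →ₗ[R] R, ψ ∘ₗ (T.P.d i j).hom = φ := by
    subst hi
    obtain rfl : j = h + 2 := by omega
    exact fun φ hφ => (T.hom_exact h φ).1 hφ
  have hz : ∀ x, (T.P.d j l).hom x ∈ LinearMap.ker (T.P.d l m).hom := fun x =>
    (hex j _ _ hl hm).apply_apply_eq_zero x
  refine ⟨T.P.X j, Submodule.subtype _, (T.P.d j l).hom.codRestrict _ hz,
    T.finite _, T.projective _, ⟨Subtype.val_injective, fun y => ?_, ?_⟩, fun φ => ?_⟩
  · refine Subtype.ext_iff.trans ?_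
    change (T.P.d j l).hom y = 0 ↔ _
    exact ⟨fun hy => ⟨⟨y, hy⟩, rfl⟩, by rintro ⟨y, rfl⟩; exact y.2⟩
  · rintro ⟨y, hy⟩
    obtain ⟨x, hx⟩ := (hex j _ _ hl hm y).1 hy
    exact ⟨x, Subtype.ext hx⟩
  · have hz' : ∀ x, (T.P.d i j).hom x ∈ LinearMap.ker (T.P.d j l).hom :=
      fun x => (hex i _ _ hj hl).apply_apply_eq_zero x
    obtain ⟨ψ, hψ⟩ := hhom (φ ∘ₗ (T.P.d i j).hom.codRestrict _ hz') (by
      refine LinearMap.ext fun x => ?_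
      have : (T.P.d i j).hom.codRestrict _ hz' ((T.P.d h i).hom x) = 0 :=
        Subtype.ext ((hex h i j hi hj).apply_apply_eq_zero x)
      exact (congrArg φ this).trans (map_zero φ))
    refine ⟨ψ, LinearMap.ext ?_⟩
    rintro ⟨y, hy⟩
    obtain ⟨x, rfl⟩ := (hex i _ _ hj hl y).1 hy
    exact LinearMap.congr_fun hψ x

theorem exists_chain_of_gproj {G : ModuleCat.{u} R} (hG : gproj R G) :
    ∃ s : ℤ → ModuleCat.{u} R, (∀ i, IsCosyzygy R (s i) (s (i + 1))) ∧
      Nonempty (s 1 ≃ₗ[R] G) := by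
  obtain ⟨-, ⟨T⟩⟩ := hG
  have e : ∀ m : ℤ, m = 2 →
      Nonempty (ModuleCat.of R (LinearMap.ker (T.P.d 1 m).hom) ≃ₗ[R] G) := by
    rintro _ rfl
    exact ⟨T.iso.symm⟩
  refine ⟨fun i => ModuleCat.of R (LinearMap.ker (T.P.d i (i + 1)).hom), fun i => ?_,
    e _ (by norm_num)⟩
  exact T.isCosyzygy_ker (h := i - 2) (i := i - 1) (by ring) (by ring) rfl rfl

theorem gproj_of_chain' (s : ℤ → ModuleCat.{u} R) (hs : ∀ i, IsCosyzygy R (s i) (s (i + 1)))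
    (i : ℤ) : gproj R (s i) := by
  have := gproj_of_chain (fun j => s (j + (i - 1))) (fun j => by
    have := hs (j + (i - 1))
    rwa [show j + (i - 1) + 1 = j + 1 + (i - 1) by ring] at this)
  rwa [show 1 + (i - 1) = i by ring] at this

theorem gproj_congr {G G' : ModuleCat.{u} R} (hG : gproj R G) (e : G ≃ₗ[R] G') : gproj R G' := by
  obtain ⟨hf, ⟨T⟩⟩ := hG
  exact ⟨Module.Finite.equiv e, ⟨⟨T.P, T.finite, T.projective, T.acyclic, T.hom_exact,
    e.symm.trans T.iso⟩⟩⟩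

theorem exists_cosyzygy_of_gproj {G : ModuleCat.{u} R} (hG : gproj R G) :
    ∃ Y, gproj R Y ∧ IsCosyzygy R G Y := by
  obtain ⟨s, hs, ⟨e⟩⟩ := exists_chain_of_gproj hG
  exact ⟨_, gproj_of_chain' s hs _, (hs 1).congr e (LinearEquiv.refl R _)⟩

theorem exists_syzygy_of_gproj {G : ModuleCat.{u} R} (hG : gproj R G) :
    ∃ Y, gproj R Y ∧ IsCosyzygy R Y G := by
  obtain ⟨s, hs, ⟨e⟩⟩ := exists_chain_of_gproj hG
  exact ⟨_, gproj_of_chain' s hs 0, (hs 0).congr (LinearEquiv.refl R _) e⟩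

/-- All `Ext^i(G, R)` with `i ≥ 1` are `Ext^1` of iterated syzygies, by dimension shifting. -/
theorem extZero_of_gproj {G : ModuleCat.{u} R} (hG : gproj R G) (i : ℕ) :
    ExtZero G (ModuleCat.of R R) (i + 1) := by
  induction i generalizing G with
  | zero =>
    obtain ⟨K, -, h⟩ := exists_syzygy_of_gproj hG
    exact h.extZero
  | succ i ih =>
    obtain ⟨K, hK, Q, f, g, h1, h2, h3, h4⟩ := exists_syzygy_of_gproj hG
    exact h3.extZero_right (ih hK) (extZero_of_projective _)

/-- Gorenstein projective modules are closed under extensions. Syzygies and cosyzygies of an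
extension are obtained by the horseshoe construction. -/
theorem gproj_of_ses {X Y Z : ModuleCat.{u} R} {f : X →ₗ[R] Y} {g : Y →ₗ[R] Z} (h : SES f g)
    (hX : gproj R X) (hZ : gproj R Z) : gproj R Y := by
  refine gproj_of_class (fun Y => ∃ (X Z : ModuleCat.{u} R) (f : X →ₗ[R] Y) (g : Y →ₗ[R] Z),
    SES f g ∧ gproj R X ∧ gproj R Z) ?_ ?_ ⟨X, Z, f, g, h, hX, hZ⟩
  · rintro Y ⟨X, Z, f, g, h, hX, hZ⟩
    obtain ⟨X', hX', Q₁, i₁, p₁, _, _, s₁, -⟩ := exists_cosyzygy_of_gproj hX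
    obtain ⟨Z', hZ', Q₂, i₂, p₂, _, _, s₂, -⟩ := exists_cosyzygy_of_gproj hZ
    -- `i₁` extends to `Y`, since `Ext¹(Z, -)` vanishes on projectives
    obtain ⟨j, hj⟩ := h.exists_extend (extZero_of_gproj hZ 0).of_projective i₁
    let F : Y →ₗ[R] Q₁ × Q₂ := j.prod (i₂ ∘ₗ g)
    have hF : Function.Injective F := by
      rw [injective_iff_map_eq_zero]
      intro y hy
      have h1 : j y = 0 := congrArg Prod.fst hy
      have h2 : i₂ (g y) = 0 := congrArg Prod.snd hy
      rw [map_eq_zero_iff _ s₂.inj] at h2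
      obtain ⟨x, rfl⟩ := (h.exact y).1 h2
      have h3 : i₁ x = 0 := (LinearMap.congr_fun hj x).symm.trans h1
      rw [map_eq_zero_iff _ s₁.inj] at h3
      rw [h3, map_zero]
    have sF := SES.coker hF
    have hFf : ∀ x, F (f x) = (i₁ x, 0) := fun x =>
      Prod.ext (LinearMap.congr_fun hj x) (by
        change i₂ (g (f x)) = 0
        rw [h.exact.apply_apply_eq_zero, map_zero])
    -- the cokernels form a short exact sequence `0 → X' → Y' → Z' → 0`
    obtain ⟨a, ha⟩ := s₁.desc ((LinearMap.range F).mkQ ∘ₗ LinearMap.inl R Q₁ Q₂) (by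
      ext x
      change Submodule.Quotient.mk (i₁ x, 0) = 0
      rw [← hFf, Submodule.Quotient.mk_eq_zero]
      exact ⟨_, rfl⟩)
    obtain ⟨b, hb⟩ := sF.desc (p₂ ∘ₗ LinearMap.snd R Q₁ Q₂) (by
      ext y
      exact s₂.exact.apply_apply_eq_zero _)
    have sab : SES a b := by
      refine ⟨?_, ?_, ?_⟩
      · rw [injective_iff_map_eq_zero]
        intro x hx
        obtain ⟨q, rfl⟩ := s₁.surj x
        have h1 : Submodule.Quotient.mk (p := LinearMap.range F) (q, 0) = 0 :=
          (LinearMap.congr_fun ha q).symm.trans hx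
        rw [Submodule.Quotient.mk_eq_zero] at h1
        obtain ⟨y, hy⟩ := h1
        have h2 : i₂ (g y) = 0 := congrArg Prod.snd hy
        rw [map_eq_zero_iff _ s₂.inj] at h2
        obtain ⟨x, rfl⟩ := (h.exact y).1 h2
        rw [hFf] at hy
        have : i₁ x = q := congrArg Prod.fst hy
        rw [← this]
        exact s₁.exact.apply_apply_eq_zero x
      · intro c
        obtain ⟨⟨q₁, q₂⟩, rfl⟩ := sF.surj c
        have h1 : b ((LinearMap.range F).mkQ (q₁, q₂)) = p₂ q₂ := LinearMap.congr_fun hb (q₁, q₂)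
        rw [h1, s₂.exact q₂]
        constructor
        · rintro ⟨z, rfl⟩
          obtain ⟨y, rfl⟩ := h.surj z
          refine ⟨p₁ (q₁ - j y), ?_⟩
          refine (LinearMap.congr_fun ha _).trans ?_
          refine (Submodule.Quotient.eq _).2 ⟨-y, ?_⟩
          refine Prod.ext ?_ ?_
          · change j (-y) = q₁ - j y - q₁
            rw [map_neg]; abel
          · change i₂ (g (-y)) = 0 - i₂ (g y)
            rw [map_neg, map_neg]; abel
        · rintro ⟨x, hx⟩
          obtain ⟨q, rfl⟩ := s₁.surj x
          have h2 := (LinearMap.congr_fun ha q).symm.trans hx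
          obtain ⟨y, hy⟩ := (Submodule.Quotient.eq _).1 h2
          have : i₂ (g y) = 0 - q₂ := congrArg Prod.snd hy
          exact ⟨-(g y), by rw [map_neg, this]; abel⟩
      · intro z
        obtain ⟨q, rfl⟩ := s₂.surj z
        exact ⟨(LinearMap.range F).mkQ (0, q), LinearMap.congr_fun hb (0, q)⟩
    refine ⟨ModuleCat.of R _, ⟨X', Z', a, b, sab, hX', hZ'⟩, ?_⟩
    exact SES.isCosyzygy (Q := ModuleCat.of R (Q₁ × Q₂)) sF
      (SES.extZero_middle (X := X') (Z := Z') (Y := ModuleCat.of R _) sab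
        (extZero_of_gproj hX' 0) (extZero_of_gproj hZ' 0))
  · rintro Y ⟨X, Z, f, g, h, hX, hZ⟩
    obtain ⟨X', hX', Q₁, i₁, p₁, _, _, s₁, -⟩ := exists_syzygy_of_gproj hX
    obtain ⟨Z', hZ', Q₂, i₂, p₂, _, _, s₂, -⟩ := exists_syzygy_of_gproj hZ
    obtain ⟨j, hj⟩ := Module.projective_lifting_property g p₂ h.surj
    let F : Q₁ × Q₂ →ₗ[R] Y := (f ∘ₗ p₁).coprod j
    have hgF : ∀ q₁ q₂, g (F (q₁, q₂)) = p₂ q₂ := fun q₁ q₂ => by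
      change g (f (p₁ q₁) + j q₂) = _
      rw [map_add, h.exact.apply_apply_eq_zero, zero_add]
      exact LinearMap.congr_fun hj q₂
    have hF : Function.Surjective F := by
      intro y
      obtain ⟨q₂, hq₂⟩ := s₂.surj (g y)
      have : g (y - j q₂) = 0 := by
        rw [map_sub, ← hq₂, sub_eq_zero]
        exact (LinearMap.congr_fun hj q₂).symm
      obtain ⟨x, hx⟩ := (h.exact _).1 this
      obtain ⟨q₁, rfl⟩ := s₁.surj x
      refine ⟨(q₁, q₂), ?_⟩
      change f (p₁ q₁) + j q₂ = y
      rw [hx]; abel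
    have sF := SES.ker hF
    -- the kernels form a short exact sequence `0 → X' → Y' → Z' → 0`
    obtain ⟨a, ha⟩ := sF.ofLift (LinearMap.inl R Q₁ Q₂ ∘ₗ i₁) (by
      ext x
      change f (p₁ (i₁ x)) + j 0 = 0
      rw [s₁.exact.apply_apply_eq_zero, map_zero, map_zero, add_zero])
    obtain ⟨b, hb⟩ := s₂.ofLift (LinearMap.snd R Q₁ Q₂ ∘ₗ (LinearMap.ker F).subtype) (by
      ext ⟨⟨q₁, q₂⟩, hq⟩
      change p₂ q₂ = 0
      rw [← hgF q₁, show F (q₁, q₂) = 0 from hq, map_zero])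
    have sab : SES a b := by
      refine ⟨?_, ?_, ?_⟩
      · intro x x' hx
        have h1 : ((i₁ x, 0) : Q₁ × Q₂) = (i₁ x', 0) :=
          (LinearMap.congr_fun ha x).symm.trans
            ((congrArg Subtype.val hx).trans (LinearMap.congr_fun ha x'))
        exact s₁.inj (congrArg Prod.fst h1)
      · rintro ⟨⟨q₁, q₂⟩, hq⟩
        have h1 : i₂ (b ⟨(q₁, q₂), hq⟩) = q₂ := LinearMap.congr_fun hb _
        rw [← map_eq_zero_iff _ s₂.inj, h1]
        constructor
        · rintro rfl
          have h2 : f (p₁ q₁) + j 0 = 0 := hq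
          rw [map_zero, add_zero, map_eq_zero_iff _ h.inj, s₁.exact] at h2
          obtain ⟨x, rfl⟩ := h2
          exact ⟨x, Subtype.ext (LinearMap.congr_fun ha x)⟩
        · rintro ⟨x, hx⟩
          have h2 : ((i₁ x, 0) : Q₁ × Q₂) = (q₁, q₂) :=
            (LinearMap.congr_fun ha x).symm.trans (congrArg Subtype.val hx)
          exact (congrArg Prod.snd h2).symm
      · intro z
        have h1 : g (j (i₂ z)) = 0 :=
          (LinearMap.congr_fun hj _).trans (s₂.exact.apply_apply_eq_zero z)
        obtain ⟨x, hx⟩ := (h.exact _).1 h1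
        obtain ⟨q₁, rfl⟩ := s₁.surj x
        have h2 : F (-q₁, i₂ z) = 0 := by
          change f (p₁ (-q₁)) + j (i₂ z) = 0
          rw [map_neg, map_neg, hx]; abel
        refine ⟨⟨(-q₁, i₂ z), h2⟩, s₂.inj ?_⟩
        exact LinearMap.congr_fun hb ⟨(-q₁, i₂ z), h2⟩
    refine ⟨ModuleCat.of R _, ⟨X', Z', a, b, sab, hX', hZ'⟩, ?_⟩
    exact SES.isCosyzygy (Q := ModuleCat.of R (Q₁ × Q₂)) sF
      (SES.extZero_middle (X := X) (Z := Z) (Y := Y) h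
        (extZero_of_gproj hX 0) (extZero_of_gproj hZ 0))

theorem IsCosyzygy.pi {X Y : ModuleCat.{u} R} (h : IsCosyzygy R X Y) (J : Type) [Finite J] :
    IsCosyzygy R (ModuleCat.of R (J → X)) (ModuleCat.of R (J → Y)) := by
  classical
  have := Fintype.ofFinite J
  obtain ⟨Q, f, g, h1, h2, h3, h4⟩ := h
  refine ⟨ModuleCat.of R (J → Q), f.compLeft J, g.compLeft J, inferInstance,
    Module.Projective.of_equiv (DFinsupp.linearEquivFunOnFintype (M := fun _ : J => Q)),
    ⟨h3.inj.comp_left, fun y => ?_, h3.surj.comp_left⟩, fun φ => ?_⟩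
  · constructor
    · intro hy
      choose x hx using fun j => (h3.exact (y j)).1 (congrFun hy j)
      exact ⟨x, funext hx⟩
    · rintro ⟨x, rfl⟩
      exact funext fun j => h3.exact.apply_apply_eq_zero (x j)
  · choose ψ hψ using fun j => h4 (φ ∘ₗ LinearMap.single R (fun _ => X) j)
    refine ⟨∑ j, ψ j ∘ₗ LinearMap.proj j, LinearMap.ext fun x => ?_⟩
    simp only [LinearMap.comp_apply, LinearMap.sum_apply]
    have h5 : ∀ j, ψ j (f (x j)) = φ (Pi.single j (x j)) := fun j =>
      LinearMap.congr_fun (hψ j) (x j)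
    have h6 : x = ∑ j, Pi.single j (x j) := (Finset.univ_sum_single x).symm
    conv_rhs => rw [h6, map_sum]
    exact Finset.sum_congr rfl fun j _ => h5 j

theorem gproj_pi {X : ModuleCat.{u} R} (h : gproj R X) (J : Type) [Finite J] :
    gproj R (ModuleCat.of R (J → X)) := by
  refine gproj_of_class (fun Y => ∃ X : ModuleCat.{u} R, gproj R X ∧ Y = ModuleCat.of R (J → X))
    ?_ ?_ ⟨X, h, rfl⟩
  · rintro _ ⟨X, hX, rfl⟩
    obtain ⟨Y, hY, h⟩ := exists_cosyzygy_of_gproj hX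
    exact ⟨_, ⟨Y, hY, rfl⟩, h.pi J⟩
  · rintro _ ⟨X, hX, rfl⟩
    obtain ⟨Y, hY, h⟩ := exists_syzygy_of_gproj hX
    exact ⟨_, ⟨Y, hY, rfl⟩, h.pi J⟩

variable (R) in
/-- `n`-fold syzygies of Gorenstein projective modules, along arbitrary finitely generated
projective modules. They form a class that is closed under syzygies and cosyzygies. -/
def IsGprojSyzygy : ℕ → ModuleCat.{u} R → Prop
  | 0, K => gproj R K
  | n + 1, K => ∃ (Z P : ModuleCat.{u} R) (f : K →ₗ[R] P) (g : P →ₗ[R] Z), IsGprojSyzygy n Z ∧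
      Module.Finite R P ∧ Module.Projective R P ∧ SES f g

theorem IsGprojSyzygy.extZero {n : ℕ} {K : ModuleCat.{u} R} (h : IsGprojSyzygy R n K) (i : ℕ) :
    ExtZero K (ModuleCat.of R R) (i + 1) := by
  induction n generalizing K i with
  | zero => exact extZero_of_gproj h i
  | succ n ih =>
    obtain ⟨Z, P, f, g, hZ, _, _, s⟩ := h
    exact s.extZero_left (extZero_of_projective i) (ih hZ (i + 1))

theorem IsGprojSyzygy.finite [IsNoetherianRing R] {n : ℕ} {K : ModuleCat.{u} R}
    (h : IsGprojSyzygy R n K) : Module.Finite R K := by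
  cases n with
  | zero => exact h.1
  | succ n =>
    obtain ⟨Z, P, f, g, hZ, _, _, s⟩ := h
    exact Module.Finite.of_injective f s.inj

/-- The kernel of a map from a projective module onto a Gorenstein projective module is
Gorenstein projective. -/
theorem gproj_of_ses_projective [IsNoetherianRing R] {K P Z : ModuleCat.{u} R} {f : K →ₗ[R] P}
    {g : P →ₗ[R] Z} (h : SES f g) [Module.Finite R P] [Module.Projective R P] (hZ : gproj R Z) :
    gproj R K := by
  refine gproj_of_class (fun K => ∃ n, IsGprojSyzygy R n K) ?_ ?_
    ⟨1, Z, P, f, g, hZ, inferInstance, inferInstance, h⟩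
  · rintro K ⟨_ | n, hK⟩
    · obtain ⟨Y, hY, h⟩ := exists_cosyzygy_of_gproj hK
      exact ⟨Y, ⟨0, hY⟩, h⟩
    · obtain ⟨Z, P, f, g, hZ, _, _, s⟩ := hK
      exact ⟨Z, ⟨n, hZ⟩, s.isCosyzygy (hZ.extZero 0)⟩
  · rintro K ⟨n, hK⟩
    have := hK.finite
    obtain ⟨m, p, hp⟩ := Module.Finite.exists_fin' R K
    exact ⟨ModuleCat.of R _, ⟨n + 1, K, ModuleCat.of R _, _, p, hK, inferInstance, inferInstance,
      SES.ker hp⟩, SES.isCosyzygy (Q := ModuleCat.of R _) (SES.ker hp) (hK.extZero 0)⟩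

end GorensteinProjective

/-! ### Finite projective resolutions -/

section FiniteResolutions

variable {R : Type u} [Ring R]

variable (R) in
/-- `N` has a resolution of length `n` by finitely generated projective modules. -/
def HasFiniteProjRes : ℕ → ModuleCat.{u} R → Prop
  | 0, N => Module.Finite R N ∧ Module.Projective R N
  | n + 1, N => ∃ (K P : ModuleCat.{u} R) (f : K →ₗ[R] P) (g : P →ₗ[R] N), HasFiniteProjRes n K ∧
      Module.Finite R P ∧ Module.Projective R P ∧ SES f g

/-- `Ext^i(X, -)` vanishes on modules of finite projective dimension if it vanishes on `R`. -/
theorem HasFiniteProjRes.extZero {X : ModuleCat.{u} R}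
    (hX : ∀ i, ExtZero X (ModuleCat.of R R) (i + 1)) {n : ℕ} {N : ModuleCat.{u} R}
    (h : HasFiniteProjRes R n N) (i : ℕ) : ExtZero X N (i + 1) := by
  induction n generalizing N i with
  | zero =>
    obtain ⟨_, _⟩ := h
    exact (hX i).of_projective
  | succ n ih =>
    obtain ⟨K, P, f, g, hK, _, _, s⟩ := h
    exact s.extZero_target_right (hX i).of_projective (ih hK (i + 1))

theorem hasFiniteProjRes_of_hasProjectiveDimensionLT [IsNoetherianRing R] {n : ℕ}
    {N : ModuleCat.{u} R} (hN : Module.Finite R N) (h : HasProjectiveDimensionLT N (n + 1)) :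
    HasFiniteProjRes R n N := by
  induction n generalizing N with
  | zero =>
    have : Projective N := projective_iff_hasProjectiveDimensionLT_one.2 h
    exact ⟨hN, (IsProjective.iff_projective N).2 this⟩
  | succ n ih =>
    obtain ⟨m, p, hp⟩ := Module.Finite.exists_fin' R N
    have : Projective (ModuleCat.of R (Fin m → R)) :=
      (IsProjective.iff_projective _).1 inferInstance
    have s := SES.shortExact (X := ModuleCat.of R (LinearMap.ker p))
      (Y := ModuleCat.of R (Fin m → R)) (Z := N) (SES.ker hp)
    exact ⟨ModuleCat.of R (LinearMap.ker p), ModuleCat.of R (Fin m → R), _, p,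
      ih (inferInstanceAs (Module.Finite R (LinearMap.ker p)))
        ((s.hasProjectiveDimensionLT_X₃_iff n this).1 h),
      inferInstance, inferInstance, SES.ker hp⟩

/-- A surjection onto a projective module splits, together with its kernel. -/
theorem SES.exists_splitting {X Y Z : Type u} [AddCommGroup X] [AddCommGroup Y] [AddCommGroup Z]
    [Module R X] [Module R Y] [Module R Z] {f : X →ₗ[R] Y} {g : Y →ₗ[R] Z} (h : SES f g)
    [Module.Projective R Z] : ∃ (r : Y →ₗ[R] X) (s : Z →ₗ[R] Y),
      r ∘ₗ f = LinearMap.id ∧ g ∘ₗ s = LinearMap.id ∧ f ∘ₗ r + s ∘ₗ g = LinearMap.id := by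
  obtain ⟨s, hs⟩ := Module.projective_lifting_property g LinearMap.id h.surj
  have hs' : ∀ z, g (s z) = z := LinearMap.congr_fun hs
  obtain ⟨r, hr⟩ := h.ofLift (LinearMap.id - s ∘ₗ g) (by
    ext y
    simp [hs'])
  refine ⟨r, s, LinearMap.ext fun x => h.inj ?_, hs, ?_⟩
  · refine (LinearMap.congr_fun hr (f x)).trans ?_
    simp [h.exact.apply_apply_eq_zero]
  · rw [hr]; abel

theorem projective_left_of_ses {X Y Z : Type u} [AddCommGroup X]
    [AddCommGroup Y] [AddCommGroup Z] [Module R X] [Module R Y] [Module R Z] {f : X →ₗ[R] Y}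
    {g : Y →ₗ[R] Z} (h : SES f g) [Module.Projective R Y] [Module.Projective R Z] :
    Module.Projective R X := by
  obtain ⟨r, s, hr, -, -⟩ := h.exists_splitting
  exact Module.Projective.of_split f r hr

theorem projective_right_of_ses {X Y Z : Type u} [AddCommGroup X]
    [AddCommGroup Y] [AddCommGroup Z] [Module R X] [Module R Y] [Module R Z] {f : X →ₗ[R] Y}
    {g : Y →ₗ[R] Z} (h : SES f g) [Module.Projective R Y] {r : Y →ₗ[R] X}
    (hr : r ∘ₗ f = LinearMap.id) : Module.Projective R Z := by
  obtain ⟨s, hs⟩ := h.desc (LinearMap.id - f ∘ₗ r) (LinearMap.ext fun x => by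
    simp [show r (f x) = x from LinearMap.congr_fun hr x])
  refine Module.Projective.of_split s g (LinearMap.ext fun z => ?_)
  obtain ⟨y, rfl⟩ := h.surj z
  have : s (g y) = y - f (r y) := LinearMap.congr_fun hs y
  rw [LinearMap.comp_apply, this, map_sub, h.exact.apply_apply_eq_zero, sub_zero]; rfl

end FiniteResolutions

/-! ### Modules over finite-dimensional algebras -/

section FiniteDimensional

variable (k : Type u) {R : Type u} [Field k] [Ring R] [Algebra k R]

theorem finiteDimensional_of_finite [FiniteDimensional k R] (X : ModuleCat.{u} R)
    [Module.Finite R X] : FiniteDimensional k X :=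
  Module.Finite.trans R X

theorem finite_of_finiteDimensional (X : ModuleCat.{u} R) [FiniteDimensional k X] :
    Module.Finite R X :=
  Module.Finite.of_restrictScalars_finite k R X

theorem algebraMap_smul_moduleCat (X : ModuleCat.{u} R) (c : k) (x : X) :
    algebraMap k R c • x = c • x := rfl

end FiniteDimensional

/-! ### The outer tensor product of an `A`-module and a `B`-module -/

section Outer

variable (k : Type u) {A B : Type u} [Field k] [Ring A] [Algebra k A] [Ring B] [Algebra k B]

/-- The underlying space `P ⊗_k N` of the outer tensor product. -/
def Outer (P : ModuleCat.{u} A) (N : ModuleCat.{u} B) : Type u := P ⊗[k] N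

instance (P : ModuleCat.{u} A) (N : ModuleCat.{u} B) : AddCommGroup (Outer k P N) :=
  inferInstanceAs (AddCommGroup (P ⊗[k] N))

/-- The action of `A ⊗ B` on `P ⊗_k N`, factor by factor. -/
def outerAction (P : ModuleCat.{u} A) (N : ModuleCat.{u} B) :
    A ⊗[k] B →ₐ[k] Module.End k (P ⊗[k] N) :=
  Module.endTensorEndAlgHom.comp
    (Algebra.TensorProduct.map (Algebra.lsmul k k P : A →ₐ[k] Module.End k P)
      (Algebra.lsmul k k N : B →ₐ[k] Module.End k N))

instance (P : ModuleCat.{u} A) (N : ModuleCat.{u} B) : Module (A ⊗[k] B) (Outer k P N) :=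
  Module.compHom (P ⊗[k] N) (outerAction k P N).toRingHom

/-- The left `A ⊗ B`-module `P ⊗_k N`. -/
def outer (P : ModuleCat.{u} A) (N : ModuleCat.{u} B) : ModuleCat.{u} (A ⊗[k] B) :=
  ModuleCat.of (A ⊗[k] B) (Outer k P N)

variable {P P' : ModuleCat.{u} A} {N N' : ModuleCat.{u} B}

/-- The pure tensor `p ⊗ n`. -/
def outerMk (p : P) (n : N) : outer k P N := (p ⊗ₜ[k] n : P ⊗[k] N)

theorem outer_smul (a : A) (b : B) (p : P) (n : N) :
    (a ⊗ₜ[k] b) • outerMk k p n = outerMk k (a • p) (b • n) := by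
  change Module.endTensorEndAlgHom (R := k) (S := k) (A := k) (M := P) (N := N)
    ((Algebra.lsmul k k P a) ⊗ₜ[k] (Algebra.lsmul k k N b)) (p ⊗ₜ[k] n) = _
  rw [Module.endTensorEndAlgHom_apply]
  rfl

theorem outerMk_add_left (p p' : P) (n : N) :
    outerMk k (p + p') n = outerMk k p n + outerMk k p' n := TensorProduct.add_tmul p p' n

theorem outerMk_add_right (p : P) (n n' : N) :
    outerMk k p (n + n') = outerMk k p n + outerMk k p n' := TensorProduct.tmul_add p n n'

theorem outerMk_zero_left (n : N) : outerMk k (0 : P) n = 0 := TensorProduct.zero_tmul _ n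

theorem outerMk_smul (c : k) (p : P) (n : N) : outerMk k (c • p) n = outerMk k p (c • n) :=
  TensorProduct.smul_tmul c p n

@[elab_as_elim]
theorem outer_induction {motive : outer k P N → Prop} (z : outer k P N) (zero : motive 0)
    (tmul : ∀ p n, motive (outerMk k p n)) (add : ∀ x y, motive x → motive y → motive (x + y)) :
    motive z :=
  TensorProduct.induction_on (motive := motive) z zero tmul add

theorem outer_smul_comm_aux {X Y : ModuleCat.{u} (A ⊗[k] B)} (f : X →+ Y)
    (h : ∀ (a : A) (b : B) (x : X), f ((a ⊗ₜ[k] b) • x) = (a ⊗ₜ[k] b) • f x)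
    (l : A ⊗[k] B) (x : X) : f (l • x) = l • f x := by
  induction l with
  | zero => simp
  | add l l' hl hl' => rw [add_smul, map_add, hl, hl', add_smul]
  | tmul a b => exact h a b x

/-- An additive map between `A ⊗ B`-modules that commutes with pure tensors is linear. -/
def linearOfTmul {X Y : ModuleCat.{u} (A ⊗[k] B)} (f : X →+ Y)
    (h : ∀ (a : A) (b : B) (x : X), f ((a ⊗ₜ[k] b) • x) = (a ⊗ₜ[k] b) • f x) :
    X →ₗ[A ⊗[k] B] Y where
  toFun := f
  map_add' := map_add f
  map_smul' := outer_smul_comm_aux k f h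

/-- A biadditive map, as a homomorphism into homomorphisms. -/
abbrev biadditive {M N W : Type*} [AddCommGroup M] [AddCommGroup N] [AddCommGroup W]
    (β : M → N → W) (h₁ : ∀ v v' y, β (v + v') y = β v y + β v' y)
    (h₂ : ∀ v y y', β v (y + y') = β v y + β v y') : M →+ N →+ W :=
  AddMonoidHom.mk' (fun v => AddMonoidHom.mk' (β v) (h₂ v)) (fun v v' => AddMonoidHom.ext (h₁ v v'))

/-- The additive map on `P ⊗_k N` given by a balanced biadditive map. -/
def outerLift {W : Type u} [AddCommGroup W] (β : P →+ N →+ W)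
    (h : ∀ (c : k) p n, β (c • p) n = β p (c • n)) : outer k P N →+ W :=
  TensorProduct.liftAddHom β h

variable (A B) in
/-- The restriction of an `A ⊗ B`-module to `A`. -/
def resA (Y : ModuleCat.{u} (A ⊗[k] B)) : ModuleCat.{u} A :=
  (ModuleCat.restrictScalars
    (Algebra.TensorProduct.includeLeft : A →ₐ[k] A ⊗[k] B).toRingHom).obj Y

variable (A B) in
/-- The restriction of an `A ⊗ B`-module to `B`. -/
def resB (Y : ModuleCat.{u} (A ⊗[k] B)) : ModuleCat.{u} B :=
  (ModuleCat.restrictScalars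
    (Algebra.TensorProduct.includeRight : B →ₐ[k] A ⊗[k] B).toRingHom).obj Y

variable {k}

/-- The identification of the restriction `resA k A B Y` with `Y`. -/
def outA {Y : ModuleCat.{u} (A ⊗[k] B)} : resA k A B Y ≃+ Y := AddEquiv.refl Y

/-- The identification of the restriction `resB k A B Y` with `Y`. -/
def outB {Y : ModuleCat.{u} (A ⊗[k] B)} : resB k A B Y ≃+ Y := AddEquiv.refl Y

theorem outA_smul {Y : ModuleCat.{u} (A ⊗[k] B)} (a : A) (y : resA k A B Y) :
    outA (a • y) = (a ⊗ₜ[k] (1 : B)) • outA y := rfl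

theorem outB_smul {Y : ModuleCat.{u} (A ⊗[k] B)} (b : B) (y : resB k A B Y) :
    outB (b • y) = ((1 : A) ⊗ₜ[k] b) • outB y := rfl

theorem algebraMap_tmul_one (c : k) :
    algebraMap k A c ⊗ₜ[k] (1 : B) = (1 : A) ⊗ₜ[k] algebraMap k B c := by
  rw [Algebra.algebraMap_eq_smul_one, Algebra.algebraMap_eq_smul_one, TensorProduct.smul_tmul]

theorem outB_smul_k {Y : ModuleCat.{u} (A ⊗[k] B)} (c : k) (y : resB k A B Y) :
    outB (c • y) = c • outB y := by
  change ((1 : A) ⊗ₜ[k] algebraMap k B c) • outB y = algebraMap k (A ⊗[k] B) c • outB y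
  rw [Algebra.TensorProduct.algebraMap_apply, algebraMap_tmul_one]

variable (k)

theorem outer_hom_ext {W : Type*} [AddCommGroup W] {f g : outer k P N →+ W}
    (h : ∀ p n, f (outerMk k p n) = g (outerMk k p n)) : f = g := by
  ext z
  refine outer_induction k z ?_ h (fun x y hx hy => ?_)
  · rw [map_zero, map_zero]
  · rw [map_add, map_add, hx, hy]

/-- The `A ⊗ B`-linear map on `P ⊗_k N` given by a biadditive map that is compatible with the
actions of `A` and `B`. -/
def outerHom {Z : ModuleCat.{u} (A ⊗[k] B)} (β : P → N → Z)
    (h₁ : ∀ p p' n, β (p + p') n = β p n + β p' n) (h₂ : ∀ p n n', β p (n + n') = β p n + β p n')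
    (h : ∀ (a : A) (b : B) p n, β (a • p) (b • n) = (a ⊗ₜ[k] b) • β p n) :
    outer k P N →ₗ[A ⊗[k] B] Z :=
  linearOfTmul k
    (outerLift k
      (biadditive β h₁ h₂)
      (fun c p n => by
        have e₁ := h (algebraMap k A c) 1 p n
        have e₂ := h 1 (algebraMap k B c) p n
        rw [one_smul] at e₁ e₂
        rw [algebraMap_tmul_one] at e₁
        exact e₁.trans e₂.symm))
    (fun a b z => by
      refine outer_induction k z ?_ (fun p n => ?_) (fun x y hx hy => ?_)
      · rw [smul_zero, map_zero, smul_zero]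
      · rw [outer_smul]
        exact h a b p n
      · rw [smul_add, map_add, hx, hy, map_add, smul_add])

/-- The map `P ⊗_k g`. -/
def outerMap (P : ModuleCat.{u} A) (g : N →ₗ[B] N') : outer k P N →ₗ[A ⊗[k] B] outer k P N' :=
  outerHom k (fun p n => outerMk k p (g n)) (fun p p' n => outerMk_add_left k p p' (g n))
    (fun p n n' => by rw [map_add, outerMk_add_right])
    (fun a b p n => by rw [map_smul, outer_smul])

theorem coe_outerMap (P : ModuleCat.{u} A) (g : N →ₗ[B] N') :
    (outerMap k P g : outer k P N → outer k P N') =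
      (LinearMap.lTensor P (g.restrictScalars k) : P ⊗[k] N → P ⊗[k] N') :=
  congrArg DFunLike.coe (outer_hom_ext k (W := outer k P N') (f := (outerMap k P g).toAddMonoidHom)
    (g := (LinearMap.lTensor P (g.restrictScalars k)).toAddMonoidHom) fun _ _ => rfl)

/-- The outer tensor product is exact, since `k` is a field. -/
theorem SES.outerTensor (P : ModuleCat.{u} A) {N₁ N₂ N₃ : ModuleCat.{u} B} {f : N₁ →ₗ[B] N₂}
    {g : N₂ →ₗ[B] N₃} (h : SES f g) : SES (outerMap k P f) (outerMap k P g) where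
  inj := by
    rw [coe_outerMap]
    exact Module.Flat.lTensor_preserves_injective_linearMap (f.restrictScalars k) h.inj
  exact := by
    rw [coe_outerMap, coe_outerMap]
    exact lTensor_exact P (f := f.restrictScalars k) (g := g.restrictScalars k) h.exact h.surj
  surj := by
    rw [coe_outerMap]
    exact LinearMap.lTensor_surjective P (g := g.restrictScalars k) h.surj

theorem outer_finite [FiniteDimensional k A] [FiniteDimensional k B] (P : ModuleCat.{u} A)
    (N : ModuleCat.{u} B) [Module.Finite A P] [Module.Finite B N] :
    Module.Finite (A ⊗[k] B) (outer k P N) := by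
  have := finiteDimensional_of_finite k P
  have := finiteDimensional_of_finite k N
  let e : P ⊗[k] N →ₗ[k] outer k P N :=
    { toFun := fun z => z
      map_add' := fun _ _ => rfl
      map_smul' := fun c z => by
        change c • z = outerAction k P N (algebraMap k (A ⊗[k] B) c) z
        rw [AlgHom.commutes]; rfl }
  have : FiniteDimensional k (outer k P N) :=
    Module.Finite.of_surjective e (fun z => ⟨z, rfl⟩)
  exact finite_of_finiteDimensional k _

/-- An `A ⊗ B`-linear map, as a `B`-linear map. -/
def resBMap {Y Y' : ModuleCat.{u} (A ⊗[k] B)} (f : Y →ₗ[A ⊗[k] B] Y') :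
    resB k A B Y →ₗ[B] resB k A B Y' where
  toFun y := outB.symm (f (outB y))
  map_add' := map_add f
  map_smul' _ _ := f.map_smul _ _

theorem SES.restrictB {X Y Z : ModuleCat.{u} (A ⊗[k] B)} {f : X →ₗ[A ⊗[k] B] Y}
    {g : Y →ₗ[A ⊗[k] B] Z} (h : SES f g) : SES (resBMap k f) (resBMap k g) :=
  ⟨h.inj, h.exact, h.surj⟩

theorem resB_finite [FiniteDimensional k A] [FiniteDimensional k B] (Y : ModuleCat.{u} (A ⊗[k] B))
    [Module.Finite (A ⊗[k] B) Y] : Module.Finite B (resB k A B Y) := by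
  have := finiteDimensional_of_finite k Y
  let e : Y →ₗ[k] resB k A B Y :=
    { toFun := fun y => y
      map_add' := fun _ _ => rfl
      map_smul' := fun c y => (outB_smul_k (Y := Y) c y).symm }
  have : FiniteDimensional k (resB k A B Y) := Module.Finite.of_surjective e fun y => ⟨y, rfl⟩
  exact finite_of_finiteDimensional k _

/-- The `A ⊗ B`-linear map `p ⊗ b ↦ (1 ⊗ b) f(p)` on `P ⊗_k B` given by an `A`-linear map `f`. -/
def outerHomLeft {Z : ModuleCat.{u} (A ⊗[k] B)} (f : P →ₗ[A] resA k A B Z) :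
    outer k P (ModuleCat.of B B) →ₗ[A ⊗[k] B] Z :=
  outerHom k (fun p (b : B) => ((1 : A) ⊗ₜ[k] b) • outA (f p))
    (fun p p' b => by
      rw [map_add, map_add, smul_add])
    (fun p (b b' : B) => by rw [TensorProduct.tmul_add, add_smul])
    (fun a b p (b' : B) => by
      change ((1 : A) ⊗ₜ[k] (b * b')) • outA (f (a • p)) = _
      rw [map_smul, outA_smul, smul_smul, smul_smul, Algebra.TensorProduct.tmul_mul_tmul,
        Algebra.TensorProduct.tmul_mul_tmul, one_mul, mul_one, mul_one])

theorem outerHomLeft_mk {Z : ModuleCat.{u} (A ⊗[k] B)} (f : P →ₗ[A] resA k A B Z) (p : P) (b : B) :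
    outerHomLeft k f (outerMk k p (N := ModuleCat.of B B) b) = ((1 : A) ⊗ₜ[k] b) • outA (f p) := rfl

/-- The `A ⊗ B`-linear map `a ⊗ n ↦ (a ⊗ 1) f(n)` on `A ⊗_k N` given by a `B`-linear map `f`. -/
def outerHomRight {Z : ModuleCat.{u} (A ⊗[k] B)} (f : N →ₗ[B] resB k A B Z) :
    outer k (ModuleCat.of A A) N →ₗ[A ⊗[k] B] Z :=
  outerHom k (fun (a : A) n => (a ⊗ₜ[k] (1 : B)) • outB (f n))
    (fun (a a' : A) n => by rw [TensorProduct.add_tmul, add_smul])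
    (fun (a : A) n n' => by
      rw [map_add, map_add, smul_add])
    (fun a b (a' : A) n => by
      change ((a * a') ⊗ₜ[k] (1 : B)) • outB (f (b • n)) = _
      rw [map_smul, outB_smul, smul_smul, smul_smul, Algebra.TensorProduct.tmul_mul_tmul,
        Algebra.TensorProduct.tmul_mul_tmul, one_mul, mul_one, mul_one])

theorem outer_hom_ext_linear {Z : ModuleCat.{u} (A ⊗[k] B)} {f g : outer k P N →ₗ[A ⊗[k] B] Z}
    (h : ∀ p n, f (outerMk k p n) = g (outerMk k p n)) : f = g :=
  LinearMap.ext fun z => DFunLike.congr_fun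
    (outer_hom_ext k (f := f.toAddMonoidHom) (g := g.toAddMonoidHom) h) z

/-- Maps out of `P ⊗_k B` are `A`-linear maps out of `P`, so they lift when `P` is projective. -/
theorem outer_projective_left (P : ModuleCat.{u} A) [Module.Projective A P] :
    Module.Projective (A ⊗[k] B) (outer k P (ModuleCat.of B B)) := by
  refine Module.Projective.of_lifting_property fun {M N} _ _ _ _ f g hf => ?_
  let M' := ModuleCat.of (A ⊗[k] B) M
  let N' := ModuleCat.of (A ⊗[k] B) N
  let g₀ : P →ₗ[A] resA k A B N' :=
    { toFun := fun p => g (outerMk k p (N := ModuleCat.of B B) (1 : B))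
      map_add' := fun p p' => by rw [outerMk_add_left, map_add]; rfl
      map_smul' := fun a p => by
        have := outer_smul k a (1 : B) p (1 : ModuleCat.of B B)
        rw [one_smul] at this
        rw [← this, map_smul]; rfl }
  let f₀ : resA k A B M' →ₗ[A] resA k A B N' :=
    { toFun := fun p => outA.symm (f (outA (Y := M') p))
      map_add' := map_add f
      map_smul' := fun a p => f.map_smul (a ⊗ₜ[k] (1 : B)) p }
  obtain ⟨h₀, hh⟩ := Module.projective_lifting_property f₀ g₀ hf
  refine ⟨outerHomLeft k (Z := M') h₀, outer_hom_ext_linear k (Z := N') fun p (b : B) => ?_⟩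
  have h1 : f (outA (h₀ p)) = g (outerMk k p (N := ModuleCat.of B B) (1 : B)) :=
    LinearMap.congr_fun hh p
  change f (((1 : A) ⊗ₜ[k] b) • outA (h₀ p)) = _
  rw [map_smul, h1, ← map_smul, outer_smul, one_smul]
  change g (outerMk k p (b * 1)) = _
  rw [mul_one]

/-- Maps out of `A ⊗_k N` are `B`-linear maps out of `N`, so they lift when `N` is projective. -/
theorem outer_projective_right (N : ModuleCat.{u} B) [Module.Projective B N] :
    Module.Projective (A ⊗[k] B) (outer k (ModuleCat.of A A) N) := by
  refine Module.Projective.of_lifting_property fun {M M₂} _ _ _ _ f g hf => ?_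
  let M' := ModuleCat.of (A ⊗[k] B) M
  let N' := ModuleCat.of (A ⊗[k] B) M₂
  let g₀ : N →ₗ[B] resB k A B N' :=
    { toFun := fun n => g (outerMk k (P := ModuleCat.of A A) (1 : A) n)
      map_add' := fun p p' => by rw [outerMk_add_right, map_add]; rfl
      map_smul' := fun b p => by
        have := outer_smul k (1 : A) b (1 : ModuleCat.of A A) p
        rw [one_smul] at this
        rw [← this, map_smul]; rfl }
  let f₀ : resB k A B M' →ₗ[B] resB k A B N' :=
    { toFun := fun p => outB.symm (f (outB (Y := M') p))
      map_add' := map_add f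
      map_smul' := fun b p => f.map_smul ((1 : A) ⊗ₜ[k] b) p }
  obtain ⟨h₀, hh⟩ := Module.projective_lifting_property f₀ g₀ hf
  refine ⟨outerHomRight k (Z := M') h₀, outer_hom_ext_linear k (Z := N') fun (a : A) n => ?_⟩
  have h1 : f (outB (h₀ n)) = g (outerMk k (P := ModuleCat.of A A) (1 : A) n) :=
    LinearMap.congr_fun hh n
  change f ((a ⊗ₜ[k] (1 : B)) • outB (h₀ n)) = _
  rw [map_smul, h1, ← map_smul, outer_smul, one_smul]
  change g (outerMk k (P := ModuleCat.of A A) (a * 1) n) = _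
  rw [mul_one]

variable (A B) in
/-- The regular module `A ⊗ B` as an outer tensor product. -/
def outerRegularEquiv : ModuleCat.of (A ⊗[k] B) (A ⊗[k] B) ≃ₗ[A ⊗[k] B]
    outer k (ModuleCat.of A A) (ModuleCat.of B B) :=
  LinearEquiv.ofLinearMap
    (LinearMap.toSpanSingleton (A ⊗[k] B) (outer k (ModuleCat.of A A) (ModuleCat.of B B))
      (outerMk k (P := ModuleCat.of A A) (N := ModuleCat.of B B) (1 : A) (1 : B)))
    (outerHom k (Z := ModuleCat.of (A ⊗[k] B) (A ⊗[k] B)) (fun (a : A) (b : B) => a ⊗ₜ[k] b)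
      (fun (a a' : A) (b : B) => TensorProduct.add_tmul a a' b)
      (fun (a : A) (b b' : B) => TensorProduct.tmul_add a b b')
      (fun a b (a' : A) (b' : B) => (Algebra.TensorProduct.tmul_mul_tmul a a' b b').symm))
    (outer_hom_ext_linear k fun (a : A) (b : B) => by
      change (a ⊗ₜ[k] b) • outerMk k (P := ModuleCat.of A A) (N := ModuleCat.of B B) (1 : A)
        (1 : B) = outerMk k (P := ModuleCat.of A A) (N := ModuleCat.of B B) a b
      rw [outer_smul]
      change outerMk k (P := ModuleCat.of A A) (N := ModuleCat.of B B) (a * 1) (b * 1) = _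
      rw [mul_one, mul_one])
    (LinearMap.ext_ring (by
      rw [LinearMap.comp_apply, LinearMap.toSpanSingleton_apply, one_smul]
      rfl))

end Outer

/-! ### The functors `(A ⊗ V) ⊗_{A ⊗ B} -` -/

section InducedTensor

variable (k : Type u) {A B : Type u} [Field k] [Ring A] [Algebra k A] [Ring B] [Algebra k B]

/-- The left `A`-module `(A ⊗ V) ⊗_{A ⊗ B} Y`, which is `V ⊗_B Y` with its `A`-action. -/
abbrev indTensor (V : ModuleCat.{u} Bᵐᵒᵖ) (Y : ModuleCat.{u} (A ⊗[k] B)) : ModuleCat.{u} A :=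
  (tensorFunctor A (A ⊗[k] B) (Induced k A V)).obj Y

variable {V V' : ModuleCat.{u} Bᵐᵒᵖ} {X Y Z : ModuleCat.{u} (A ⊗[k] B)}

variable (A) in
/-- The element `1 ⊗ v` of `A ⊗ V`. -/
def indMk (V : ModuleCat.{u} Bᵐᵒᵖ) : V →+ Induced k A V :=
  (TensorProduct.mk k A V 1).toAddMonoidHom

theorem smul_indMk (a : A) (v : V) : a • indMk k A V v = (a ⊗ₜ[k] v : A ⊗[k] V) := by
  change a • ((1 : A) ⊗ₜ[k] v) = _
  rw [TensorProduct.smul_tmul', smul_eq_mul, mul_one]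

theorem op_smul_indMk (a : A) (b : B) (v : V) :
    MulOpposite.op (a ⊗ₜ[k] b) • indMk k A V v = a • indMk k A V (MulOpposite.op b • v) := by
  rw [smul_indMk]
  refine (rightAction_apply k A V a 1 b v).trans ?_
  rw [one_mul]

/-- The pure tensor `v ⊗ y` of `V ⊗_B Y`, as the class of `(1 ⊗ v) ⊗ y`. -/
def pure (v : V) (y : Y) : indTensor k V Y :=
  Submodule.Quotient.mk (indMk k A V v ⊗ₜ[ℤ] y)

theorem pure_add_left (v v' : V) (y : Y) : pure k (v + v') y = pure k v y + pure k v' y := by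
  unfold pure
  rw [map_add, TensorProduct.add_tmul]; rfl

theorem pure_add_right (v : V) (y y' : Y) : pure k v (y + y') = pure k v y + pure k v y' := by
  unfold pure
  rw [TensorProduct.tmul_add]; rfl

theorem balanced_mk (m : Induced k A V) (l : A ⊗[k] B) (y : Y) :
    (Submodule.Quotient.mk ((MulOpposite.op l • m) ⊗ₜ[ℤ] y) : indTensor k V Y) =
      Submodule.Quotient.mk (m ⊗ₜ[ℤ] (l • y)) :=
  (Submodule.Quotient.eq _).2 (Submodule.subset_span ⟨m, l, y, rfl⟩)

theorem pure_smul_right (a : A) (b : B) (v : V) (y : Y) :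
    pure k v ((a ⊗ₜ[k] b) • y) = a • pure k (MulOpposite.op b • v) y := by
  unfold pure
  rw [← balanced_mk, op_smul_indMk]; rfl

@[elab_as_elim]
theorem indTensor_induction {motive : indTensor k V Y → Prop} (z : indTensor k V Y)
    (pure : ∀ v y, motive (pure k v y)) (add : ∀ x y, motive x → motive y → motive (x + y)) :
    motive z := by
  have zero : motive 0 := by
    have := pure 0 0
    unfold MonRep.pure at this
    rwa [TensorProduct.tmul_zero] at this
  obtain ⟨t, rfl⟩ := Submodule.Quotient.mk_surjective _ z
  induction t with
  | zero => exact zero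
  | add s t hs ht => exact add _ _ hs ht
  | tmul m y =>
    refine TensorProduct.induction_on (motive := fun m : A ⊗[k] V =>
      motive (Submodule.Quotient.mk ((show Induced k A V from m) ⊗ₜ[ℤ] y))) m ?_ (fun a v => ?_)
      (fun m m' hm hm' => ?_)
    · change motive (Submodule.Quotient.mk ((0 : Induced k A V) ⊗ₜ[ℤ] y))
      rwa [TensorProduct.zero_tmul]
    · have := pure v ((a ⊗ₜ[k] (1 : B)) • y)
      rw [pure_smul_right, MulOpposite.op_one, one_smul] at this
      unfold MonRep.pure at this
      rw [← smul_indMk]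
      exact this
    · change motive (Submodule.Quotient.mk
        (((show Induced k A V from m) + (show Induced k A V from m')) ⊗ₜ[ℤ] y))
      rw [TensorProduct.add_tmul]
      exact add _ _ hm hm'

/-- The additive map on `V ⊗_B Y` given by a `B`-balanced biadditive map. -/
def indLift {W : Type u} [AddCommGroup W] (β : V →+ Y →+ W)
    (h : ∀ (b : B) v y, β (MulOpposite.op b • v) y = β v (((1 : A) ⊗ₜ[k] b) • y)) :
    indTensor k V Y →+ W :=
  let γ : Induced k A V →+ Y →+ W := TensorProduct.liftAddHom
    (AddMonoidHom.mk' (fun a : A => AddMonoidHom.mk' (fun v => AddMonoidHom.mk'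
        (fun y => β v ((a ⊗ₜ[k] (1 : B)) • y)) (fun y y' => by rw [smul_add, map_add]))
        (fun v v' => by ext y; simp))
      (fun a a' => by ext v y; simp [TensorProduct.add_tmul, add_smul]))
    (fun c a v => by
      ext y
      change β v (((c • a) ⊗ₜ[k] (1 : B)) • y) =
        β (MulOpposite.op (algebraMap k B c) • v) ((a ⊗ₜ[k] (1 : B)) • y)
      rw [h, smul_smul, Algebra.TensorProduct.tmul_mul_tmul, one_mul, mul_one,
        TensorProduct.smul_tmul, Algebra.algebraMap_eq_smul_one])
  have hγ : ∀ (a : A) (v : V) (y : Y),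
      γ (a • indMk k A V v) y = β v ((a ⊗ₜ[k] (1 : B)) • y) := fun a v y => by
    rw [smul_indMk]; rfl
  have hγ' : ∀ (m : Induced k A V) (l : A ⊗[k] B) (y : Y),
      γ (MulOpposite.op l • m) y = γ m (l • y) := by
    intro m l y
    induction l with
    | zero => simp
    | add l l' hl hl' =>
      rw [MulOpposite.op_add, add_smul, add_smul, map_add, map_add, ← hl, ← hl']; rfl
    | tmul a b =>
      refine TensorProduct.induction_on (motive := fun m : A ⊗[k] V =>
        γ (MulOpposite.op (a ⊗ₜ[k] b) • (show Induced k A V from m)) y =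
          γ (show Induced k A V from m) ((a ⊗ₜ[k] b) • y)) m ?_ (fun a' v => ?_)
        (fun m m' hm hm' => ?_)
      · change γ (MulOpposite.op (a ⊗ₜ[k] b) • (0 : Induced k A V)) y =
          γ (0 : Induced k A V) ((a ⊗ₜ[k] b) • y)
        rw [smul_zero, map_zero]; rfl
      · rw [← smul_indMk]
        change γ (MulOpposite.op (a ⊗ₜ[k] b) • a' • indMk k A V v) y =
          γ (a' • indMk k A V v) ((a ⊗ₜ[k] b) • y)
        rw [← smul_comm a' (MulOpposite.op (a ⊗ₜ[k] b)), op_smul_indMk, smul_smul, hγ, hγ, h,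
          smul_smul, smul_smul, Algebra.TensorProduct.tmul_mul_tmul,
          Algebra.TensorProduct.tmul_mul_tmul, one_mul, mul_one, one_mul]
      · change γ (MulOpposite.op (a ⊗ₜ[k] b) • ((show Induced k A V from m) +
          (show Induced k A V from m'))) y = γ ((show Induced k A V from m) +
          (show Induced k A V from m')) ((a ⊗ₜ[k] b) • y)
        rw [smul_add, map_add, map_add, AddMonoidHom.add_apply, AddMonoidHom.add_apply, hm, hm']
  let δ : Induced k A V ⊗[ℤ] Y →+ W := TensorProduct.liftAddHom γ
    (fun n m y => by rw [map_zsmul, map_zsmul]; rfl)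
  QuotientAddGroup.lift (balancedRel A (A ⊗[k] B) (Induced k A V) Y).toAddSubgroup δ (by
    -- the relations are closed under the action of `A`, so their `A`-span is in the kernel
    suffices H : ∀ t ∈ balancedRel A (A ⊗[k] B) (Induced k A V) Y, ∀ a : A, δ (a • t) = 0 by
      intro t ht
      have := H t ht 1
      rwa [one_smul] at this
    intro t ht
    induction ht using Submodule.span_induction with
    | mem t ht =>
      obtain ⟨m, l, y, rfl⟩ := ht
      intro a
      rw [smul_sub, TensorProduct.smul_tmul', TensorProduct.smul_tmul', smul_comm, map_sub,
        sub_eq_zero]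
      exact hγ' _ _ _
    | zero => intro a; rw [smul_zero, map_zero]
    | add x y _ _ hx hy => intro a; rw [smul_add, map_add, hx, hy, add_zero]
    | smul a x _ hx => intro a'; rw [smul_smul]; exact hx _)

theorem indLift_pure {W : Type u} [AddCommGroup W] (β : V →+ Y →+ W)
    (h : ∀ (b : B) v y, β (MulOpposite.op b • v) y = β v (((1 : A) ⊗ₜ[k] b) • y)) (v : V) (y : Y) :
    indLift k β h (pure k v y) = β v y := by
  change β v (((1 : A) ⊗ₜ[k] (1 : B)) • y) = β v y
  congr 1
  exact one_smul (A ⊗[k] B) y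

theorem indTensor_hom_ext {W : Type*} [AddCommGroup W] {f g : indTensor k V Y →+ W}
    (h : ∀ v y, f (pure k v y) = g (pure k v y)) : f = g := by
  ext z
  refine indTensor_induction k z h (fun x y hx hy => ?_)
  rw [map_add, map_add, hx, hy]

theorem smul_pure (a : A) (v : V) (y : Y) :
    a • pure k v y = pure k v ((a ⊗ₜ[k] (1 : B)) • y) := by
  rw [pure_smul_right, MulOpposite.op_one, one_smul]

theorem pure_balanced (b : B) (v : V) (y : Y) :
    pure k (MulOpposite.op b • v) y = pure k v (((1 : A) ⊗ₜ[k] b) • y) := by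
  rw [pure_smul_right, one_smul]

theorem biadditive_balanced {W : ModuleCat.{u} A} (β : V → Y → W)
    (h₁ : ∀ v v' y, β (v + v') y = β v y + β v' y) (h₂ : ∀ v y y', β v (y + y') = β v y + β v y')
    (h : ∀ (a : A) (b : B) v y, β v ((a ⊗ₜ[k] b) • y) = a • β (MulOpposite.op b • v) y)
    (b : B) (v : V) (y : Y) : biadditive β h₁ h₂ (MulOpposite.op b • v) y =
      biadditive β h₁ h₂ v (((1 : A) ⊗ₜ[k] b) • y) :=
  ((h 1 b v y).trans (one_smul A _)).symm

/-- The `A`-linear map on `V ⊗_B Y` given by a biadditive map that is `B`-balanced and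
`A`-linear in the second variable. -/
def indHom {W : ModuleCat.{u} A} (β : V → Y → W)
    (h₁ : ∀ v v' y, β (v + v') y = β v y + β v' y) (h₂ : ∀ v y y', β v (y + y') = β v y + β v y')
    (h : ∀ (a : A) (b : B) v y, β v ((a ⊗ₜ[k] b) • y) = a • β (MulOpposite.op b • v) y) :
    indTensor k V Y →ₗ[A] W :=
  { toFun := indLift k (biadditive β h₁ h₂) (biadditive_balanced k β h₁ h₂ h)
    map_add' := map_add _
    map_smul' := fun a z => by
      refine indTensor_induction k z (fun v y => ?_) (fun x y hx hy => ?_)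
      · rw [smul_pure, indLift_pure, indLift_pure]
        refine (h a 1 v y).trans ?_
        rw [MulOpposite.op_one, one_smul]
        rfl
      · rw [smul_add, map_add, hx, hy, map_add, smul_add] }

theorem indHom_pure {W : ModuleCat.{u} A} (β : V → Y → W)
    (h₁ : ∀ v v' y, β (v + v') y = β v y + β v' y) (h₂ : ∀ v y y', β v (y + y') = β v y + β v y')
    (h : ∀ (a : A) (b : B) v y, β v ((a ⊗ₜ[k] b) • y) = a • β (MulOpposite.op b • v) y)
    (v : V) (y : Y) : indHom k β h₁ h₂ h (pure k v y) = β v y :=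
  indLift_pure k _ (biadditive_balanced k β h₁ h₂ h) v y

theorem indTensor_hom_ext_linear {W : ModuleCat.{u} A} {f g : indTensor k V Y →ₗ[A] W}
    (h : ∀ v y, f (pure k v y) = g (pure k v y)) : f = g :=
  LinearMap.ext fun z => DFunLike.congr_fun
    (indTensor_hom_ext k (f := f.toAddMonoidHom) (g := g.toAddMonoidHom) h) z

/-- The map `V ⊗_B f`. -/
abbrev indMap (V : ModuleCat.{u} Bᵐᵒᵖ) (f : X →ₗ[A ⊗[k] B] Y) :
    indTensor k V X →ₗ[A] indTensor k V Y :=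
  BalancedTensor.map A (Induced k A V) f

theorem indMap_pure (f : X →ₗ[A ⊗[k] B] Y) (v : V) (x : X) :
    indMap k V f (pure k v x) = pure k v (f x) := rfl

theorem indMap_comp (g : Y →ₗ[A ⊗[k] B] Z) (f : X →ₗ[A ⊗[k] B] Y)
    (z : indTensor k V X) : indMap k V (g ∘ₗ f) z = indMap k V g (indMap k V f z) :=
  LinearMap.congr_fun (BalancedTensor.map_comp A (A ⊗[k] B) (Induced k A V) f g) z

/-- The map `g ⊗_B Y`. -/
def indMapLeft (Y : ModuleCat.{u} (A ⊗[k] B)) (g : V →ₗ[Bᵐᵒᵖ] V') :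
    indTensor k V Y →ₗ[A] indTensor k V' Y :=
  indHom k (fun v y => pure k (g v) y) (fun v v' y => by rw [map_add, pure_add_left])
    (fun v y y' => pure_add_right k (g v) y y')
    (fun a b v y => by rw [pure_smul_right, map_smul])

theorem indMapLeft_pure (g : V →ₗ[Bᵐᵒᵖ] V') (v : V) (y : Y) :
    indMapLeft k Y g (pure k v y) = pure k (g v) y := indHom_pure k _ _ _ _ v y

/-- The map `V ⊗_B f` for a map `f` that is only `B`-linear. -/
def indMapB (V : ModuleCat.{u} Bᵐᵒᵖ) (f : resB k A B X →ₗ[B] resB k A B Y) :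
    indTensor k V X →+ indTensor k V Y :=
  indLift k (AddMonoidHom.mk' (fun v => AddMonoidHom.mk'
      (fun x => pure k v (outB (f (outB.symm x))))
      (fun x x' => by rw [map_add, map_add, map_add, pure_add_right]))
      (fun v v' => by ext x; exact pure_add_left k v v' _))
    (fun b v x => by
      change pure k (MulOpposite.op b • v) (outB (f (outB.symm x))) =
        pure k v (outB (f (b • (outB.symm x))))
      rw [map_smul, outB_smul, pure_balanced])

theorem indMapB_pure (f : resB k A B X →ₗ[B] resB k A B Y) (v : V) (x : X) :
    indMapB k V f (pure k v x) = pure k v (outB (f (outB.symm x))) := indLift_pure k _ _ v x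

theorem indMapB_comp (g : resB k A B Y →ₗ[B] resB k A B Z) (f : resB k A B X →ₗ[B] resB k A B Y)
    (z : indTensor k V X) : indMapB k V (g ∘ₗ f) z = indMapB k V g (indMapB k V f z) :=
  DFunLike.congr_fun (indTensor_hom_ext k (f := indMapB k V (g ∘ₗ f))
    (g := (indMapB k V g).comp (indMapB k V f)) fun v y => by
      simp [indMapB_pure]) z

theorem indMapB_add (f g : resB k A B X →ₗ[B] resB k A B Y) (z : indTensor k V X) :
    indMapB k V (f + g) z = indMapB k V f z + indMapB k V g z :=
  DFunLike.congr_fun (indTensor_hom_ext k (f := indMapB k V (f + g))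
    (g := indMapB k V f + indMapB k V g) fun v y => by
      simp [indMapB_pure, pure_add_right]) z

theorem indMapB_id (z : indTensor k V X) :
    indMapB k V (LinearMap.id : resB k A B X →ₗ[B] resB k A B X) z = z :=
  DFunLike.congr_fun (indTensor_hom_ext k (f := indMapB k V LinearMap.id)
    (g := AddMonoidHom.id _) fun v y => by simp [indMapB_pure]) z

theorem indMapB_resBMap (f : X →ₗ[A ⊗[k] B] Y) (z : indTensor k V X) :
    indMapB k V (resBMap k f) z = indMap k V f z :=
  DFunLike.congr_fun (indTensor_hom_ext k (f := indMapB k V (resBMap k f))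
    (g := (indMap k V f).toAddMonoidHom) fun v y => indMapB_pure k _ v y) z

theorem indMap_surjective {f : X →ₗ[A ⊗[k] B] Y} (hf : Function.Surjective f) :
    Function.Surjective (indMap k V f) := by
  intro z
  refine indTensor_induction k z (fun v y => ?_) ?_
  · obtain ⟨x, rfl⟩ := hf y
    exact ⟨pure k v x, rfl⟩
  · rintro _ _ ⟨x, rfl⟩ ⟨y, rfl⟩
    exact ⟨x + y, map_add _ _ _⟩

theorem indMap_injective_of_retraction {f : X →ₗ[A ⊗[k] B] Y}
    {r : resB k A B Y →ₗ[B] resB k A B X} (h : r ∘ₗ resBMap k f = LinearMap.id) :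
    Function.Injective (indMap k V f) := by
  refine Function.LeftInverse.injective (g := indMapB k V r) fun z => ?_
  rw [← indMapB_resBMap, ← indMapB_comp, h, indMapB_id]

/-- `V ⊗_B -` is exact on short exact sequences whose last term is projective over `B`. -/
theorem SES.tensorRight {f : X →ₗ[A ⊗[k] B] Y} {g : Y →ₗ[A ⊗[k] B] Z} (h : SES f g)
    [Module.Projective B (resB k A B Z)] (V : ModuleCat.{u} Bᵐᵒᵖ) :
    SES (indMap k V f) (indMap k V g) := by
  obtain ⟨r, s, hr, hs, hrs⟩ := (h.restrictB k).exists_splitting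
  refine ⟨indMap_injective_of_retraction k hr, fun z => ⟨fun hz => ?_, ?_⟩,
    indMap_surjective k h.surj⟩
  · refine ⟨indMapB k V r z, ?_⟩
    have := indMapB_id k (V := V) z
    rw [← hrs, indMapB_add, indMapB_comp, indMapB_comp, indMapB_resBMap, indMapB_resBMap, hz,
      map_zero, add_zero] at this
    exact this
  · rintro ⟨z, rfl⟩
    refine indTensor_induction k z (fun v y => ?_) (fun x y hx hy => ?_)
    · rw [indMap_pure, indMap_pure, h.exact.apply_apply_eq_zero]
      exact congrArg Submodule.Quotient.mk (TensorProduct.tmul_zero _ _)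
    · rw [map_add, map_add, hx, hy, add_zero]

end InducedTensor

/-! ### Duality between left and right modules -/

section Duality

variable (k : Type u) {B : Type u} [Field k] [Ring B] [Algebra k B]

variable {N N' : ModuleCat.{u} B}

/-- Elements of `D(N)` as linear forms. -/
def dualForm : dual k B N ≃+ (N →ₗ[k] k) := AddEquiv.refl _

theorem dualForm_op_smul (b : B) (ξ : dual k B N) (n : N) :
    dualForm k (MulOpposite.op b • ξ) n = dualForm k ξ (b • n) := rfl

theorem dualForm_smul (c : k) (ξ : dual k B N) (n : N) :
    dualForm k (c • ξ) n = c * dualForm k ξ n := by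
  change dualForm k ξ (c • n) = _
  rw [map_smul, smul_eq_mul]

/-- Evaluation of an element of `D(N)`, as an additive map. -/
def dualEval (ξ : dual k B N) : N →+ k := (dualForm k ξ).toAddMonoidHom

theorem dual_ext {ξ ξ' : dual k B N} (h : ∀ n, dualForm k ξ n = dualForm k ξ' n) : ξ = ξ' :=
  (dualForm k).injective (LinearMap.ext h)

theorem dualForm_sum {J : Type*} (s : Finset J) (ξ : J → dual k B N) (n : N) :
    dualForm k (∑ j ∈ s, ξ j) n = ∑ j ∈ s, dualForm k (ξ j) n := by
  rw [map_sum, LinearMap.sum_apply]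

theorem eq_of_dualForm {n n' : N} (h : ∀ ξ : dual k B N, dualForm k ξ n = dualForm k ξ n') :
    n = n' := by
  rw [← sub_eq_zero]
  refine (Module.forall_dual_apply_eq_zero_iff k (n - n')).1 fun f => ?_
  have := h ((dualForm k).symm f)
  rw [AddEquiv.apply_symm_apply] at this
  rw [map_sub, this, sub_self]

/-- The `i`-th coordinate form of a basis, as an element of `D(N)`. -/
def coordDual {ι : Type*} (e : Module.Basis ι k N) (i : ι) : dual k B N :=
  (dualForm k).symm (e.coord i)

theorem sum_smul_coordDual {ι : Type*} [Fintype ι] (e : Module.Basis ι k N) (ξ : dual k B N) :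
    ∑ i, dualForm k ξ (e i) • coordDual k e i = ξ := by
  refine dual_ext k fun n => ?_
  rw [map_sum, LinearMap.sum_apply]
  conv_rhs => rw [← e.sum_repr n, map_sum]
  refine Finset.sum_congr rfl fun i _ => ?_
  rw [dualForm_smul, map_smul, smul_eq_mul, mul_comm]
  rfl

/-- A family of functionals `δ ξ` on `W` that depends `B`-linearly on `ξ ∈ D(N)` comes from a
`B`-linear map `W → N`, when `N` is finite-dimensional. -/
theorem exists_linearMap_of_dual [FiniteDimensional k N] {W : ModuleCat.{u} B}
    (δ : dual k B N → W → k) (h₁ : ∀ ξ ξ' w, δ (ξ + ξ') w = δ ξ w + δ ξ' w)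
    (h₂ : ∀ ξ w w', δ ξ (w + w') = δ ξ w + δ ξ w') (h₃ : ∀ (c : k) ξ w, δ (c • ξ) w = c * δ ξ w)
    (h₄ : ∀ (b : B) ξ w, δ (MulOpposite.op b • ξ) w = δ ξ (b • w)) :
    ∃ h : W →ₗ[B] N, ∀ ξ w, dualForm k ξ (h w) = δ ξ w := by
  let e := Module.finBasis k N
  let h₀ : W → N := fun w => ∑ i, δ (coordDual k e i) w • e i
  have key : ∀ ξ w, dualForm k ξ (h₀ w) = δ ξ w := by
    intro ξ w
    have h₁' : ∀ (s : Finset (Fin (Module.finrank k N))) (f : _ → dual k B N),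
        δ (∑ i ∈ s, f i) w = ∑ i ∈ s, δ (f i) w := fun s f =>
      map_sum (AddMonoidHom.mk' (fun ξ => δ ξ w) (fun ξ ξ' => h₁ ξ ξ' w)) f s
    conv_rhs => rw [← sum_smul_coordDual k e ξ, h₁']
    rw [map_sum]
    refine Finset.sum_congr rfl fun i _ => ?_
    rw [h₃, map_smul, smul_eq_mul, mul_comm]
  refine ⟨⟨⟨h₀, fun w w' => eq_of_dualForm k fun ξ => ?_⟩, fun b w => eq_of_dualForm k fun ξ => ?_⟩,
    key⟩
  · rw [map_add, key, key, key, h₂]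
  · change dualForm k ξ (h₀ (b • w)) = dualForm k ξ (b • h₀ w)
    rw [← dualForm_op_smul, key, key, h₄]

/-- The transpose of a `B`-linear map. -/
def dualMap (g : N →ₗ[B] N') : dual k B N' →ₗ[Bᵐᵒᵖ] dual k B N where
  toFun ξ := (dualForm k).symm (dualForm k ξ ∘ₗ g.restrictScalars k)
  map_add' _ _ := rfl
  map_smul' b ξ := dual_ext k fun n => congrArg (dualForm k ξ) (g.map_smul b.unop n).symm

theorem dualForm_dualMap (g : N →ₗ[B] N') (ξ : dual k B N') (n : N) :
    dualForm k (dualMap k g ξ) n = dualForm k ξ (g n) := rfl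

theorem SES.dual {N₁ N₂ N₃ : ModuleCat.{u} B} {f : N₁ →ₗ[B] N₂} {g : N₂ →ₗ[B] N₃} (h : SES f g) :
    SES (dualMap k g) (dualMap k f) := by
  refine ⟨?_, fun ξ => ⟨fun hξ => ?_, ?_⟩, fun ξ => ?_⟩
  · intro ξ ξ' hξ
    refine dual_ext k fun n => ?_
    obtain ⟨m, rfl⟩ := h.surj n
    exact LinearMap.congr_fun (congrArg (dualForm k) hξ) m
  · have s : SES (f.restrictScalars k) (g.restrictScalars k) := ⟨h.inj, h.exact, h.surj⟩
    obtain ⟨ψ, hψ⟩ := s.desc (dualForm k ξ) (congrArg (dualForm k) hξ)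
    exact ⟨(dualForm k).symm ψ, (dualForm k).injective hψ⟩
  · rintro ⟨ζ, rfl⟩
    refine dual_ext k fun n => ?_
    rw [dualForm_dualMap, dualForm_dualMap, h.exact.apply_apply_eq_zero, map_zero]; rfl
  · obtain ⟨l, hl⟩ := LinearMap.exists_leftInverse_of_injective (f.restrictScalars k)
      (LinearMap.ker_eq_bot.2 h.inj)
    refine ⟨(dualForm k).symm (dualForm k ξ ∘ₗ l), dual_ext k fun n => ?_⟩
    exact congrArg (dualForm k ξ) (LinearMap.congr_fun hl n)

/-- A right-linear map between dual modules is a transpose. -/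
theorem exists_dualMap_eq [FiniteDimensional k N'] (ρ : dual k B N' →ₗ[Bᵐᵒᵖ] dual k B N) :
    ∃ s : N →ₗ[B] N', dualMap k s = ρ := by
  obtain ⟨s, hs⟩ := exists_linearMap_of_dual k (W := N) (fun ξ n => dualForm k (ρ ξ) n)
    (fun ξ ξ' n => by rw [map_add, map_add]; rfl) (fun ξ n n' => map_add _ _ _)
    (fun c ξ n => by rw [← dualForm_smul, ← algebraMap_smul_moduleCat, map_smul]; rfl)
    (fun b ξ n => by rw [map_smul, dualForm_op_smul])
  exact ⟨s, LinearMap.ext fun ξ => dual_ext k fun n => hs ξ n⟩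

/-- The underlying space of the left module `Hom_k(V, k)` of a right module `V`. -/
def PredualSpace (V : ModuleCat.{u} Bᵐᵒᵖ) : Type u := V →ₗ[k] k

variable (V : ModuleCat.{u} Bᵐᵒᵖ)

instance : AddCommGroup (PredualSpace k V) := inferInstanceAs (AddCommGroup (V →ₗ[k] k))

/-- The left `B`-action `(b f)(v) = f(v b)`. -/
instance : Module B (PredualSpace k V) where
  smul b f := (show V →ₗ[k] k from f) ∘ₗ Algebra.lsmul k k V (MulOpposite.op b)
  one_smul f := LinearMap.ext fun v => congrArg (show V →ₗ[k] k from f) (one_smul Bᵐᵒᵖ v)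
  mul_smul b c f := LinearMap.ext fun v =>
    congrArg (show V →ₗ[k] k from f) (mul_smul (MulOpposite.op c) (MulOpposite.op b) v)
  smul_zero _ := rfl
  smul_add _ _ _ := rfl
  add_smul b c f := LinearMap.ext fun v =>
    (congrArg (show V →ₗ[k] k from f) (add_smul (MulOpposite.op b) (MulOpposite.op c) v)).trans
      (map_add (show V →ₗ[k] k from f) _ _)
  zero_smul f := LinearMap.ext fun v =>
    (congrArg (show V →ₗ[k] k from f) (zero_smul Bᵐᵒᵖ v)).trans
      (map_zero (show V →ₗ[k] k from f))

/-- The left module `Hom_k(V, k)` of a right module `V`. -/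
def predual : ModuleCat.{u} B := ModuleCat.of B (PredualSpace k V)

variable {V}

/-- Elements of the predual as linear forms. -/
def predualForm : predual k V ≃+ (V →ₗ[k] k) := AddEquiv.refl _

theorem predualForm_smul_k (c : k) (f : predual k V) (v : V) :
    predualForm k (c • f) v = c * predualForm k f v := by
  change predualForm k f (c • v) = _
  rw [map_smul, smul_eq_mul]

theorem predual_ext {f f' : predual k V} (h : ∀ v, predualForm k f v = predualForm k f' v) :
    f = f' :=
  (predualForm k).injective (LinearMap.ext h)

/-- Elements of the predual as linear forms, as a `k`-linear equivalence. -/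
def predualFormₗ : predual k V ≃ₗ[k] (V →ₗ[k] k) where
  __ := predualForm k
  map_smul' c f := LinearMap.ext fun v => predualForm_smul_k k c f v

variable (V) in
/-- Evaluation `V → D(Hom_k(V, k))`. -/
def evalDual : V →ₗ[Bᵐᵒᵖ] dual k B (predual k V) where
  toFun v := (dualForm k).symm (Module.Dual.eval k V v ∘ₗ (predualFormₗ k).toLinearMap)
  map_add' v v' := dual_ext k fun f => map_add (predualForm k f) v v'
  map_smul' _ _ := rfl

theorem evalDual_bijective [FiniteDimensional k V] : Function.Bijective (evalDual k V) := by
  constructor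
  · intro v v' h
    rw [← sub_eq_zero]
    refine (Module.forall_dual_apply_eq_zero_iff k (v - v')).1 fun f => ?_
    have : predualForm k ((predualForm k).symm f) v = predualForm k ((predualForm k).symm f) v' :=
      LinearMap.congr_fun (congrArg (dualForm k) h) ((predualForm k).symm f)
    rw [AddEquiv.apply_symm_apply] at this
    rw [map_sub, this, sub_self]
  · intro ζ
    obtain ⟨v, hv⟩ := (Module.evalEquiv k V).surjective
      (dualForm k ζ ∘ₗ (predualFormₗ k).symm.toLinearMap)
    refine ⟨v, dual_ext k fun f => ?_⟩
    have := LinearMap.congr_fun hv (predualFormₗ k f)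
    rw [LinearMap.comp_apply, LinearEquiv.coe_coe, LinearEquiv.symm_apply_apply] at this
    exact this

variable (V) in
/-- A finite-dimensional right module is the dual of its predual. -/
def evalDualEquiv [FiniteDimensional k V] : V ≃ₗ[Bᵐᵒᵖ] dual k B (predual k V) :=
  LinearEquiv.ofBijective (evalDual k V) (evalDual_bijective k)

instance finiteDimensional_predual [FiniteDimensional k V] : FiniteDimensional k (predual k V) :=
  Module.Finite.equiv (predualFormₗ k).symm

theorem dual_finiteDimensional [FiniteDimensional k N] : FiniteDimensional k (dual k B N) := by
  let e : (N →ₗ[k] k) →ₗ[k] dual k B N :=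
    { toFun := (dualForm k).symm
      map_add' := fun _ _ => rfl
      map_smul' := fun c f => dual_ext k fun n =>
        (dualForm_smul k c ((dualForm k).symm f) n).symm }
  exact Module.Finite.of_surjective e (dualForm k).symm.surjective

/-- The map `X → Hom_k(V, k)` corresponding to a map `V → D(X)`. -/
def transpose {X : ModuleCat.{u} B} {V : ModuleCat.{u} Bᵐᵒᵖ} (q : V →ₗ[Bᵐᵒᵖ] dual k B X) :
    X →ₗ[B] predual k V where
  toFun x := (predualForm k).symm
    { toFun := fun v => dualForm k (q v) x
      map_add' := fun v v' => by rw [map_add, map_add]; rfl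
      map_smul' := fun c v => by
        rw [← algebraMap_smul_moduleCat, map_smul]
        exact dualForm_smul k c _ x }
  map_add' x x' := predual_ext k fun v => map_add (dualForm k (q v)) x x'
  map_smul' b x := predual_ext k fun v => by
    change dualForm k (q v) (b • x) = dualForm k (q (MulOpposite.op b • v)) x
    rw [q.map_smul, dualForm_op_smul]

theorem transpose_injective {X : ModuleCat.{u} B} {V : ModuleCat.{u} Bᵐᵒᵖ}
    {q : V →ₗ[Bᵐᵒᵖ] dual k B X} (hq : Function.Surjective q) :
    Function.Injective (transpose k q) := fun x x' h =>
  eq_of_dualForm k fun ξ => by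
    obtain ⟨v, rfl⟩ := hq ξ
    exact LinearMap.congr_fun (congrArg (predualForm k) h) v

/-- The dual of a projective module is injective: maps `V → D(P)` are maps `P → Hom_k(V, k)`, and
`Hom_k(-, k)` is exact. -/
theorem dual_injective (P : ModuleCat.{u} B) [Module.Projective B P] :
    Injective (dual k B P) := by
  refine ⟨fun {X Y} f i hi => ?_⟩
  have hi' : Function.Injective i.hom := (ModuleCat.mono_iff_injective i).1 hi
  let F : P →ₗ[B] predual k X := transpose k f.hom
  let q : predual k Y →ₗ[B] predual k X :=
    { toFun := fun g => (predualForm k).symm (predualForm k g ∘ₗ i.hom.restrictScalars k)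
      map_add' := fun _ _ => rfl
      map_smul' := fun b g => predual_ext k fun x =>
        congrArg (predualForm k g) (i.hom.map_smul (MulOpposite.op b) x).symm }
  have hq : Function.Surjective q := by
    intro g
    obtain ⟨l, hl⟩ := LinearMap.exists_leftInverse_of_injective (i.hom.restrictScalars k)
      (LinearMap.ker_eq_bot.2 hi')
    exact ⟨(predualForm k).symm (predualForm k g ∘ₗ l), predual_ext k fun x =>
      congrArg (predualForm k g) (LinearMap.congr_fun hl x)⟩
  obtain ⟨G, hG⟩ := Module.projective_lifting_property q F hq
  refine ⟨ModuleCat.ofHom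
    { toFun := fun y => (dualForm k).symm
        { toFun := fun p => predualForm k (G p) y
          map_add' := fun p p' => by rw [map_add, map_add]; rfl
          map_smul' := fun c p => by
            rw [← algebraMap_smul_moduleCat, map_smul]
            exact predualForm_smul_k k c _ y }
      map_add' := fun y y' => dual_ext k fun p => map_add (predualForm k (G p)) y y'
      map_smul' := fun b y => dual_ext k fun p => by
        change predualForm k (G p) (b • y) = predualForm k (G (b.unop • p)) y
        rw [G.map_smul]; rfl }, ?_⟩
  ext x
  refine dual_ext k fun p => ?_
  exact LinearMap.congr_fun (congrArg (predualForm k) (LinearMap.congr_fun hG p)) x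

/-- The transpose of a surjection `B^n → N` splits, and the splitting is itself a transpose. -/
theorem projective_of_dual_injective [FiniteDimensional k B] [Module.Finite B N]
    (h : Injective (dual k B N)) : Module.Projective B N := by
  obtain ⟨n, p, hp⟩ := Module.Finite.exists_fin' B N
  let F := ModuleCat.of B (Fin n → B)
  have := finiteDimensional_of_finite k F
  have s := SES.dual k (N₁ := ModuleCat.of B (LinearMap.ker p)) (N₂ := F) (N₃ := N) (SES.ker hp)
  let i : dual k B N ⟶ dual k B F := ModuleCat.ofHom (dualMap k (N := F) (N' := N) p)
  have hi : Mono i := (ModuleCat.mono_iff_injective _).2 s.inj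
  have hρ := Injective.comp_factorThru (𝟙 _) i
  obtain ⟨t, ht⟩ := exists_dualMap_eq k (Injective.factorThru (𝟙 _) i).hom
  refine Module.Projective.of_split (M := F) t p
    (LinearMap.ext fun n => eq_of_dualForm k fun ξ => ?_)
  have h1 : (Injective.factorThru (𝟙 _) i).hom (i.hom ξ) = ξ :=
    LinearMap.congr_fun (congrArg ModuleCat.Hom.hom hρ) ξ
  rw [← ht] at h1
  exact LinearMap.congr_fun (congrArg (dualForm k) h1) n

/-- Duality turns finite injective dimension into finite projective dimension. -/
theorem hasProjectiveDimensionLT_of_dual [FiniteDimensional k B] {n : ℕ} [Module.Finite B N]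
    (h : HasInjectiveDimensionLT (dual k B N) (n + 1)) : HasProjectiveDimensionLT N (n + 1) := by
  have : IsNoetherianRing B := IsNoetherianRing.of_finite k B
  induction n generalizing N with
  | zero =>
    have := projective_of_dual_injective k (injective_iff_hasInjectiveDimensionLT_one.2 h)
    exact projective_iff_hasProjectiveDimensionLT_one.1 ((IsProjective.iff_projective N).1 this)
  | succ n ih =>
    obtain ⟨m, p, hp⟩ := Module.Finite.exists_fin' B N
    let F := ModuleCat.of B (Fin m → B)
    let K := ModuleCat.of B (LinearMap.ker p)
    have hF : Module.Projective B F := inferInstanceAs (Module.Projective B (Fin m → B))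
    have hK : Module.Finite B K := inferInstanceAs (Module.Finite B (LinearMap.ker p))
    have s : SES (R := B) (X := K) (Y := F) (Z := N) (LinearMap.ker p).subtype p := SES.ker hp
    have : Projective F := (IsProjective.iff_projective _).1 hF
    have s' := SES.dual k (N₁ := K) (N₂ := F) (N₃ := N) s
    have h' : HasInjectiveDimensionLT (dual k B K) (n + 1) :=
      (s'.shortExact.hasInjectiveDimensionLT_X₃_iff n (dual_injective k F)).2 h
    exact (SES.shortExact (X := K) (Y := F) (Z := N) s).hasProjectiveDimensionLT_X₃_iff n this |>.2
      (ih h')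

end Duality

/-! ### The adjunction between `D(N) ⊗_B -` and the outer tensor product with `N` -/

section Adjunction

variable (k : Type u) {A B : Type u} [Field k] [Ring A] [Algebra k A] [Ring B] [Algebra k B]

variable {P : ModuleCat.{u} A} {N N' : ModuleCat.{u} B} {X Y Z : ModuleCat.{u} (A ⊗[k] B)}

/-- The contraction `P ⊗_k N → P` with a form `ξ` on `N`. -/
def contr (ξ : dual k B N) : outer k P N →+ P :=
  outerLift k (biadditive (fun p n => dualForm k ξ n • p) (fun p p' n => smul_add _ p p')
    (fun p n n' => by rw [map_add, add_smul]))
    (fun c p n => by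
      change dualForm k ξ n • c • p = dualForm k ξ (c • n) • p
      rw [map_smul, smul_smul, smul_eq_mul, mul_comm])

theorem contr_mk (ξ : dual k B N) (p : P) (n : N) :
    contr k ξ (outerMk k p n) = dualForm k ξ n • p := rfl

theorem contr_add (ξ ξ' : dual k B N) (z : outer k P N) :
    contr k (ξ + ξ') z = contr k ξ z + contr k ξ' z :=
  DFunLike.congr_fun (outer_hom_ext k (f := contr k (ξ + ξ')) (g := contr k ξ + contr k ξ')
    fun p n => by
      rw [AddMonoidHom.add_apply, contr_mk, contr_mk, contr_mk, map_add, LinearMap.add_apply,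
        add_smul]) z

theorem contr_smul (ξ : dual k B N) (a : A) (b : B) (z : outer k P N) :
    contr k ξ ((a ⊗ₜ[k] b) • z) = a • contr k (MulOpposite.op b • ξ) z := by
  refine outer_induction k z ?_ (fun p n => ?_) (fun x y hx hy => ?_)
  · rw [smul_zero, map_zero, map_zero, smul_zero]
  · rw [outer_smul, contr_mk, contr_mk, dualForm_op_smul, smul_comm]
  · rw [smul_add, map_add, hx, hy, map_add, smul_add]

theorem sum_contr_coordDual {ι : Type*} [Fintype ι] (e : Module.Basis ι k N) (z : outer k P N) :
    ∑ i, outerMk k (contr k (coordDual k e i) z) (e i) = z := by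
  refine outer_induction k z ?_ (fun p n => ?_) (fun x y hx hy => ?_)
  · refine Finset.sum_eq_zero fun i _ => ?_
    rw [map_zero, outerMk_zero_left]
  · have : ∀ i, outerMk k (contr k (coordDual k e i) (outerMk k p n)) (e i) =
        outerMk k p (e.coord i n • e i) := fun i => by
      rw [contr_mk, outerMk_smul]; rfl
    simp only [this]
    conv_rhs => rw [← e.sum_repr n]
    exact (map_sum (AddMonoidHom.mk' (outerMk k p) (outerMk_add_right k p)) _ _).symm
  · conv_rhs => rw [← hx, ← hy]
    rw [← Finset.sum_add_distrib]
    refine Finset.sum_congr rfl fun i _ => ?_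
    rw [map_add, outerMk_add_left]

/-- Elements of `P ⊗_k N` are determined by their contractions with the forms on `N`. -/
theorem eq_of_contr [FiniteDimensional k N] {z z' : outer k P N}
    (h : ∀ ξ : dual k B N, contr k ξ z = contr k ξ z') : z = z' := by
  rw [← sum_contr_coordDual k (Module.finBasis k N) z,
    ← sum_contr_coordDual k (Module.finBasis k N) z']
  simp only [h]

theorem pure_smul_k {V : ModuleCat.{u} Bᵐᵒᵖ} (c : k) (v : V) (y : Y) :
    pure k (c • v) y = c • pure k v y := by
  change pure k (MulOpposite.op (algebraMap k B c) • v) y = algebraMap k A c • pure k v y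
  rw [pure_balanced, smul_pure, algebraMap_tmul_one]

theorem outerMk_smul_left (c : k) (p : P) (n : N) :
    outerMk k (c • p) n = c • outerMk k p n := by
  change _ = algebraMap k (A ⊗[k] B) c • outerMk k p n
  rw [Algebra.TensorProduct.algebraMap_apply, outer_smul, one_smul]; rfl

/-- The pure tensor map, as a biadditive homomorphism. -/
def pureHom (V : ModuleCat.{u} Bᵐᵒᵖ) (Y : ModuleCat.{u} (A ⊗[k] B)) : V →+ Y →+ indTensor k V Y :=
  biadditive (pure k) (pure_add_left k) (pure_add_right k)

theorem pureHom_apply {V : ModuleCat.{u} Bᵐᵒᵖ} (v : V) (y : Y) : pureHom k V Y v y = pure k v y :=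
  rfl

theorem pure_sum_left {ι : Type*} (s : Finset ι) {V : ModuleCat.{u} Bᵐᵒᵖ} (f : ι → V) (y : Y) :
    pure k (∑ i ∈ s, f i) y = ∑ i ∈ s, pure k (f i) y := by
  simp only [← pureHom_apply]
  rw [map_sum, AddMonoidHom.finsetSum_apply]

theorem pure_sum_right {ι : Type*} (s : Finset ι) {V : ModuleCat.{u} Bᵐᵒᵖ} (v : V) (f : ι → Y) :
    pure k v (∑ i ∈ s, f i) = ∑ i ∈ s, pure k v (f i) := by
  simp only [← pureHom_apply]
  rw [map_sum]

/-- The map `D(N) ⊗_B Y → P` corresponding to `ψ : Y → P ⊗_k N`. -/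
def adjoint (ψ : Y →ₗ[A ⊗[k] B] outer k P N) : indTensor k (dual k B N) Y →ₗ[A] P :=
  indHom k (fun ξ y => contr k ξ (ψ y)) (fun ξ ξ' y => contr_add k ξ ξ' (ψ y))
    (fun ξ y y' => by rw [map_add, map_add])
    (fun a b ξ y => by rw [map_smul, contr_smul])

theorem adjoint_pure (ψ : Y →ₗ[A ⊗[k] B] outer k P N) (ξ : dual k B N) (y : Y) :
    adjoint k ψ (pure k ξ y) = contr k ξ (ψ y) := indHom_pure k _ _ _ _ ξ y

/-- For finite-dimensional `N`, every map `D(N) ⊗_B Y → P` comes from a map `Y → P ⊗_k N`. -/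
theorem exists_adjoint_eq [FiniteDimensional k N] (φ : indTensor k (dual k B N) Y →ₗ[A] P) :
    ∃ ψ : Y →ₗ[A ⊗[k] B] outer k P N, adjoint k ψ = φ := by
  let e := Module.finBasis k N
  let f : Y → outer k P N := fun y => ∑ i, outerMk k (φ (pure k (coordDual k e i) y)) (e i)
  have hf : ∀ ξ y, contr k ξ (f y) = φ (pure k ξ y) := by
    intro ξ y
    conv_rhs => rw [← sum_smul_coordDual k e ξ, pure_sum_left, map_sum]
    rw [map_sum]
    refine Finset.sum_congr rfl fun i _ => ?_
    rw [contr_mk, pure_smul_k]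
    exact (φ.map_smul (algebraMap k A _) _).symm
  have hadd : ∀ y y', f (y + y') = f y + f y' := fun y y' => eq_of_contr k fun ξ => by
    rw [map_add, hf, hf, hf, pure_add_right, map_add]
  let ψ : Y →ₗ[A ⊗[k] B] outer k P N := linearOfTmul k (AddMonoidHom.mk' f hadd)
    (fun a b y => eq_of_contr k fun ξ => by
      change contr k ξ (f ((a ⊗ₜ[k] b) • y)) = contr k ξ ((a ⊗ₜ[k] b) • f y)
      rw [contr_smul, hf, hf, pure_smul_right, map_smul])
  exact ⟨ψ, indTensor_hom_ext_linear k fun ξ y => (adjoint_pure k ψ ξ y).trans (hf ξ y)⟩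

theorem adjoint_injective [FiniteDimensional k N] {ψ ψ' : Y →ₗ[A ⊗[k] B] outer k P N}
    (h : adjoint k ψ = adjoint k ψ') : ψ = ψ' :=
  LinearMap.ext fun y => eq_of_contr k fun ξ => by
    rw [← adjoint_pure, h, adjoint_pure]

theorem adjoint_comp (f : X →ₗ[A ⊗[k] B] Y) (ψ : Y →ₗ[A ⊗[k] B] outer k P N) :
    adjoint k (ψ ∘ₗ f) = adjoint k ψ ∘ₗ indMap k (dual k B N) f :=
  indTensor_hom_ext_linear k fun ξ y => by
    rw [adjoint_pure, LinearMap.comp_apply, LinearMap.comp_apply, indMap_pure, adjoint_pure]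

/-- By adjunction, maps to `P ⊗_k N` extend along `f` if maps to `P` extend along `D(N) ⊗_B f`. -/
theorem extend_of_extend_indTensor [FiniteDimensional k N] (f : X →ₗ[A ⊗[k] B] Y)
    (h : ∀ φ : indTensor k (dual k B N) X →ₗ[A] P, ∃ φ' : indTensor k (dual k B N) Y →ₗ[A] P,
      φ' ∘ₗ indMap k (dual k B N) f = φ) (ψ : X →ₗ[A ⊗[k] B] outer k P N) :
    ∃ ψ' : Y →ₗ[A ⊗[k] B] outer k P N, ψ' ∘ₗ f = ψ := by
  obtain ⟨φ', hφ'⟩ := h (adjoint k ψ)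
  obtain ⟨ψ', rfl⟩ := exists_adjoint_eq k φ'
  exact ⟨ψ', adjoint_injective k (by rw [adjoint_comp, hφ'])⟩

theorem extend_indTensor_of_extend [FiniteDimensional k N] (f : X →ₗ[A ⊗[k] B] Y)
    (h : ∀ ψ : X →ₗ[A ⊗[k] B] outer k P N, ∃ ψ' : Y →ₗ[A ⊗[k] B] outer k P N, ψ' ∘ₗ f = ψ)
    (φ : indTensor k (dual k B N) X →ₗ[A] P) : ∃ φ' : indTensor k (dual k B N) Y →ₗ[A] P,
      φ' ∘ₗ indMap k (dual k B N) f = φ := by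
  obtain ⟨ψ, rfl⟩ := exists_adjoint_eq k φ
  obtain ⟨ψ', rfl⟩ := h ψ
  exact ⟨adjoint k ψ', (adjoint_comp k f ψ').symm⟩

/-- If `D(N) ⊗_B f` is injective, then `B`-linear maps to `N` extend along `f`: the
`k`-dual of `D(N) ⊗_B Y` is `Hom_B(Y, N)`. -/
theorem extend_of_indMap_injective [FiniteDimensional k N] {f : X →ₗ[A ⊗[k] B] Y}
    (h : Function.Injective (indMap k (dual k B N) f)) (g : resB k A B X →ₗ[B] N) :
    ∃ g' : resB k A B Y →ₗ[B] N, g' ∘ₗ resBMap k f = g := by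
  let γ₀ : indTensor k (dual k B N) X →+ k := indLift k
    (biadditive (fun ξ x => dualForm k ξ (g (outB.symm x)))
      (fun ξ ξ' x => by rw [map_add]; rfl) (fun ξ x x' => by rw [map_add, map_add, map_add]))
    (fun b ξ x => by
      change dualForm k (MulOpposite.op b • ξ) (g (outB.symm x)) =
        dualForm k ξ (g (b • outB.symm x))
      rw [dualForm_op_smul, g.map_smul])
  have hγ₀ : ∀ ξ x, γ₀ (pure k ξ x) = dualForm k ξ (g (outB.symm x)) := fun ξ x =>
    indLift_pure k _ _ ξ x
  let γ : indTensor k (dual k B N) X →ₗ[k] k :=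
    { toFun := γ₀
      map_add' := map_add γ₀
      map_smul' := fun c z => by
        refine indTensor_induction k z (fun ξ x => ?_) (fun x y hx hy => ?_)
        · rw [← pure_smul_k, hγ₀, hγ₀, dualForm_smul]; rfl
        · rw [smul_add, map_add, hx, hy, map_add, smul_add] }
  obtain ⟨l, hl⟩ :=
    LinearMap.exists_leftInverse_of_injective ((indMap k (dual k B N) f).restrictScalars k)
    (LinearMap.ker_eq_bot.2 h)
  obtain ⟨g', hg'⟩ := exists_linearMap_of_dual k (N := N) (W := resB k A B Y)
    (fun ξ y => γ (l (pure k ξ (outB y))))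
    (fun ξ ξ' y => by rw [pure_add_left, map_add, map_add])
    (fun ξ y y' => by rw [map_add, pure_add_right, map_add, map_add])
    (fun c ξ y => by rw [pure_smul_k, map_smul, map_smul, smul_eq_mul])
    (fun b ξ y => by rw [pure_balanced, outB_smul])
  refine ⟨g', LinearMap.ext fun x => eq_of_dualForm k fun ξ => ?_⟩
  refine (hg' ξ _).trans ?_
  have h1 : l (pure k ξ (f (outB x))) = pure k ξ (outB x) :=
    LinearMap.congr_fun hl (pure k ξ (outB x))
  change γ (l (pure k ξ (f (outB x)))) = _
  rw [h1]
  exact hγ₀ ξ _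

end Adjunction

/-! ### Projectivity over `B` -/

section ProjectiveOverB

variable (k : Type u) {A B : Type u} [Field k] [Ring A] [Algebra k A] [Ring B] [Algebra k B]

variable {X Y Z : ModuleCat.{u} (A ⊗[k] B)}

theorem projective_finsupp {R : Type u} [Ring R] (ι M : Type u) [AddCommGroup M] [Module R M]
    [Module.Projective R M] : Module.Projective R (ι →₀ M) := by
  classical
  exact Module.Projective.of_equiv (finsuppLequivDFinsupp (M := M) (ι := ι) R).symm

variable (A B) in
theorem resB_regular_projective :
    Module.Projective B (resB k A B (ModuleCat.of (A ⊗[k] B) (A ⊗[k] B))) := by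
  classical
  let e := Module.Basis.ofVectorSpace k A
  let F : A ⊗[k] B ≃ₗ[k] (Module.Basis.ofVectorSpaceIndex k A →₀ B) :=
    TensorProduct.equivFinsuppOfBasisLeft e
  have := projective_finsupp (R := B) (Module.Basis.ofVectorSpaceIndex k A) B
  have hF : ∀ (b : B) (z : A ⊗[k] B), F (((1 : A) ⊗ₜ[k] b) * z) = b • F z := by
    intro b z
    induction z with
    | zero => rw [mul_zero, map_zero, smul_zero]
    | add x y hx hy => rw [mul_add, map_add, hx, hy, map_add, smul_add]
    | tmul a b' =>
      rw [Algebra.TensorProduct.tmul_mul_tmul, one_mul]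
      ext i
      simp [F, TensorProduct.equivFinsuppOfBasisLeft_apply_tmul]
  let G : resB k A B (ModuleCat.of (A ⊗[k] B) (A ⊗[k] B)) ≃ₗ[B]
      (Module.Basis.ofVectorSpaceIndex k A →₀ B) :=
    { (outB.trans F.toAddEquiv : resB k A B (ModuleCat.of (A ⊗[k] B) (A ⊗[k] B)) ≃+ _) with
      map_smul' := fun b z => hF b (outB z) }
  exact Module.Projective.of_equiv G.symm

/-- An `A ⊗ B`-projective module is `B`-projective, as `A ⊗ B` is free over `B`. -/
theorem resB_projective (Q : ModuleCat.{u} (A ⊗[k] B)) [Module.Projective (A ⊗[k] B) Q] :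
    Module.Projective B (resB k A B Q) := by
  obtain ⟨s, hs⟩ := Module.projective_def'.1 ‹Module.Projective (A ⊗[k] B) Q›
  let F := ModuleCat.of (A ⊗[k] B) (Q →₀ (A ⊗[k] B))
  have := resB_regular_projective k A B
  have := projective_finsupp (R := B) Q (resB k A B (ModuleCat.of (A ⊗[k] B) (A ⊗[k] B)))
  let G : (Q →₀ (resB k A B (ModuleCat.of (A ⊗[k] B) (A ⊗[k] B)))) ≃ₗ[B] resB k A B F :=
    { toFun := fun f => f
      invFun := fun f => f
      left_inv := fun _ => rfl
      right_inv := fun _ => rfl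
      map_add' := fun _ _ => rfl
      map_smul' := fun _ _ => rfl }
  have : Module.Projective B (resB k A B F) := Module.Projective.of_equiv G
  exact Module.Projective.of_split (M := resB k A B F) (resBMap k (Y := Q) (Y' := F) s)
    (resBMap k (Y := F) (Y' := Q) (Finsupp.linearCombination (A ⊗[k] B) id))
    (LinearMap.ext fun q => LinearMap.congr_fun hs q)

end ProjectiveOverB

/-! ### Tensor products with `P ⊗_k B` and with exact sequences of right modules -/

section TensorComputations

variable (k : Type u) {A B : Type u} [Field k] [Ring A] [Algebra k A] [Ring B] [Algebra k B]

variable {P : ModuleCat.{u} A} {N N' : ModuleCat.{u} B} {X Y Z : ModuleCat.{u} (A ⊗[k] B)}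

theorem indMapLeft_comp {V V' V'' : ModuleCat.{u} Bᵐᵒᵖ} (g : V →ₗ[Bᵐᵒᵖ] V')
    (g' : V' →ₗ[Bᵐᵒᵖ] V'') (z : indTensor k V Y) :
    indMapLeft k Y g' (indMapLeft k Y g z) = indMapLeft k Y (g' ∘ₗ g) z := by
  refine indTensor_induction k z (fun v y => ?_) (fun x y hx hy => ?_)
  · rw [indMapLeft_pure, indMapLeft_pure, indMapLeft_pure]; rfl
  · rw [map_add, map_add, hx, hy, map_add]

theorem indMapLeft_id {V : ModuleCat.{u} Bᵐᵒᵖ} (z : indTensor k V Y) :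
    indMapLeft k Y (LinearMap.id : V →ₗ[Bᵐᵒᵖ] V) z = z := by
  refine indTensor_induction k z (fun v y => ?_) (fun x y hx hy => ?_)
  · rw [indMapLeft_pure]; rfl
  · rw [map_add, hx, hy]

theorem indMapLeft_add {V V' : ModuleCat.{u} Bᵐᵒᵖ} (g g' : V →ₗ[Bᵐᵒᵖ] V')
    (z : indTensor k V Y) :
    indMapLeft k Y (g + g') z = indMapLeft k Y g z + indMapLeft k Y g' z := by
  refine indTensor_induction k z (fun v y => ?_) (fun x y hx hy => ?_)
  · rw [indMapLeft_pure, indMapLeft_pure, indMapLeft_pure, LinearMap.add_apply, pure_add_left]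
  · rw [map_add, hx, hy, map_add, map_add]; abel

/-- The map `B → N`, `b ↦ b n`. -/
def orbitMap (n : N) : ModuleCat.of B B →ₗ[B] N := LinearMap.toSpanSingleton B N n

/-- For a basis `e` of `N`, the map `D(N) ⊗_B (P ⊗_k B) → P^J` with components
`ξ ⊗ (p ⊗ b) ↦ ξ(b e_j) p`. -/
def coordMap {J : Type*} (e : J → N) (P : ModuleCat.{u} A) :
    indTensor k (dual k B N) (outer k P (ModuleCat.of B B)) →ₗ[A] (J → P) :=
  LinearMap.pi fun j => adjoint k LinearMap.id ∘ₗ indMapLeft k _ (dualMap k (orbitMap (e j)))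

theorem coordMap_pure {J : Type*} (e : J → N) (P : ModuleCat.{u} A) (ξ : dual k B N)
    (z : outer k P (ModuleCat.of B B)) (j : J) :
    coordMap k e P (pure k ξ z) j = contr k (dualMap k (orbitMap (e j)) ξ) z := by
  change adjoint k LinearMap.id (indMapLeft k _ (dualMap k (orbitMap (e j))) (pure k ξ z)) = _
  rw [indMapLeft_pure, adjoint_pure]; rfl

theorem coordMap_pure_mk {J : Type*} (e : J → N) (P : ModuleCat.{u} A) (ξ : dual k B N)
    (p : P) (b : B) (j : J) :
    coordMap k e P (pure k ξ (outerMk k p (N := ModuleCat.of B B) b)) j =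
      dualForm k ξ (b • e j) • p :=
  coordMap_pure k e P ξ _ j

/-- `D(N) ⊗_B (P ⊗_k B)` is a power of `P`, with exponent the dimension of `N`. -/
theorem coordMap_bijective {J : Type*} [Fintype J] (e : Module.Basis J k N) (P : ModuleCat.{u} A) :
    Function.Bijective (coordMap k e P) := by
  classical
  let inv : (J → P) →+ indTensor k (dual k B N) (outer k P (ModuleCat.of B B)) :=
    AddMonoidHom.mk' (fun w => ∑ j, pure k (coordDual k e j)
      (outerMk k (w j) (N := ModuleCat.of B B) (1 : B)))
      (fun w w' => by
        rw [← Finset.sum_add_distrib]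
        refine Finset.sum_congr rfl fun j _ => ?_
        rw [Pi.add_apply, outerMk_add_left, pure_add_right])
  constructor
  · refine Function.LeftInverse.injective (g := inv) fun z => ?_
    refine indTensor_induction k z (fun ξ z => ?_) (fun x y hx hy => ?_)
    · refine outer_induction k z ?_ (fun p (b : B) => ?_) (fun x y hx hy => ?_)
      · have h0 : pure k ξ (0 : outer k P (ModuleCat.of B B)) = 0 := by
          rw [← pureHom_apply, map_zero]
        rw [h0, map_zero, map_zero]
      · change ∑ j, pure k (coordDual k e j) (outerMk k
          (coordMap k e P (pure k ξ (outerMk k p (N := ModuleCat.of B B) b)) j)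
          (N := ModuleCat.of B B) (1 : B)) = _
        have h1 : ∀ j, pure k (coordDual k e j) (outerMk k
            (coordMap k e P (pure k ξ (outerMk k p (N := ModuleCat.of B B) b)) j)
            (N := ModuleCat.of B B) (1 : B)) =
            pure k (dualForm k (MulOpposite.op b • ξ) (e j) • coordDual k e j)
              (outerMk k p (N := ModuleCat.of B B) (1 : B)) := fun j => by
          rw [coordMap_pure_mk, dualForm_op_smul, pure_smul_k, outerMk_smul_left,
            ← algebraMap_smul_moduleCat, Algebra.TensorProduct.algebraMap_apply, ← smul_pure]
          rfl
        simp only [h1]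
        rw [← pure_sum_left, sum_smul_coordDual, pure_balanced, outer_smul, one_smul]
        change pure k ξ (outerMk k p (N := ModuleCat.of B B) (b * 1)) = _
        rw [mul_one]
      · rw [pure_add_right, map_add, map_add, hx, hy]
    · rw [map_add, map_add, hx, hy]
  · refine Function.RightInverse.surjective (g := inv) fun w => funext fun i => ?_
    change coordMap k e P (∑ j, pure k (coordDual k e j)
      (outerMk k (w j) (N := ModuleCat.of B B) (1 : B))) i = _
    rw [map_sum, Finset.sum_apply]
    have h1 : ∀ j, coordMap k e P (pure k (coordDual k e j)
        (outerMk k (w j) (N := ModuleCat.of B B) (1 : B))) i = if i = j then w j else 0 :=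
      fun j => by
        rw [coordMap_pure_mk, one_smul]
        change e.coord j (e i) • w j = _
        rw [e.coord_apply, e.repr_self, Finsupp.single_apply]
        split_ifs <;> simp
    simp [h1]

theorem projective_pi {R : Type u} [Ring R] {J : Type*} [Finite J] (M : Type u) [AddCommGroup M]
    [Module R M] [Module.Projective R M] : Module.Projective R (J → M) := by
  classical
  have := Fintype.ofFinite J
  exact Module.Projective.of_equiv (DFinsupp.linearEquivFunOnFintype (M := fun _ : J => M))

/-- `D(N) ⊗_B Q` is finitely generated projective over `A` when `Q` is so over `A ⊗ B`. -/
theorem indTensor_finite_projective [FiniteDimensional k N] (Q : ModuleCat.{u} (A ⊗[k] B))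
    [Module.Finite (A ⊗[k] B) Q] [Module.Projective (A ⊗[k] B) Q] :
    Module.Finite A (indTensor k (dual k B N) Q) ∧
      Module.Projective A (indTensor k (dual k B N) Q) := by
  obtain ⟨n, p, hp⟩ := Module.Finite.exists_fin' (A ⊗[k] B) Q
  -- `Q` is a direct summand of `P ⊗_k B` with `P = A^n`
  let P : ModuleCat.{u} A := ModuleCat.of A (Fin n → A)
  let f : P →ₗ[A] resA k A B Q :=
    { toFun := fun v => outA.symm (p fun i => (v i) ⊗ₜ[k] (1 : B))
      map_add' := fun v w => by
        rw [← map_add, ← map_add]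
        congr 2
        funext i
        exact TensorProduct.add_tmul _ _ _
      map_smul' := fun a v => by
        refine outA.injective ?_
        rw [RingHom.id_apply, outA_smul, AddEquiv.apply_symm_apply, AddEquiv.apply_symm_apply,
          ← map_smul]
        congr 1
        funext i
        change (a * v i) ⊗ₜ[k] (1 : B) = (a ⊗ₜ[k] (1 : B)) * (v i ⊗ₜ[k] (1 : B))
        rw [Algebra.TensorProduct.tmul_mul_tmul, one_mul] }
  have hF : Function.Surjective (outerHomLeft k f) := by
    rw [← LinearMap.range_eq_top, eq_top_iff, ← LinearMap.range_eq_top.2 hp]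
    rintro _ ⟨w, rfl⟩
    rw [← Finset.univ_sum_single w, map_sum]
    refine Submodule.sum_mem _ fun i _ => ?_
    have : Pi.single i (w i) = (w i) • (Pi.single i 1 : Fin n → A ⊗[k] B) := by
      rw [← Pi.single_smul, smul_eq_mul, mul_one]
    rw [this, map_smul]
    refine Submodule.smul_mem _ _ ⟨outerMk k (P := P) (N := ModuleCat.of B B)
      (Pi.single i 1 : Fin n → A) (1 : B), ?_⟩
    rw [outerHomLeft_mk, ← Algebra.TensorProduct.one_def, one_smul]
    change p (fun j => (Pi.single i 1 : Fin n → A) j ⊗ₜ[k] (1 : B)) = _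
    congr 1
    funext j
    by_cases h : j = i
    · subst h; rw [Pi.single_eq_same, Pi.single_eq_same]; rfl
    · rw [Pi.single_eq_of_ne h, Pi.single_eq_of_ne h, TensorProduct.zero_tmul]
  obtain ⟨s, hs⟩ := Module.projective_lifting_property _ LinearMap.id hF
  let e := Module.finBasis k N
  let E := LinearEquiv.ofBijective _ (coordMap_bijective k e P)
  have := projective_pi (R := A) (J := Fin (Module.finrank k N)) (Fin n → A)
  have hfin : Module.Finite A (indTensor k (dual k B N) (outer k P (ModuleCat.of B B))) :=
    Module.Finite.equiv (M := Fin (Module.finrank k N) → Fin n → A) E.symm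
  have hproj : Module.Projective A (indTensor k (dual k B N) (outer k P (ModuleCat.of B B))) :=
    Module.Projective.of_equiv (M := Fin (Module.finrank k N) → Fin n → A) E.symm
  have hret : indMap k (dual k B N) (outerHomLeft k f) ∘ₗ indMap k (dual k B N) s =
      LinearMap.id := by
    refine indTensor_hom_ext_linear k fun ξ y => ?_
    rw [LinearMap.comp_apply, indMap_pure, indMap_pure]
    exact congrArg (pure k ξ) (LinearMap.congr_fun hs y)
  exact ⟨Module.Finite.of_surjective _ (indMap_surjective k hF),
    Module.Projective.of_split _ _ hret⟩

/-- `- ⊗_B Y` is exact when `Y` is projective over `B`. -/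
theorem SES.tensorLeft [Module.Finite B (resB k A B Y)] [Module.Projective B (resB k A B Y)]
    {V₁ V₂ V₃ : ModuleCat.{u} Bᵐᵒᵖ} {f : V₁ →ₗ[Bᵐᵒᵖ] V₂} {g : V₂ →ₗ[Bᵐᵒᵖ] V₃} (h : SES f g) :
    SES (indMapLeft k Y f) (indMapLeft k Y g) := by
  classical
  obtain ⟨n, d, hd⟩ := Module.Finite.exists_fin' B (resB k A B Y)
  obtain ⟨c, hc⟩ := Module.projective_lifting_property d LinearMap.id hd
  let x : Fin n → Y := fun i => outB (d (Pi.single i 1))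
  -- `V ⊗_B Y` is a retract of `V^n`, naturally in `V`, since `Y` is a retract of `B^n`
  let C : ∀ V : ModuleCat.{u} Bᵐᵒᵖ, indTensor k V Y →+ (Fin n → V) := fun V =>
    indLift k (biadditive (fun v y i => MulOpposite.op (c (outB.symm y) i) • v)
      (fun v v' y => funext fun i => smul_add _ v v')
      (fun v y y' => funext fun i => by
        rw [map_add, map_add, Pi.add_apply, MulOpposite.op_add, add_smul]; rfl))
      (fun b v y => funext fun i => by
        change MulOpposite.op (c (outB.symm y) i) • MulOpposite.op b • v =
          MulOpposite.op (c (b • outB.symm y) i) • v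
        rw [map_smul, Pi.smul_apply, smul_smul]; rfl)
  have hC : ∀ (V : ModuleCat.{u} Bᵐᵒᵖ) v y i,
      C V (pure k v y) i = MulOpposite.op (c (outB.symm y) i) • v := fun V v y i =>
    congrFun (indLift_pure k _ _ v y) i
  let D : ∀ V : ModuleCat.{u} Bᵐᵒᵖ, (Fin n → V) →+ indTensor k V Y := fun V =>
    AddMonoidHom.mk' (fun w => ∑ i, pure k (w i) (x i)) (fun w w' => by
      rw [← Finset.sum_add_distrib]
      exact Finset.sum_congr rfl fun i _ => pure_add_left k _ _ _)
  have hDC : ∀ V (z : indTensor k V Y), D V (C V z) = z := by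
    intro V z
    refine indTensor_induction k z (fun v y => ?_) (fun x y hx hy => ?_)
    · change ∑ i, pure k (C V (pure k v y) i) (x i) = _
      have h1 : ∀ i, pure k (C V (pure k v y) i) (x i) =
          pure k v (outB (d (Pi.single i (c (outB.symm y) i)))) := fun i => by
        have h2 : (Pi.single i (c (outB.symm y) i) : Fin n → B) =
            c (outB.symm y) i • Pi.single i 1 := by
          rw [← Pi.single_smul, smul_eq_mul, mul_one]
        rw [hC, pure_balanced, h2, map_smul, outB_smul]
      simp only [h1]
      rw [← pure_sum_right, ← map_sum, ← map_sum, Finset.univ_sum_single]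
      exact congrArg (fun y => pure k v (outB y)) (LinearMap.congr_fun hc (outB.symm y))
    · rw [map_add, map_add, hx, hy]
  have hCn : ∀ {V V' : ModuleCat.{u} Bᵐᵒᵖ} (g : V →ₗ[Bᵐᵒᵖ] V') (z : indTensor k V Y) i,
      C V' (indMapLeft k Y g z) i = g (C V z i) := by
    intro V V' g z i
    refine indTensor_induction k z (fun v y => ?_) (fun x y hx hy => ?_)
    · rw [indMapLeft_pure, hC, hC, map_smul]
    · rw [map_add, map_add, map_add, Pi.add_apply, Pi.add_apply, hx, hy, map_add]
  have hDn : ∀ {V V' : ModuleCat.{u} Bᵐᵒᵖ} (g : V →ₗ[Bᵐᵒᵖ] V') (w : Fin n → V),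
      indMapLeft k Y g (D V w) = D V' (fun i => g (w i)) := by
    intro V V' g w
    change indMapLeft k Y g (∑ i, pure k (w i) (x i)) = ∑ i, pure k (g (w i)) (x i)
    rw [map_sum]
    exact Finset.sum_congr rfl fun i _ => indMapLeft_pure k g _ _
  refine ⟨?_, fun z => ⟨fun hz => ?_, ?_⟩, fun z => ?_⟩
  · rw [injective_iff_map_eq_zero]
    intro z hz
    have : C V₁ z = 0 := funext fun i => h.inj (by
      rw [← hCn, hz, map_zero, Pi.zero_apply, Pi.zero_apply, map_zero])
    rw [← hDC _ z, this, map_zero]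
  · have h1 : ∀ i, ∃ w, f w = C V₂ z i := fun i => (h.exact _).1 (by
      rw [← hCn, hz, map_zero, Pi.zero_apply])
    choose w hw using h1
    refine ⟨D V₁ w, ?_⟩
    rw [hDn]
    simp only [hw]
    exact hDC _ z
  · rintro ⟨z, rfl⟩
    have h0 : g ∘ₗ f = 0 := LinearMap.ext fun v => h.exact.apply_apply_eq_zero v
    rw [indMapLeft_comp, h0]
    have h2 := indMapLeft_add k (Y := Y) (0 : V₁ →ₗ[Bᵐᵒᵖ] V₃) 0 z
    rw [add_zero] at h2
    simpa using h2
  · choose w hw using fun i => h.surj (C V₃ z i)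
    refine ⟨D V₂ w, ?_⟩
    rw [hDn]
    simp only [hw]
    exact hDC _ z

end TensorComputations

/-! ### Modules that are projective over `B` with Gorenstein projective tensor products -/

section MonModules

variable (k : Type u) {A B : Type u} [Field k] [Ring A] [Algebra k A] [Ring B] [Algebra k B]

/-- `X` is finitely generated, projective over `B`, and `D(N) ⊗_B X` is Gorenstein projective over
`A` for every finitely generated left `B`-module `N`. -/
structure IsMonModule (X : ModuleCat.{u} (A ⊗[k] B)) : Prop where
  finite : Module.Finite (A ⊗[k] B) X
  projective : Module.Projective B (resB k A B X)
  gproj : ∀ N : ModuleCat.{u} B, Module.Finite B N → gproj A (indTensor k (dual k B N) X)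

/-- Maps to `A ⊗ B` are maps from `D(B) ⊗_B -` to `A`, and `D(B) ⊗_B -` preserves exact sequences
that end in `X`. -/
theorem IsMonModule.extZero [FiniteDimensional k B] {X : ModuleCat.{u} (A ⊗[k] B)}
    (hX : IsMonModule k X) : ExtZero X (ModuleCat.of (A ⊗[k] B) (A ⊗[k] B)) 1 := by
  have := hX.finite
  have := hX.projective
  obtain ⟨n, p, hp⟩ := Module.Finite.exists_fin' (A ⊗[k] B) X
  let Q := ModuleCat.of (A ⊗[k] B) (Fin n → A ⊗[k] B)
  let K := ModuleCat.of (A ⊗[k] B) (LinearMap.ker p)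
  have h : SES (X := K) (Y := Q) (Z := X) (LinearMap.ker p).subtype p := SES.ker hp
  have hQ : Module.Projective (A ⊗[k] B) Q :=
    inferInstanceAs (Module.Projective _ (Fin n → A ⊗[k] B))
  have hN : Module.Finite B (ModuleCat.of B B) := inferInstanceAs (Module.Finite B B)
  have := finiteDimensional_of_finite k (ModuleCat.of B B)
  have hE : ExtZero X (outer k (ModuleCat.of A A) (ModuleCat.of B B)) 1 := by
    refine SES.extZero_of_extend (X := K) (Y := Q) h (extZero_of_projective 0) ?_
    refine extend_of_extend_indTensor k (X := K) (Y := Q) _ ?_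
    exact SES.exists_extend (SES.tensorRight k (X := K) (Y := Q) (Z := X) h _)
      (extZero_of_gproj (hX.gproj _ hN) 0)
  exact hE.of_retract (outerRegularEquiv k A B).toLinearMap
    (outerRegularEquiv k A B).symm.toLinearMap
    (LinearMap.ext fun x => (outerRegularEquiv k A B).symm_apply_apply x)

variable [FiniteDimensional k A] [FiniteDimensional k B]

/-- Exactness of `D(N) ⊗_B -` at sequences that end in `X` makes `D(N) ⊗_B K` a syzygy of
`D(N) ⊗_B X`. -/
theorem IsMonModule.of_syzygy {X K Q : ModuleCat.{u} (A ⊗[k] B)} (hX : IsMonModule k X)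
    {f : K →ₗ[A ⊗[k] B] Q} {g : Q →ₗ[A ⊗[k] B] X} (h : SES f g) [Module.Finite (A ⊗[k] B) Q]
    [Module.Projective (A ⊗[k] B) Q] : IsMonModule k K := by
  have : IsNoetherianRing A := IsNoetherianRing.of_finite k A
  have : IsNoetherianRing (A ⊗[k] B) := IsNoetherianRing.of_finite k _
  have := hX.projective
  have := resB_projective k Q
  refine ⟨Module.Finite.of_injective f h.inj, projective_left_of_ses (h.restrictB k),
    fun N hN => ?_⟩
  have := finiteDimensional_of_finite k N
  obtain ⟨_, _⟩ := indTensor_finite_projective k (N := N) Q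
  exact gproj_of_ses_projective (h.tensorRight k (dual k B N)) (hX.gproj N hN)

/-- If `φ : D(B) ⊗_B X → P` is a monomorphism with Gorenstein projective cokernel, then the adjoint
map `X → P ⊗_k B` becomes, after applying `D(N) ⊗_B -`, the composite of
`D(N) ⊗_B X → (D(B) ⊗_B X)^J` and `φ^J`, where `J` indexes a basis of `N`. Both maps are
monomorphisms with Gorenstein projective cokernels. -/
theorem IsMonModule.adjoint_tensor {X : ModuleCat.{u} (A ⊗[k] B)} (hX : IsMonModule k X)
    {P C : ModuleCat.{u} A} {φ : indTensor k (dual k B (ModuleCat.of B B)) X →ₗ[A] P}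
    {π : P →ₗ[A] C} (hφ : SES φ π) (hC : MonRep.gproj A C)
    (ψ : X →ₗ[A ⊗[k] B] outer k P (ModuleCat.of B B)) (hψ : adjoint k ψ = φ)
    (N : ModuleCat.{u} B) [Module.Finite B N] :
    Function.Injective (indMap k (dual k B N) ψ) ∧ ∀ (Y : ModuleCat.{u} A)
      (γ : indTensor k (dual k B N) (outer k P (ModuleCat.of B B)) →ₗ[A] Y),
      SES (indMap k (dual k B N) ψ) γ → MonRep.gproj A Y := by
  classical
  have := hX.finite
  have := hX.projective
  have := resB_finite k X
  have : IsNoetherianRing B := IsNoetherianRing.of_finite k B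
  have := finiteDimensional_of_finite k N
  let e := Module.finBasis k N
  let J := Fin (Module.finrank k N)
  let F : ModuleCat.{u} B := ModuleCat.of B (J → B)
  let q : F →ₗ[B] N := Fintype.linearCombination B e
  have hqs : ∀ (j : J) (b : B), q (Pi.single j b : J → B) = b • e j := fun j b =>
    Fintype.linearCombination_apply_single B e j b
  have hq : Function.Surjective q := by
    intro n
    refine ⟨fun j => algebraMap k B (e.repr n j), ?_⟩
    change ∑ j, algebraMap k B (e.repr n j) • e j = n
    conv_rhs => rw [← e.sum_repr n]
    rfl
  let L : ModuleCat.{u} B := ModuleCat.of B (LinearMap.ker q)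
  have hL : Module.Finite B L := inferInstanceAs (Module.Finite B (LinearMap.ker q))
  have s₁ := SES.tensorLeft k (Y := X) (SES.dual k (N₁ := L) (N₂ := F) (N₃ := N) (SES.ker hq))
  -- `D(F) ⊗_B X` is the `J`-fold power of `D(B) ⊗_B X`
  let ι : J → ((ModuleCat.of B B : ModuleCat.{u} B) →ₗ[B] F) := fun j =>
    LinearMap.single B (fun _ : J => B) j
  let pr : J → (F →ₗ[B] (ModuleCat.of B B : ModuleCat.{u} B)) := fun j => LinearMap.proj j
  let θ : indTensor k (dual k B F) X →ₗ[A] (J → indTensor k (dual k B (ModuleCat.of B B)) X) :=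
    LinearMap.pi fun j => indMapLeft k X (dualMap k (ι j))
  let θ' : (J → indTensor k (dual k B (ModuleCat.of B B)) X) →ₗ[A] indTensor k (dual k B F) X :=
    ∑ j, indMapLeft k X (dualMap k (pr j)) ∘ₗ LinearMap.proj j
  have hθ'θ : ∀ z, θ' (θ z) = z := by
    intro z
    change (∑ j, indMapLeft k X (dualMap k (pr j)) ∘ₗ LinearMap.proj j :
      _ →ₗ[A] indTensor k (dual k B F) X) (θ z) = z
    rw [LinearMap.sum_apply]
    refine indTensor_induction k z (fun ξ x => ?_) (fun x y hx hy => ?_)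
    · have h1 : ∀ j, (indMapLeft k X (dualMap k (pr j)) ∘ₗ LinearMap.proj j) (θ (pure k ξ x)) =
          pure k (dualMap k (pr j) (dualMap k (ι j) ξ)) x := fun j => by
        change indMapLeft k X (dualMap k (pr j)) (indMapLeft k X (dualMap k (ι j)) (pure k ξ x)) = _
        rw [indMapLeft_pure, indMapLeft_pure]
      simp only [h1]
      rw [← pure_sum_left]
      congr 1
      refine dual_ext k fun w => ?_
      refine (dualForm_sum k Finset.univ _ w).trans ?_
      let D : (J → B) →+ k := dualEval k ξ
      have h2 := congrArg D (Finset.univ_sum_single (show J → B from w))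
      rw [map_sum] at h2
      exact h2
    · simp only [map_add]
      rw [Finset.sum_add_distrib, hx, hy]
  have hθθ' : ∀ w, θ (θ' w) = w := by
    intro w
    funext i
    change indMapLeft k X (dualMap k (ι i)) ((∑ j, indMapLeft k X (dualMap k (pr j)) ∘ₗ
      LinearMap.proj j : _ →ₗ[A] indTensor k (dual k B F) X) w) = w i
    rw [LinearMap.sum_apply, map_sum]
    have h1 : ∀ j, indMapLeft k X (dualMap k (ι i)) ((indMapLeft k X (dualMap k (pr j)) ∘ₗ
        LinearMap.proj j) w) = if i = j then w j else 0 := fun j => by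
      change indMapLeft k X (dualMap k (ι i)) (indMapLeft k X (dualMap k (pr j)) (w j)) = _
      rw [indMapLeft_comp]
      refine indTensor_induction k (w j) (fun ξ x => ?_) (fun x y hx hy => ?_)
      · rw [indMapLeft_pure]
        split_ifs with hij
        · subst hij
          congr 1
          refine dual_ext k fun b => ?_
          change dualForm k ξ ((Pi.single i (show B from b) : J → B) i) = _
          rw [Pi.single_eq_same]
        · have h2 : (dualMap k (ι i) ∘ₗ dualMap k (pr j)) ξ = 0 := dual_ext k fun b => by
            change dualForm k ξ ((Pi.single i (show B from b) : J → B) j) = 0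
            rw [Pi.single_eq_of_ne (Ne.symm hij)]
            exact map_zero (dualForm k ξ)
          rw [h2, ← pureHom_apply, map_zero]; rfl
      · rw [map_add, hx, hy]
        split_ifs <;> simp
    exact (Finset.sum_congr rfl fun j _ => h1 j).trans
      ((Finset.sum_ite_eq Finset.univ i w).trans (if_pos (Finset.mem_univ i)))
  let Θ : indTensor k (dual k B F) X ≃ₗ[A] (J → indTensor k (dual k B (ModuleCat.of B B)) X) :=
    { θ with invFun := θ', left_inv := hθ'θ, right_inv := hθθ' }
  let α := indMapLeft k X (dualMap k q)
  let κ := LinearEquiv.ofBijective _ (coordMap_bijective k e P)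
  have hcomm : ∀ z, κ (indMap k (dual k B N) ψ z) = φ.compLeft J (Θ (α z)) := by
    intro z
    refine indTensor_induction k z (fun ξ x => ?_) (fun x y hx hy => ?_)
    · funext j
      change coordMap k e P (pure k ξ (ψ x)) j = φ (indMapLeft k X (dualMap k (ι j))
        (indMapLeft k X (dualMap k q) (pure k ξ x)))
      rw [coordMap_pure, ← adjoint_pure, hψ, indMapLeft_pure, indMapLeft_pure]
      congr 2
      exact dual_ext k fun b => congrArg (dualForm k ξ) (hqs j b).symm
    · simp only [map_add, hx, hy]
  have s₂ : SES (φ.compLeft J ∘ₗ Θ.toLinearMap) (π.compLeft J) := by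
    refine ⟨hφ.inj.comp_left.comp Θ.injective, fun w => ⟨fun hw => ?_, ?_⟩, hφ.surj.comp_left⟩
    · choose z hz using fun j => (hφ.exact (w j)).1 (congrFun hw j)
      exact ⟨Θ.symm z, (congrArg (φ.compLeft J) (Θ.apply_symm_apply z)).trans (funext hz)⟩
    · rintro ⟨z, rfl⟩
      exact funext fun j => hφ.exact.apply_apply_eq_zero (Θ z j)
  have hcomm' : ∀ z, (φ.compLeft J ∘ₗ Θ.toLinearMap) (α z) = κ (indMap k (dual k B N) ψ z) :=
    fun z => (hcomm z).symm
  refine ⟨fun z z' h => s₁.inj (s₂.inj ?_), fun Y γ hγ => ?_⟩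
  · refine (hcomm' z).trans ?_
    rw [h]; exact (hcomm' z').symm
  · have s₃ : SES ((φ.compLeft J ∘ₗ Θ.toLinearMap) ∘ₗ α) (γ ∘ₗ κ.symm.toLinearMap) := by
      refine ⟨s₂.inj.comp s₁.inj, fun w => ?_, hγ.surj.comp κ.symm.surjective⟩
      refine (hγ.exact (κ.symm w)).trans ⟨?_, ?_⟩
      · rintro ⟨z, hz⟩
        refine ⟨z, (hcomm' z).trans ?_⟩
        rw [hz, LinearEquiv.apply_symm_apply]
      · rintro ⟨z, rfl⟩
        refine ⟨z, ?_⟩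
        rw [LinearEquiv.eq_symm_apply]
        exact (hcomm' z).symm
    obtain ⟨a, b, hab⟩ := s₁.third s₂ s₃
    exact gproj_of_ses (X := indTensor k (dual k B L) X) (Y := Y)
      (Z := ModuleCat.of A (J → C)) hab (hX.gproj L hL) (gproj_pi hC J)

/-- The cosyzygy of `X` is the cokernel of `X → P ⊗_k B`, the adjoint of an embedding of
`D(B) ⊗_B X` into a projective `A`-module `P`. -/
theorem IsMonModule.exists_cosyzygy {X : ModuleCat.{u} (A ⊗[k] B)} (hX : IsMonModule k X) :
    ∃ Y, IsMonModule k Y ∧ IsCosyzygy (A ⊗[k] B) X Y := by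
  have := hX.finite
  have := hX.projective
  have := resB_finite k X
  have hN : Module.Finite B (ModuleCat.of B B) := inferInstanceAs (Module.Finite B B)
  have := finiteDimensional_of_finite k (ModuleCat.of B B)
  obtain ⟨C, hC, P, φ, π, _, _, hφ, -⟩ := exists_cosyzygy_of_gproj (hX.gproj _ hN)
  obtain ⟨ψ, hψ⟩ := exists_adjoint_eq k φ
  have hQ := outer_projective_left k (B := B) P
  have hQf := outer_finite k P (ModuleCat.of B B)
  have hQB := resB_projective k (outer k P (ModuleCat.of B B))
  have := finiteDimensional_of_finite k (resB k A B X)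
  obtain ⟨r, hr⟩ := extend_of_indMap_injective k (N := resB k A B X)
    (hX.adjoint_tensor k hφ hC ψ hψ (resB k A B X)).1 LinearMap.id
  have hinj : Function.Injective ψ :=
    Function.LeftInverse.injective (g := fun y => outB (r (outB.symm y)))
      fun x => LinearMap.congr_fun hr x
  let Y : ModuleCat.{u} (A ⊗[k] B) :=
    ModuleCat.of _ (outer k P (ModuleCat.of B B) ⧸ LinearMap.range ψ)
  have s : SES (X := X) (Y := outer k P (ModuleCat.of B B)) (Z := Y) ψ (LinearMap.range ψ).mkQ :=
    SES.coker hinj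
  have hYB : Module.Projective B (resB k A B Y) :=
    projective_right_of_ses (SES.restrictB k (Z := Y) s) hr
  have hY : IsMonModule k Y := by
    refine ⟨Module.Finite.of_surjective _ s.surj, hYB, fun N hN => ?_⟩
    exact (hX.adjoint_tensor k hφ hC ψ hψ N).2 _ _ (SES.tensorRight k (Z := Y) s _)
  exact ⟨Y, hY, s.isCosyzygy (Y := Y) hY.extZero⟩

/-- The modules of this kind are closed under syzygies and cosyzygies over `A ⊗ B`. -/
theorem IsMonModule.isGproj {X : ModuleCat.{u} (A ⊗[k] B)} (hX : IsMonModule k X) :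
    MonRep.gproj (A ⊗[k] B) X := by
  refine gproj_of_class (IsMonModule k) (fun X hX => hX.exists_cosyzygy) (fun X hX => ?_) hX
  have := hX.finite
  obtain ⟨n, p, hp⟩ := Module.Finite.exists_fin' (A ⊗[k] B) X
  let Q := ModuleCat.of (A ⊗[k] B) (Fin n → A ⊗[k] B)
  let K := ModuleCat.of (A ⊗[k] B) (LinearMap.ker p)
  have h : SES (X := K) (Y := Q) (Z := X) (LinearMap.ker p).subtype p := SES.ker hp
  have hQ : Module.Projective (A ⊗[k] B) Q :=
    inferInstanceAs (Module.Projective _ (Fin n → A ⊗[k] B))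
  have hQ' : Module.Finite (A ⊗[k] B) Q :=
    inferInstanceAs (Module.Finite _ (Fin n → A ⊗[k] B))
  exact ⟨K, hX.of_syzygy k (K := K) (Q := Q) h, SES.isCosyzygy (X := K) (Q := Q) h hX.extZero⟩

end MonModules

/-! ### Vanishing of `Tor` and projectivity over `B` -/

section TorVanishing

variable (k : Type u) {A B : Type u} [Field k] [Ring A] [Algebra k A] [Ring B] [Algebra k B]

/-- A projective resolution of `X`, written out as a sequence of linear maps, which computes
the modules `Tor_i(A ⊗ V, X)`. -/
theorem exists_resolution (X : ModuleCat.{u} (A ⊗[k] B)) :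
    ∃ (P : ℕ → ModuleCat.{u} (A ⊗[k] B)) (d : ∀ n, P (n + 1) →ₗ[A ⊗[k] B] P n)
      (π : P 0 →ₗ[A ⊗[k] B] X), (∀ n, Module.Projective (A ⊗[k] B) (P n)) ∧
      Function.Surjective π ∧ Function.Exact (d 0) π ∧ (∀ n, Function.Exact (d (n + 1)) (d n)) ∧
      ∀ (V : ModuleCat.{u} Bᵐᵒᵖ) (i : ℕ),
        Limits.IsZero ((torFunctor A (A ⊗[k] B) (Induced k A V) (i + 1)).obj X) ↔
          Function.Exact (indMap k V (d (i + 1))) (indMap k V (d i)) := by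
  let P := projectiveResolution X
  refine ⟨fun n => P.complex.X n, fun n => (P.complex.d (n + 1) n).hom, (P.π.f 0).hom,
    fun n => (IsProjective.iff_projective _).2 (P.projective n), ?_, ?_, fun n => ?_, fun V i => ?_⟩
  · exact (ModuleCat.epi_iff_surjective _).1 inferInstance
  · exact (ShortComplex.ShortExact.moduleCat_exact_iff_function_exact _).1 P.exact₀
  · exact (ShortComplex.ShortExact.moduleCat_exact_iff_function_exact _).1 (P.exact_succ n)
  · rw [torFunctor, (P.isoLeftDerivedObj (tensorFunctor A (A ⊗[k] B) (Induced k A V))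
      (i + 1)).isZero_iff]
    change Limits.IsZero (HomologicalComplex.homology _ _) ↔ _
    rw [← HomologicalComplex.exactAt_iff_isZero_homology,
      HomologicalComplex.exactAt_iff' _ (i + 2) (i + 1) i (by simp only [ChainComplex.prev]; rfl)
        (by simp),
      ShortComplex.ShortExact.moduleCat_exact_iff_function_exact]
    rfl

variable {X Y Z : ModuleCat.{u} (A ⊗[k] B)}

theorem projective_resB_congr (e : X ≃ₗ[A ⊗[k] B] Y) [Module.Projective B (resB k A B X)] :
    Module.Projective B (resB k A B Y) :=
  Module.Projective.of_split (resBMap k e.symm.toLinearMap) (resBMap k e.toLinearMap)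
    (LinearMap.ext fun y => e.apply_symm_apply y)

/-- `V ⊗_B -` is exact at `Y` if the image and the cokernel of `Y → Z` are projective over `B`. -/
theorem indMap_exact {f : X →ₗ[A ⊗[k] B] Y} {g : Y →ₗ[A ⊗[k] B] Z} (h : Function.Exact f g)
    (h₁ : Module.Projective B (resB k A B (ModuleCat.of _ (LinearMap.range g))))
    (h₂ : Module.Projective B (resB k A B (ModuleCat.of _ (Z ⧸ LinearMap.range g))))
    (V : ModuleCat.{u} Bᵐᵒᵖ) : Function.Exact (indMap k V f) (indMap k V g) := by
  let K : ModuleCat.{u} (A ⊗[k] B) := ModuleCat.of _ (LinearMap.ker g)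
  let I : ModuleCat.{u} (A ⊗[k] B) := ModuleCat.of _ (LinearMap.range g)
  let C : ModuleCat.{u} (A ⊗[k] B) := ModuleCat.of _ (Z ⧸ LinearMap.range g)
  let g' : Y →ₗ[A ⊗[k] B] I := g.rangeRestrict
  let j : I →ₗ[A ⊗[k] B] Z := (LinearMap.range g).subtype
  let c : Z →ₗ[A ⊗[k] B] C := (LinearMap.range g).mkQ
  let l : K →ₗ[A ⊗[k] B] Y := (LinearMap.ker g).subtype
  let f' : X →ₗ[A ⊗[k] B] K := f.codRestrict _ fun x => h.apply_apply_eq_zero x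
  have hf' : Function.Surjective f' := by
    rintro ⟨y, hy⟩
    obtain ⟨x, rfl⟩ := (h y).1 hy
    exact ⟨x, rfl⟩
  have s₁ : SES l g' := ⟨Subtype.val_injective, fun y => by
    have : g' y = 0 ↔ g y = 0 := Subtype.ext_iff
    rw [this]; simp [l, K], g.surjective_rangeRestrict⟩
  have s₂ : SES j c := ⟨Subtype.val_injective, fun z => by simp [j, c, C, I],
    Submodule.mkQ_surjective _⟩
  have t₁ := s₁.tensorRight k V
  have t₂ := s₂.tensorRight k V
  intro z
  have e₁ : indMap k V g z = indMap k V j (indMap k V g' z) :=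
    indMap_comp k j g' z
  rw [e₁, map_eq_zero_iff _ t₂.inj, t₁.exact z]
  constructor
  · rintro ⟨w, rfl⟩
    obtain ⟨x, rfl⟩ := indMap_surjective k (V := V) hf' w
    exact ⟨x, indMap_comp k l f' x⟩
  · rintro ⟨x, rfl⟩
    exact ⟨indMap k V f' x,
      (indMap_comp k l f' x).symm⟩

/-- If `X` is projective over `B`, so are all its syzygies, and a projective resolution of `X`
splits over `B`. -/
theorem isZero_tor_of_projective [Module.Projective B (resB k A B X)] (V : ModuleCat.{u} Bᵐᵒᵖ)
    (i : ℕ) : Limits.IsZero ((torFunctor A (A ⊗[k] B) (Induced k A V) (i + 1)).obj X) := by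
  obtain ⟨P, d, π, hP, hπ, hd₀, hd, htor⟩ := exists_resolution k X
  let C : ℕ → ModuleCat.{u} (A ⊗[k] B) := fun n => ModuleCat.of _ (P n ⧸ LinearMap.range (d n))
  let I : ℕ → ModuleCat.{u} (A ⊗[k] B) := fun n => ModuleCat.of _ (LinearMap.range (d n))
  have hI : ∀ n, Module.Projective B (resB k A B (C n)) →
      Module.Projective B (resB k A B (I n)) := by
    intro n hn
    have := resB_projective k (P n)
    let c : P n →ₗ[A ⊗[k] B] C n := (LinearMap.range (d n)).mkQ
    let j : I n →ₗ[A ⊗[k] B] P n := (LinearMap.range (d n)).subtype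
    have s : SES j c := ⟨Subtype.val_injective, fun z => by simp [j, c, C, I],
      Submodule.mkQ_surjective _⟩
    exact projective_left_of_ses (s.restrictB k)
  have hC : ∀ n, Module.Projective B (resB k A B (C n)) := by
    intro n
    induction n with
    | zero =>
      have e : X ≃ₗ[A ⊗[k] B] C 0 :=
        ((Submodule.quotEquivOfEq _ _ (LinearMap.exact_iff.1 hd₀).symm).trans
          (π.quotKerEquivOfSurjective hπ)).symm
      exact projective_resB_congr k e
    | succ n ih =>
      have := hI n ih
      have e : I n ≃ₗ[A ⊗[k] B] C (n + 1) :=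
        ((Submodule.quotEquivOfEq _ _ (LinearMap.exact_iff.1 (hd n)).symm).trans
          (d n).quotKerEquivRange).symm
      exact projective_resB_congr k e
  exact (htor V i).2 (indMap_exact k (hd i) (hI i (hC i)) (hC i) V)

/-- If every `B`-linear map from `X` to a simple module extends to `Y`, then so does every map to
a finite-dimensional module, by induction on the dimension. -/
theorem extend_of_extend_simple {U W : ModuleCat.{u} B} [FiniteDimensional k B]
    [Module.Projective B W] (f : U →ₗ[B] W)
    (h : ∀ S : ModuleCat.{u} B, IsSimpleModule B S → ∀ g : U →ₗ[B] S, ∃ g' : W →ₗ[B] S, g' ∘ₗ f = g)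
    (n : ℕ) : ∀ (N : ModuleCat.{u} B), FiniteDimensional k N → Module.finrank k N ≤ n →
      ∀ g : U →ₗ[B] N, ∃ g' : W →ₗ[B] N, g' ∘ₗ f = g := by
  induction n with
  | zero =>
    intro N _ hN g
    have : Subsingleton N := Module.finrank_zero_iff.1 (Nat.le_zero.1 hN)
    exact ⟨0, LinearMap.ext fun _ => Subsingleton.elim _ _⟩
  | succ n ih =>
    intro N hfd hN g
    by_cases hs : Subsingleton N
    · exact ⟨0, LinearMap.ext fun _ => Subsingleton.elim _ _⟩
    have : Nontrivial N := not_subsingleton_iff_nontrivial.1 hs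
    have := finite_of_finiteDimensional k (R := B) N
    obtain ⟨M, hM⟩ : ∃ M : Submodule B N, IsCoatom M := IsCoatomic.exists_coatom _
    let N' : ModuleCat.{u} B := ModuleCat.of B M
    let S : ModuleCat.{u} B := ModuleCat.of B (N ⧸ M)
    have hS : IsSimpleModule B S := isSimpleModule_iff_isCoatom.2 hM
    let l : N' →ₗ[B] N := M.subtype
    let q : N →ₗ[B] S := M.mkQ
    have s : SES l q := ⟨Subtype.val_injective, fun z => by simp [l, q, S, N'],
      Submodule.mkQ_surjective _⟩
    obtain ⟨G, hG⟩ := h S hS (q ∘ₗ g)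
    obtain ⟨G', hG'⟩ := Module.projective_lifting_property q G s.surj
    obtain ⟨g₁, hg₁⟩ := s.ofLift (g - G' ∘ₗ f) (by
      rw [LinearMap.comp_sub, ← LinearMap.comp_assoc, hG', hG, sub_self])
    have hfd' : FiniteDimensional k N' :=
      FiniteDimensional.of_injective (l.restrictScalars k) s.inj
    have hlt : Module.finrank k N' < Module.finrank k N := by
      refine lt_of_le_of_ne (LinearMap.finrank_le_finrank_of_injective
        (f := l.restrictScalars k) s.inj) fun heq => hM.1 ?_
      have := (LinearMap.injective_iff_surjective_of_finrank_eq_finrank heq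
        (f := l.restrictScalars k)).1 s.inj
      rw [eq_top_iff]
      rintro x -
      obtain ⟨y, rfl⟩ := this x
      exact y.2
    obtain ⟨g₂, hg₂⟩ := ih N' hfd' (by omega) g₁
    refine ⟨l ∘ₗ g₂ + G', ?_⟩
    rw [LinearMap.add_comp, LinearMap.comp_assoc, hg₂, hg₁, sub_add_cancel]

/-- Let `0 → I → P₀ → X → 0` be exact with `P₀` projective. If `Tor_1(A ⊗ D(S), X) = 0`, then
`D(S) ⊗_B I → D(S) ⊗_B P₀` is a monomorphism, so `B`-linear maps `I → S` extend to `P₀`. If this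
holds for all simple `S`, it holds for all finite-dimensional targets, in particular for the kernel
of a finitely generated presentation of `X`, which then splits over `B`. -/
theorem projective_of_isZero_tor [FiniteDimensional k A] [FiniteDimensional k B]
    [Module.Finite (A ⊗[k] B) X]
    (h : ∀ S : ModuleCat.{u} B, IsSimpleModule B S →
      Limits.IsZero ((torFunctor A (A ⊗[k] B) (Induced k A (dual k B S)) 1).obj X)) :
    Module.Projective B (resB k A B X) := by
  obtain ⟨P, d, π, hP, hπ, hd₀, hd, htor⟩ := exists_resolution k X
  let I : ModuleCat.{u} (A ⊗[k] B) := ModuleCat.of _ (LinearMap.ker π)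
  let j : I →ₗ[A ⊗[k] B] P 0 := (LinearMap.ker π).subtype
  have sI : SES j π := SES.ker hπ
  let p : P 1 →ₗ[A ⊗[k] B] I := (d 0).codRestrict _ fun x => hd₀.apply_apply_eq_zero x
  have hp : Function.Surjective p := by
    rintro ⟨y, hy⟩
    obtain ⟨x, rfl⟩ := (hd₀ y).1 hy
    exact ⟨x, rfl⟩
  have hpd : p ∘ₗ d 1 = 0 := LinearMap.ext fun x => Subtype.ext ((hd 0).apply_apply_eq_zero x)
  have hPB := resB_projective k (P 0)
  have hext : ∀ N : ModuleCat.{u} B, FiniteDimensional k N → ∀ g : resB k A B I →ₗ[B] N,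
      ∃ g' : resB k A B (P 0) →ₗ[B] N, g' ∘ₗ resBMap k j = g := by
    refine fun N hN => extend_of_extend_simple k (resBMap k j) (fun S hS g => ?_) _ N hN le_rfl
    have : Module.Finite B S := inferInstance
    have := finiteDimensional_of_finite k S
    refine extend_of_indMap_injective k ((injective_iff_map_eq_zero _).2 fun z hz => ?_) g
    obtain ⟨w, rfl⟩ := indMap_surjective k (V := dual k B S) hp z
    have hw : indMap k (dual k B S) (d 0) w = 0 :=
      (indMap_comp k j p w).trans hz
    obtain ⟨v, rfl⟩ := ((htor _ 0).1 (h S hS) w).1 hw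
    refine (indMap_comp k p (d 1) v).symm.trans ?_
    rw [hpd]
    refine indTensor_induction k v (fun ξ y => ?_) (fun x y hx hy => ?_)
    · rw [indMap_pure, LinearMap.zero_apply]
      exact map_zero (pureHom k _ _ ξ)
    · rw [map_add, hx, hy, add_zero]
  -- pass to a finitely generated presentation
  obtain ⟨n, q, hq⟩ := Module.Finite.exists_fin' (A ⊗[k] B) X
  have : IsNoetherianRing (A ⊗[k] B) := IsNoetherianRing.of_finite k _
  let Q : ModuleCat.{u} (A ⊗[k] B) := ModuleCat.of _ (Fin n → A ⊗[k] B)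
  have hQ : Module.Projective (A ⊗[k] B) Q :=
    inferInstanceAs (Module.Projective _ (Fin n → A ⊗[k] B))
  have hQf : Module.Finite (A ⊗[k] B) Q := inferInstanceAs (Module.Finite _ (Fin n → A ⊗[k] B))
  let K : ModuleCat.{u} (A ⊗[k] B) := ModuleCat.of _ (LinearMap.ker q)
  let l : K →ₗ[A ⊗[k] B] Q := (LinearMap.ker q).subtype
  have sK : SES (X := K) (Y := Q) (Z := X) l q := SES.ker hq
  have hK : Module.Finite (A ⊗[k] B) K := Module.Finite.of_injective l sK.inj
  obtain ⟨u, hu⟩ := Module.projective_lifting_property π (show Q →ₗ[A ⊗[k] B] X from q) hπ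
  obtain ⟨v, hv⟩ := Module.projective_lifting_property (show Q →ₗ[A ⊗[k] B] X from q) π hq
  obtain ⟨a, ha⟩ := sI.ofLift (u ∘ₗ l) (by
    rw [← LinearMap.comp_assoc, hu]
    exact LinearMap.ext fun x => sK.exact.apply_apply_eq_zero x)
  obtain ⟨b, hb⟩ := sK.ofLift (v ∘ₗ j) (by
    rw [← LinearMap.comp_assoc, hv]
    exact LinearMap.ext fun x => sI.exact.apply_apply_eq_zero x)
  obtain ⟨c, hc⟩ := sK.ofLift (LinearMap.id - v ∘ₗ u) (by
    rw [LinearMap.comp_sub, ← LinearMap.comp_assoc, hv, hu, LinearMap.comp_id, sub_self])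
  have := resB_finite k K
  obtain ⟨b', hb'⟩ := hext (resB k A B K) (finiteDimensional_of_finite k _) (resBMap k b)
  -- on `K`, the map `c + b' u` is `(1 - v u) + v u = 1`
  have hr : (resBMap k c + b' ∘ₗ resBMap k u) ∘ₗ resBMap k l = LinearMap.id := by
    refine LinearMap.ext fun x => ?_
    have e₁ : b' (resBMap k u (resBMap k l x)) = resBMap k b (resBMap k a x) :=
      (congrArg b' (LinearMap.congr_fun ha x).symm).trans (LinearMap.congr_fun hb' _)
    refine (sK.restrictB k).inj ?_
    change resBMap k l (resBMap k c (resBMap k l x) + b' (resBMap k u (resBMap k l x))) =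
      resBMap k l x
    rw [e₁, map_add]
    have e₂ : l (c (l x)) = l x - v (u (l x)) := LinearMap.congr_fun hc (l x)
    have e₃ : l (b (a x)) = v (u (l x)) :=
      (LinearMap.congr_fun hb (a x)).trans (congrArg v (LinearMap.congr_fun ha x))
    change l (c (l x)) + l (b (a x)) = l x
    rw [e₂, e₃, sub_add_cancel]
  have := resB_projective k Q
  exact projective_right_of_ses (sK.restrictB k) hr

/-- The finitely generated right `B`-modules are the modules `D(N)`, for finitely generated `N`. -/
theorem monOver_gproj_iff [FiniteDimensional k A] [FiniteDimensional k B] :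
    monOver k B (gproj A) X ↔ IsMonModule k X := by
  constructor
  · rintro ⟨⟨hf, htor⟩, hV⟩
    refine ⟨hf, projective_of_isZero_tor k fun S hS => htor S hS 1 le_rfl, fun N hN => hV _ ?_⟩
    have := finiteDimensional_of_finite k N
    have := dual_finiteDimensional k (N := N)
    exact finite_of_finiteDimensional k _
  · rintro ⟨hf, hp, hN⟩
    refine ⟨⟨hf, fun S _ i hi => ?_⟩, fun V hV => ?_⟩
    · obtain ⟨i, rfl⟩ := Nat.exists_eq_add_of_le' hi
      exact isZero_tor_of_projective k _ i
    · have : FiniteDimensional k Bᵐᵒᵖ := inferInstance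
      have := finiteDimensional_of_finite k V
      let e := evalDualEquiv k V
      let E : indTensor k (dual k B (predual k V)) X ≃ₗ[A] indTensor k V X :=
        LinearEquiv.ofLinearMap (indMapLeft k X e.symm.toLinearMap) (indMapLeft k X e.toLinearMap)
          (LinearMap.ext fun z => by
            rw [LinearMap.comp_apply, indMapLeft_comp, LinearEquiv.symm_comp, indMapLeft_id]; rfl)
          (LinearMap.ext fun z => by
            rw [LinearMap.comp_apply, indMapLeft_comp, LinearEquiv.comp_symm, indMapLeft_id]; rfl)
      exact gproj_congr (hN _ (finite_of_finiteDimensional k _)) E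

end TorVanishing

/-! ### Gorenstein projective modules when `B` has finite global dimension -/

section FiniteGlobalDimension

theorem exists_hasProjectiveDimensionLT_of_gldim {R : Type u} [Ring R] (h : gldim R < ⊤) :
    ∃ d : ℕ, ∀ M : ModuleCat.{u} R, Module.Finite R M → HasProjectiveDimensionLT M (d + 1) := by
  obtain ⟨d, hd⟩ : ∃ d : ℕ, gldim R ≤ d := by
    generalize gldim R = x at h
    induction x with
    | bot => exact ⟨0, bot_le⟩
    | coe x =>
      induction x with
      | top => exact absurd h (lt_irrefl _)
      | coe d => exact ⟨d, le_rfl⟩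
  exact ⟨d, fun M hM => (projectiveDimension_le_iff M d).1
    ((le_iSup₂ (f := fun (M : ModuleCat.{u} R) (_ : Module.Finite R M) => projectiveDimension M)
      M hM).trans hd)⟩

theorem gldim_le {R : Type u} [Ring R] {d : ℕ}
    (h : ∀ M : ModuleCat.{u} R, Module.Finite R M → HasProjectiveDimensionLT M (d + 1)) :
    gldim R ≤ d :=
  iSup₂_le fun M hM => (projectiveDimension_le_iff M d).2 (h M hM)

variable (k : Type u) {A B : Type u} [Field k] [Ring A] [Algebra k A] [Ring B] [Algebra k B]

/-- A Gorenstein projective module over `A ⊗ B` is a syzygy of arbitrarily high order over `B`. -/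
theorem projective_resB_of_gproj {d : ℕ}
    (hd : ∀ X : ModuleCat.{u} (A ⊗[k] B), gproj (A ⊗[k] B) X →
      HasProjectiveDimensionLT (resB k A B X) (d + 1))
    {X : ModuleCat.{u} (A ⊗[k] B)} (hX : gproj (A ⊗[k] B) X) :
    Module.Projective B (resB k A B X) := by
  induction d with
  | zero =>
    have := hd X hX
    exact (IsProjective.iff_projective _).2 (projective_iff_hasProjectiveDimensionLT_one.2 this)
  | succ d ih =>
    refine ih fun X hX => ?_
    obtain ⟨Y, hY, Q, f, g, _, _, s, -⟩ := exists_cosyzygy_of_gproj hX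
    have := resB_projective k Q
    exact ((s.restrictB k).shortExact.hasProjectiveDimensionLT_X₃_iff d
      ((IsProjective.iff_projective (resB k A B Q)).1 inferInstance)).1 (hd Y hY)

/-- Maps from `D(N) ⊗_B X` to `A` correspond to maps from `X` to `A ⊗_k N`, which extend when
`Ext^1(Y, A ⊗_k N)` vanishes. -/
theorem IsCosyzygy.indTensor [FiniteDimensional k A] [FiniteDimensional k B]
    {N : ModuleCat.{u} B} [FiniteDimensional k N] {X Y : ModuleCat.{u} (A ⊗[k] B)}
    (h : IsCosyzygy (A ⊗[k] B) X Y) [Module.Projective B (resB k A B Y)]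
    (hY : ExtZero Y (outer k (ModuleCat.of A A) N) 1) :
    IsCosyzygy A (indTensor k (dual k B N) X) (indTensor k (dual k B N) Y) := by
  obtain ⟨Q, f, g, _, _, s, -⟩ := h
  obtain ⟨h₁, h₂⟩ := indTensor_finite_projective k (N := N) Q
  exact ⟨_, _, _, h₁, h₂, s.tensorRight k _,
    extend_indTensor_of_extend k (P := ModuleCat.of A A) f fun ψ => s.exists_extend hY ψ⟩

theorem HasFiniteProjRes.outer [FiniteDimensional k A] [FiniteDimensional k B] {n : ℕ}
    {N : ModuleCat.{u} B} (h : HasFiniteProjRes B n N) :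
    HasFiniteProjRes (A ⊗[k] B) n (outer k (ModuleCat.of A A) N) := by
  have hA : Module.Finite A (ModuleCat.of A A) := inferInstanceAs (Module.Finite A A)
  induction n generalizing N with
  | zero =>
    obtain ⟨_, _⟩ := h
    exact ⟨outer_finite k _ N, outer_projective_right k N⟩
  | succ n ih =>
    obtain ⟨K, P, f, g, hK, _, _, s⟩ := h
    exact ⟨_, _, _, _, ih hK, outer_finite k _ P, outer_projective_right k P, s.outerTensor k _⟩

/-- As `N` has finite projective dimension, so has `A ⊗_k N` over `A ⊗ B`, and `Ext^i(X, A ⊗_k N)`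
vanishes for Gorenstein projective `X`. Hence `D(N) ⊗_B -` carries complete projective resolutions
over `A ⊗ B` to complete projective resolutions over `A`. -/
theorem isMonModule_of_gproj [FiniteDimensional k A] [FiniteDimensional k B] (hB : gldim B < ⊤)
    {X : ModuleCat.{u} (A ⊗[k] B)} (hX : gproj (A ⊗[k] B) X) : IsMonModule k X := by
  have : IsNoetherianRing B := IsNoetherianRing.of_finite k B
  obtain ⟨d, hd⟩ := exists_hasProjectiveDimensionLT_of_gldim hB
  have hproj : ∀ Y : ModuleCat.{u} (A ⊗[k] B), gproj (A ⊗[k] B) Y →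
      Module.Projective B (resB k A B Y) := fun Y hY =>
    projective_resB_of_gproj k (d := d) (fun Z hZ => by
      have := hZ.1
      exact hd _ (resB_finite k Z)) hY
  refine ⟨hX.1, hproj X hX, fun N hN => ?_⟩
  have := finiteDimensional_of_finite k N
  have hres := (hasFiniteProjRes_of_hasProjectiveDimensionLT hN (hd N hN)).outer k (A := A)
  have key : ∀ Y Z : ModuleCat.{u} (A ⊗[k] B), gproj (A ⊗[k] B) Z → IsCosyzygy (A ⊗[k] B) Y Z →
      IsCosyzygy A (indTensor k (dual k B N) Y) (indTensor k (dual k B N) Z) :=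
    fun Y Z hZ h => by
      have := hproj Z hZ
      exact h.indTensor k (hres.extZero (extZero_of_gproj hZ) 0)
  refine gproj_of_class (fun G => ∃ Y, gproj (A ⊗[k] B) Y ∧ G = indTensor k (dual k B N) Y)
    ?_ ?_ ⟨X, hX, rfl⟩
  · rintro _ ⟨Y, hY, rfl⟩
    obtain ⟨Z, hZ, h⟩ := exists_cosyzygy_of_gproj hY
    exact ⟨_, ⟨Z, hZ, rfl⟩, key Y Z hZ h⟩
  · rintro _ ⟨Z, hZ, rfl⟩
    obtain ⟨Y, hY, h⟩ := exists_syzygy_of_gproj hZ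
    exact ⟨_, ⟨Y, hY, rfl⟩, key Y Z hZ h⟩

end FiniteGlobalDimension

/-! ### The modules `A ⊗ M` -/

section OuterGproj

variable (k : Type u) {A B : Type u} [Field k] [Ring A] [Algebra k A] [Ring B] [Algebra k B]

variable (A) in
/-- Maps from `A ⊗ M` to `A ⊗ B` are `B`-linear maps from `M` to `A ⊗ B`, which is a finitely
generated projective `B`-module. -/
theorem IsCosyzygy.outerTensor [FiniteDimensional k A] [FiniteDimensional k B]
    {M M' : ModuleCat.{u} B} (h : IsCosyzygy B M M') :
    IsCosyzygy (A ⊗[k] B) (outer k (ModuleCat.of A A) M) (outer k (ModuleCat.of A A) M') := by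
  have hM' := h.extZero
  obtain ⟨Q, f, g, _, _, s, -⟩ := h
  have hA : Module.Finite A (ModuleCat.of A A) := inferInstanceAs (Module.Finite A A)
  let L : ModuleCat.{u} (A ⊗[k] B) := ModuleCat.of (A ⊗[k] B) (A ⊗[k] B)
  have hL : Module.Finite (A ⊗[k] B) L := inferInstanceAs (Module.Finite (A ⊗[k] B) (A ⊗[k] B))
  have hLB : Module.Projective B (resB k A B L) := resB_regular_projective k A B
  have := resB_finite k L
  refine ⟨_, _, _, outer_finite k _ Q, outer_projective_right k Q, s.outerTensor k _, fun φ => ?_⟩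
  let φ₁ : outer k (ModuleCat.of A A) M →ₗ[A ⊗[k] B] L := φ
  let φ₀ : M →ₗ[B] resB k A B L :=
    { toFun := fun m => outB.symm (φ₁ (outerMk k (P := ModuleCat.of A A) (1 : A) m))
      map_add' := fun m m' => by rw [outerMk_add_right, map_add, map_add]
      map_smul' := fun b m => by
        have := outer_smul k (1 : A) b (1 : ModuleCat.of A A) m
        rw [one_smul] at this
        rw [← this, map_smul]; rfl }
  obtain ⟨ψ₀, hψ₀⟩ := s.exists_extend hM'.of_projective φ₀
  refine ⟨outerHomRight k ψ₀, outer_hom_ext_linear k (Z := L) fun (a : A) m => ?_⟩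
  change (a ⊗ₜ[k] (1 : B)) • outB (ψ₀ (f m)) = φ₁ (outerMk k (P := ModuleCat.of A A) a m)
  rw [show ψ₀ (f m) = φ₀ m from LinearMap.congr_fun hψ₀ m]
  change (a ⊗ₜ[k] (1 : B)) • φ₁ (outerMk k (P := ModuleCat.of A A) (1 : A) m) = _
  rw [← map_smul, outer_smul, one_smul]
  change φ₁ (outerMk k (P := ModuleCat.of A A) (a * 1) m) = _
  rw [mul_one]

variable (A) in
theorem gproj_outer [FiniteDimensional k A] [FiniteDimensional k B] {M : ModuleCat.{u} B}
    (hM : gproj B M) : gproj (A ⊗[k] B) (outer k (ModuleCat.of A A) M) := by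
  refine gproj_of_class (fun G => ∃ M, gproj B M ∧ G = outer k (ModuleCat.of A A) M)
    ?_ ?_ ⟨M, hM, rfl⟩
  · rintro _ ⟨Y, hY, rfl⟩
    obtain ⟨Z, hZ, h⟩ := exists_cosyzygy_of_gproj hY
    exact ⟨_, ⟨Z, hZ, rfl⟩, h.outerTensor k A⟩
  · rintro _ ⟨Z, hZ, rfl⟩
    obtain ⟨Y, hY, h⟩ := exists_syzygy_of_gproj hZ
    exact ⟨_, ⟨Y, hY, rfl⟩, h.outerTensor k A⟩

variable (A) in
/-- `M` is a direct summand of `A ⊗ M` over `B`, as `k` is a direct summand of `A`. -/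
theorem projective_of_resB_outer [Nontrivial A] {M : ModuleCat.{u} B}
    (h : Module.Projective B (resB k A B (outer k (ModuleCat.of A A) M))) :
    Module.Projective B M := by
  obtain ⟨l, hl⟩ := LinearMap.exists_leftInverse_of_injective (Algebra.linearMap k A)
    (LinearMap.ker_eq_bot.2 (algebraMap k A).injective)
  have hl1 : l 1 = 1 := by
    have := LinearMap.congr_fun hl 1
    rwa [LinearMap.comp_apply, Algebra.linearMap_apply, map_one] at this
  let i : M →ₗ[B] resB k A B (outer k (ModuleCat.of A A) M) :=
    { toFun := fun m => outB.symm (outerMk k (P := ModuleCat.of A A) (1 : A) m)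
      map_add' := fun m m' => by rw [outerMk_add_right, map_add]
      map_smul' := fun b m => by
        have := outer_smul k (1 : A) b (1 : ModuleCat.of A A) m
        rw [one_smul] at this
        rw [← this]; rfl }
  let p₀ : outer k (ModuleCat.of A A) M →+ M := outerLift k
    (biadditive (fun (a : A) m => l a • m) (fun (a a' : A) m => by rw [map_add, add_smul])
      (fun (a : A) m m' => smul_add _ _ _))
    (fun c (a : A) m => by
      change l (algebraMap k A c * a) • m = l a • c • m
      rw [← Algebra.smul_def, map_smul, smul_smul, smul_eq_mul, mul_comm])
  let p : resB k A B (outer k (ModuleCat.of A A) M) →ₗ[B] M :=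
    { toFun := fun z => p₀ (outB z)
      map_add' := fun z z' => by rw [map_add, map_add]
      map_smul' := fun b z => by
        rw [outB_smul]
        refine outer_induction k (outB z) ?_ (fun (a : A) m => ?_) (fun x y hx hy => ?_)
        · rw [smul_zero, map_zero, smul_zero]
        · rw [outer_smul, one_smul]
          change l a • (b • m) = b • (l a • m)
          rw [← algebraMap_smul_moduleCat, ← algebraMap_smul_moduleCat, smul_smul, smul_smul,
            Algebra.commutes]
        · rw [smul_add, map_add, hx, hy, map_add, smul_add] }
  refine Module.Projective.of_split i p (LinearMap.ext fun m => ?_)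
  change l 1 • m = m
  rw [hl1, one_smul]

end OuterGproj

/-! ### Gorenstein algebras -/

section Gorenstein

variable {R : Type u} [Ring R]

/-- Maps from `X` to `I` factor through a finitely generated projective module over `I`, since
`Ext^1(X, -)` vanishes on the first syzygy of `I`. -/
theorem HasFiniteProjRes.exists_factor {n : ℕ} {I X : ModuleCat.{u} R}
    (h : HasFiniteProjRes R n I) (hX : ∀ i, ExtZero X (ModuleCat.of R R) (i + 1))
    (φ : X →ₗ[R] I) : ∃ (P : ModuleCat.{u} R) (ψ : X →ₗ[R] P) (g : P →ₗ[R] I),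
      Module.Finite R P ∧ Module.Projective R P ∧ g ∘ₗ ψ = φ := by
  cases n with
  | zero => exact ⟨I, φ, LinearMap.id, h.1, h.2, rfl⟩
  | succ n =>
    obtain ⟨K, P, f, g, hK, hP, hP', s⟩ := h
    obtain ⟨ψ, hψ⟩ := s.exists_lift (hK.extZero hX 0) φ
    exact ⟨P, ψ, g, hP, hP', hψ⟩

/-- A dual basis argument: all maps from `X` to `B` factor through a single map to a finitely
generated free module. -/
theorem exists_left_approximation (k : Type u) {B : Type u} [Field k] [Ring B] [Algebra k B]
    [FiniteDimensional k B] (X : ModuleCat.{u} B) [Module.Finite B X] :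
    ∃ (m : ℕ) (Φ : X →ₗ[B] (Fin m → B)),
      ∀ φ : X →ₗ[B] B, ∃ ψ : (Fin m → B) →ₗ[B] B, ψ ∘ₗ Φ = φ := by
  have := finiteDimensional_of_finite k X
  have : FiniteDimensional k (X →ₗ[B] B) :=
    Module.Finite.of_injective (LinearMap.restrictScalarsₗ k B X B k)
      (LinearMap.restrictScalars_injective k)
  let e := Module.finBasis k (X →ₗ[B] B)
  refine ⟨_, LinearMap.pi fun j => e j, fun φ => ⟨∑ j, e.repr φ j • LinearMap.proj j, ?_⟩⟩
  ext x
  have h : ∑ j, e.repr φ j • e j x = φ x := by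
    refine Eq.trans ?_ (LinearMap.congr_fun (e.sum_repr φ) x)
    rw [LinearMap.sum_apply]; rfl
  simpa using h

theorem hasInjectiveDimensionLT_pi {n : ℕ} {N : ModuleCat.{u} R} (h : HasInjectiveDimensionLT N n)
    (m : ℕ) : HasInjectiveDimensionLT (ModuleCat.of R (Fin m → N)) n := by
  rw [hasInjectiveDimensionLT_iff.{u}]
  intro i hi Y e
  have : ExtZero Y N i := HasInjectiveDimensionLT.subsingleton N n i hi Y
  exact (extZero_pi this m).eq_zero e

theorem exists_hasInjectiveDimensionLT {N : ModuleCat.{u} R} (h : injectiveDimension N < ⊤) :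
    ∃ n : ℕ, HasInjectiveDimensionLT N (n + 1) :=
  (injectiveDimension_ne_top_iff N).1 h.ne

/-- If `B` has finite injective dimension as a right module, then every finitely generated left
module embeds into one of finite projective dimension, the dual of a free right module. -/
theorem exists_embedding_hasFiniteProjRes (k : Type u) {B : Type u} [Field k] [Ring B] [Algebra k B]
    [FiniteDimensional k B] (hB : injectiveDimension (ModuleCat.of Bᵐᵒᵖ B) < ⊤)
    (X : ModuleCat.{u} B) [Module.Finite B X] :
    ∃ (n : ℕ) (I : ModuleCat.{u} B) (φ : X →ₗ[B] I), HasFiniteProjRes B n I ∧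
      Function.Injective φ := by
  have : IsNoetherianRing B := IsNoetherianRing.of_finite k B
  obtain ⟨n, hn⟩ := exists_hasInjectiveDimensionLT hB
  have := finiteDimensional_of_finite k X
  have := dual_finiteDimensional k (N := X)
  have := finite_of_finiteDimensional k (dual k B X)
  obtain ⟨m, q, hq⟩ := Module.Finite.exists_fin' Bᵐᵒᵖ (dual k B X)
  let e : B ≃ₗ[Bᵐᵒᵖ] Bᵐᵒᵖ :=
    { MulOpposite.opAddEquiv with map_smul' := fun _ _ => rfl }
  let V : ModuleCat.{u} Bᵐᵒᵖ := ModuleCat.of Bᵐᵒᵖ (Fin m → Bᵐᵒᵖ)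
  let q' : V →ₗ[Bᵐᵒᵖ] dual k B X := q
  have hBo := hasInjectiveDimensionLT_of_iso
    (show ModuleCat.of Bᵐᵒᵖ B ≅ ModuleCat.of Bᵐᵒᵖ Bᵐᵒᵖ from e.toModuleIso) (n + 1)
  have hV : HasInjectiveDimensionLT V (n + 1) := hasInjectiveDimensionLT_pi hBo m
  have hVf : Module.Finite Bᵐᵒᵖ V := inferInstanceAs (Module.Finite Bᵐᵒᵖ (Fin m → Bᵐᵒᵖ))
  have := finiteDimensional_of_finite k V
  have hVd := hasInjectiveDimensionLT_of_iso
    (show V ≅ dual k B (predual k V) from (evalDualEquiv k V).toModuleIso) (n + 1)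
  have hIf : Module.Finite B (predual k V) := finite_of_finiteDimensional k _
  exact ⟨n, predual k V, transpose k q',
    hasFiniteProjRes_of_hasProjectiveDimensionLT hIf (hasProjectiveDimensionLT_of_dual k hVd),
    transpose_injective k hq⟩

/-- Over an algebra of finite right injective dimension, the modules `X` with
`Ext^i(X, B) = 0` for all `i ≥ 1` are Gorenstein projective. -/
theorem gproj_of_extZero (k : Type u) {B : Type u} [Field k] [Ring B] [Algebra k B]
    [FiniteDimensional k B] (hB : injectiveDimension (ModuleCat.of Bᵐᵒᵖ B) < ⊤)
    {X : ModuleCat.{u} B} (hf : Module.Finite B X)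
    (hX : ∀ i, ExtZero X (ModuleCat.of B B) (i + 1)) : gproj B X := by
  have : IsNoetherianRing B := IsNoetherianRing.of_finite k B
  refine gproj_of_class (fun X => Module.Finite B X ∧
    ∀ i, ExtZero X (ModuleCat.of B B) (i + 1)) ?_ ?_ ⟨hf, hX⟩
  -- the embedding `X → P` gives injectivity, `Φ` the extension of maps to `B`
  · rintro X ⟨hf, hX⟩
    obtain ⟨n, I, φ, hI, hφ⟩ := exists_embedding_hasFiniteProjRes k hB X
    obtain ⟨P, ψ, g, _, _, hψ⟩ := hI.exists_factor hX φ
    obtain ⟨m, Φ, hΦ⟩ := exists_left_approximation k X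
    let Q : ModuleCat.{u} B := ModuleCat.of B (P × (Fin m → B))
    let f : X →ₗ[B] Q := ψ.prod Φ
    have hinj : Function.Injective f := fun x x' h => by
      have h1 : ψ x = ψ x' := congrArg Prod.fst h
      refine hφ ?_
      rw [← hψ, LinearMap.comp_apply, h1]; rfl
    let Y : ModuleCat.{u} B := ModuleCat.of B (Q ⧸ LinearMap.range f)
    have s : SES (X := X) (Y := Q) (Z := Y) f (LinearMap.range f).mkQ := SES.coker hinj
    have hQf : Module.Finite B Q := inferInstanceAs (Module.Finite B (P × (Fin m → B)))
    have hQ : Module.Projective B Q := inferInstanceAs (Module.Projective B (P × (Fin m → B)))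
    have hext : ∀ χ : X →ₗ[B] B, ∃ χ' : Q →ₗ[B] B, χ' ∘ₗ f = χ := fun χ => by
      obtain ⟨χ', hχ'⟩ := hΦ χ
      exact ⟨χ' ∘ₗ LinearMap.snd B P (Fin m → B), hχ'⟩
    have hY : ExtZero Y (ModuleCat.of B B) 1 :=
      s.extZero_of_extend (Z := Y) (extZero_of_projective 0) hext
    refine ⟨Y, ⟨Module.Finite.of_surjective _ s.surj, fun i => ?_⟩,
      s.isCosyzygy (Y := Y) hY⟩
    cases i with
    | zero => exact hY
    | succ i => exact s.extZero_right (Z := Y) (hX i) (extZero_of_projective (i + 1))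
  · rintro Y ⟨hf, hY⟩
    obtain ⟨n, p, hp⟩ := Module.Finite.exists_fin' B Y
    let Q := ModuleCat.of B (Fin n → B)
    let K := ModuleCat.of B (LinearMap.ker p)
    have s : SES (X := K) (Y := Q) (Z := Y) (LinearMap.ker p).subtype p := SES.ker hp
    have hQ : Module.Projective B Q := inferInstanceAs (Module.Projective B (Fin n → B))
    have hQf : Module.Finite B Q := inferInstanceAs (Module.Finite B (Fin n → B))
    exact ⟨K, ⟨inferInstanceAs (Module.Finite B (LinearMap.ker p)), fun i =>
      s.extZero_left (X := K) (Y := Q) (extZero_of_projective i) (hY (i + 1))⟩,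
      s.isCosyzygy (X := K) (Q := Q) (hY 0)⟩

/-- Suppose that every finitely generated `X` with `Ext^i(X, R) = 0` for all `i ≥ 1` is
projective. If `Ext^i(M, R) = 0` for all `i > n`, then the `n`-th syzygy of `M` is such an `X`. -/
theorem hasProjectiveDimensionLT_of_extZero
    (h : ∀ X : ModuleCat.{u} R, Module.Finite R X →
      (∀ i, ExtZero X (ModuleCat.of R R) (i + 1)) → Module.Projective R X) [IsNoetherianRing R]
    {n : ℕ} {M : ModuleCat.{u} R} (hM : Module.Finite R M)
    (hn : ∀ i, ExtZero M (ModuleCat.of R R) (n + i + 1)) : HasProjectiveDimensionLT M (n + 1) := by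
  induction n generalizing M with
  | zero =>
    have := h M hM fun i => by simpa using hn i
    exact projective_iff_hasProjectiveDimensionLT_one.1 ((IsProjective.iff_projective M).1 this)
  | succ n ih =>
    obtain ⟨m, p, hp⟩ := Module.Finite.exists_fin' R M
    let Q := ModuleCat.of R (Fin m → R)
    let K := ModuleCat.of R (LinearMap.ker p)
    have s : SES (X := K) (Y := Q) (Z := M) (LinearMap.ker p).subtype p := SES.ker hp
    have hQ : Module.Projective R Q := inferInstanceAs (Module.Projective R (Fin m → R))
    refine ((SES.shortExact (X := K) (Y := Q) (Z := M) s).hasProjectiveDimensionLT_X₃_iff n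
      ((IsProjective.iff_projective Q).1 hQ)).2 (ih (M := K)
      (inferInstanceAs (Module.Finite R (LinearMap.ker p))) fun i =>
      s.extZero_left (X := K) (Y := Q) (extZero_of_projective (n + i)) ?_)
    have := hn i
    rwa [show n + 1 + i + 1 = n + i + 1 + 1 by ring] at this

/-- A Gorenstein algebra whose Gorenstein projective modules are projective has finite global
dimension. -/
theorem gldim_lt_top_of_isGorenstein (k : Type u) {B : Type u} [Field k] [Ring B] [Algebra k B]
    [FiniteDimensional k B] (hB : IsGorenstein B)
    (h : ∀ M : ModuleCat.{u} B, gproj B M → Module.Projective B M) : gldim B < ⊤ := by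
  have : IsNoetherianRing B := IsNoetherianRing.of_finite k B
  obtain ⟨n, hn⟩ := exists_hasInjectiveDimensionLT hB.1
  refine (gldim_le (d := n) fun M hM => hasProjectiveDimensionLT_of_extZero
    (fun X hf hX => h X (gproj_of_extZero k hB.2 hf hX)) hM fun i =>
    HasInjectiveDimensionLT.subsingleton _ (n + 1) (n + i + 1) (by omega) M).trans_lt ?_
  exact WithBot.coe_lt_coe.2 (ENat.natCast_lt_top n)

end Gorenstein

end MonRep

end

theorem mainTheorem2 (k A B : Type u) [Field k] [Ring A] [Algebra k A] [Ring B] [Algebra k B]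
    [FiniteDimensional k A] [FiniteDimensional k B] [Nontrivial A]
    (hB : MonRep.IsGorenstein B) :
    MonRep.gproj (A ⊗[k] B) = MonRep.monOver k B (MonRep.gproj A) ↔ MonRep.gldim B < ⊤ := by
  constructor
  · intro h
    refine MonRep.gldim_lt_top_of_isGorenstein k hB fun M hM => ?_
    have hM' := MonRep.gproj_outer k A hM
    rw [h, MonRep.monOver_gproj_iff] at hM'
    exact MonRep.projective_of_resB_outer k A hM'.projective
  · intro h
    funext X
    exact propext ⟨fun hX => (MonRep.monOver_gproj_iff k).2 (MonRep.isMonModule_of_gproj k h hX),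
      fun hX => ((MonRep.monOver_gproj_iff k).1 hX).isGproj k⟩
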